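/- Conventions. All groups are finite and all two-cocycles $\psi:G\times G\to\mathbb C^*$ are normalised ($\psi(1,1)=1$). $\mathbb C_\psi G$ is the twisted group algebra, with basis $G$ and product $g\circ h=\psi(g,h)\,gh$. An element $g$ is $\psi$-regular if $\psi(g,h)=\psi(h,g)$ for all $h$ commuting with $g$. $\psi$ is a class-function cocycle if the characters $\chi_M(g)=\operatorname{tr}(g|_M)$ of all finite-dimensional representations $M$ of $\mathbb C_\psi G$ are constant on conjugacy classes of $G$. Let $(U,\omega)$ be a finite-dimensional complex symplectic vector space, and let $G$ act on $U$ through a homomorphism $G\to Sp(U)$. Let $S_\psi(G,U)$ be the set of $\psi$-regular $s\in G$ with $\operatorname{rank}(\mathrm{Id}-s|_U)=2$. For such $s$ let $\omega_s$ be the skew form on $U$ with radical $\operatorname{Ker}(\mathrm{Id}-s)$ that coincides with $\omega$ on $\operatorname{Im}(\mathrm{Id}-s)$. For a class-function cocycle $\psi$ and a conjugation invariant $c:S_\psi(G,U)\to\mathbb C$, the twisted symplectic reflection algebra $\mathcal H_c(G,U,\psi)$ is the quotient of $(TU)\rtimes\mathbb C_\psi G$ by the two-sided ideal generated by $$y\otimes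 x-x\otimes y-\omega(x,y)\cdot 1-\sum_{s\in S_\psi(G,U)}c(s)\,\omega_s(x,y)\,s,\qquad x,y\in U.$$ Theorem. Let $W\subset Sp(U)$ be a subgroup, $\pi:G\twoheadrightarrow W$ a surjective homomorphism from a finite group $G$ (not necessarily injective), $\psi$ a class-function two-cocycle on $G$, and $c:S_\psi(G,U)\to\mathbb C$ a conjugation invariant function. Let $\operatorname{Rep}(G,\psi)$ be the category of finite-dimensional representations of $\mathbb C_\psi G$, considered as a module category over $\operatorname{Rep}(W)$ by the tensor product ($g\in G$ acts on $X\otimes M$ by $\pi(g)\otimes g$), and let $\operatorname{Rep}(G,\psi)=\bigoplus_i\mathcal C_i$ be a decomposition into a (finite) direct sum of indecomposable module categories. Then the regular representation decomposes as $\mathbb C_\psi G=\bigoplus_i \mathbb C_\psi G^{(i)}$ with $\mathbb C_\psi G^{(i)}\in\mathcal C_i$, and there are unique $e_i\in \mathbb C_\psi G^{(i)}$ with $1=\sum_i e_i$. Let $H\subset W$ be a subgroup, $\zeta$ a class-function two-cocycle on $H$, and $F:\mathcal C_i\to\operatorname{Rep}(H,\zeta)$ an equivalence of module categories over $\operatorname{Rep}(W)$.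 Then there are numbers $\alpha_{\widetilde C}(E)$, for conjugacy classes $\widetilde C$ of $G$ and $E$ of $H$, such that for every simple $M\in\mathcal C_i$ and every $g\in \widetilde C$ $$\chi_M(g)=\sum_{E}\alpha_{\widetilde C}(E)\,\chi_{F(M)}(E),$$ the sum being over the conjugacy classes $E$ of $\zeta$-regular elements of $H$ that lie in the $W$-conjugacy class of $\pi(g)$. (In particular $\chi_M(g)=0$ if there is no such $E$.) For any such numbers, the image of $e_i$ in $\mathcal H_c(G,U,\psi)$ is a central idempotent, and the algebra $e_i\mathcal H_c(G,U,\psi)$ is Morita equivalent to $\mathcal H_{c'}(H,U,\zeta)$ (their categories of modules are equivalent as $\mathbb C$-linear categories), where the conjugation invariant function $c':S_\zeta(H,U)\to\mathbb C$ is given on a conjugacy class $E$ of $\zeta$-regular reflections of $H$ by $$c'(E)=\frac{1}{\alpha_{\{1\}}(\{1\})\,|E|}\sum_{\widetilde C}\alpha_{\widetilde C}(E)\,c(\widetilde C)\,|\widetilde C|,$$ the sum being over the conjugacy classes $\widetilde C$ of $G$ contained in $S_\psi(G,U)$ such that $\pi(\widetilde C)$ is the conjugacy class of $W$ containing $E$.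 -/

import Mathlib

noncomputable section

/-- A normalised `ℂˣ`-valued two-cocycle on a group (trivial coefficients). -/
structure TwoCocycle (G : Type) [Group G] where
  toFun : G → G → ℂˣ
  cocycle : ∀ g h k, toFun g h * toFun (g * h) k = toFun h k * toFun g (h * k)
  normalized : toFun 1 1 = 1

namespace TwoCocycle

variable {G : Type} [Group G]

instance : CoeFun (TwoCocycle G) (fun _ => G → G → ℂˣ) := ⟨toFun⟩

theorem one_left (ψ : TwoCocycle G) (g : G) : ψ 1 g = 1 := by
  have h := ψ.cocycle 1 1 g
  simpa [ψ.normalized] using h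

theorem one_right (ψ : TwoCocycle G) (g : G) : ψ g 1 = 1 := by
  have h := ψ.cocycle g 1 1
  simpa [ψ.normalized] using h

/-- `g` is `ψ`-regular if `ψ(g, h) = ψ(h, g)` for every `h` in the centralizer of `g`. -/
def IsRegular (ψ : TwoCocycle G) (g : G) : Prop :=
  ∀ h : G, Commute g h → ψ g h = ψ h g

end TwoCocycle

/-- The twisted crossed product `B ⋊_ψ G` of an algebra `B` on which a group `G` acts by algebra
automorphisms: it has elements `∑ b_g g` with `b_g ∈ B`, and the product is determined by
`(x g) (y h) = ψ(g, h) x (g · y) gh`. -/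
def CrossedProduct {G : Type} [Group G] {B : Type} [Ring B] [Algebra ℂ B]
    (_act : G →* (B ≃ₐ[ℂ] B)) (_ψ : TwoCocycle G) : Type := G →₀ B

namespace CrossedProduct

variable {G : Type} [Group G] {B : Type} [Ring B] [Algebra ℂ B]
  (act : G →* (B ≃ₐ[ℂ] B)) (ψ : TwoCocycle G)

instance : AddCommGroup (CrossedProduct act ψ) := inferInstanceAs (AddCommGroup (G →₀ B))
instance : Module ℂ (CrossedProduct act ψ) := inferInstanceAs (Module ℂ (G →₀ B))

/-- The element `x g`. -/
def single (g : G) (x : B) : CrossedProduct act ψ := Finsupp.single g x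

instance : Mul (CrossedProduct act ψ) where
  mul a b := Finsupp.sum (M := B) a fun g x => Finsupp.sum (M := B) b fun h y =>
    single act ψ (g * h) ((ψ g h : ℂ) • (x * act g y))

instance : One (CrossedProduct act ψ) where
  one := single act ψ 1 1

variable {act ψ}

theorem mul_def (a b : CrossedProduct act ψ) :
    a * b = Finsupp.sum (M := B) a fun g x => Finsupp.sum (M := B) b fun h y =>
      single act ψ (g * h) ((ψ g h : ℂ) • (x * act g y)) := rfl

theorem one_def : (1 : CrossedProduct act ψ) = single act ψ 1 1 := rfl

theorem single_zero (g : G) : single act ψ g 0 = 0 := Finsupp.single_zero g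

theorem single_add (g : G) (x y : B) :
    single act ψ g (x + y) = single act ψ g x + single act ψ g y := Finsupp.single_add g x y

theorem smul_single (c : ℂ) (g : G) (x : B) :
    c • single act ψ g x = single act ψ g (c • x) := Finsupp.smul_single c g x

theorem single_mul_single (g h : G) (x y : B) :
    single act ψ g x * single act ψ h y = single act ψ (g * h) ((ψ g h : ℂ) • (x * act g y)) := by
  rw [mul_def]
  refine (Finsupp.sum_single_index ?_).trans (Finsupp.sum_single_index ?_)
  · exact Finset.sum_eq_zero fun k _ => by simp [single_zero]
  · simp [single_zero]

theorem induction {p : CrossedProduct act ψ → Prop} (a : CrossedProduct act ψ)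
    (h0 : p 0) (hadd : ∀ a b, p a → p b → p (a + b)) (hs : ∀ g x, p (single act ψ g x)) : p a :=
  Finsupp.induction_linear (motive := p) a h0 hadd hs

protected theorem mul_add (a b c : CrossedProduct act ψ) : a * (b + c) = a * b + a * c := by
  simp only [mul_def]
  refine Eq.trans (Finset.sum_congr rfl fun g _ => Finsupp.sum_add_index' (M := B) ?_ ?_)
    (Finset.sum_add_distrib)
  · intro h; simp [single_zero]
  · intro h x y; simp only [map_add, mul_add, smul_add, single_add]

protected theorem add_mul (a b c : CrossedProduct act ψ) : (a + b) * c = a * c + b * c := by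
  simp only [mul_def]
  refine Finsupp.sum_add_index' (M := B) ?_ ?_
  · intro h
    exact Finset.sum_eq_zero fun k _ => by simp [single_zero]
  · intro h x y
    refine Eq.trans (Finset.sum_congr rfl fun k _ => ?_) Finset.sum_add_distrib
    simp only [add_mul, smul_add, single_add]

protected theorem zero_mul (a : CrossedProduct act ψ) : 0 * a = 0 := by
  simpa using CrossedProduct.add_mul 0 0 a

protected theorem mul_zero (a : CrossedProduct act ψ) : a * 0 = 0 := by
  simpa using CrossedProduct.mul_add a 0 0

protected theorem one_mul (a : CrossedProduct act ψ) : 1 * a = a := by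
  refine induction (p := fun a => 1 * a = a) a (CrossedProduct.mul_zero _)
    (fun a b ha hb => by rw [CrossedProduct.mul_add, ha, hb]) fun g x => ?_
  simp [one_def, single_mul_single, ψ.one_left]

protected theorem mul_one (a : CrossedProduct act ψ) : a * 1 = a := by
  refine induction (p := fun a => a * 1 = a) a (CrossedProduct.zero_mul _)
    (fun a b ha hb => by rw [CrossedProduct.add_mul, ha, hb]) fun g x => ?_
  simp [one_def, single_mul_single, ψ.one_right]

protected theorem mul_assoc (a b c : CrossedProduct act ψ) : a * b * c = a * (b * c) := by
  refine induction (p := fun a => a * b * c = a * (b * c)) a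
    (by simp only [CrossedProduct.zero_mul])
    (fun a a' ha ha' => by simp only [CrossedProduct.add_mul, ha, ha']) fun g x => ?_
  refine induction (p := fun b => single act ψ g x * b * c = single act ψ g x * (b * c)) b
    (by simp only [CrossedProduct.zero_mul, CrossedProduct.mul_zero])
    (fun a a' ha ha' => by
      simp only [CrossedProduct.add_mul, CrossedProduct.mul_add, ha, ha']) fun h y => ?_
  refine induction (p := fun c => single act ψ g x * single act ψ h y * c =
      single act ψ g x * (single act ψ h y * c)) c
    (by simp only [CrossedProduct.mul_zero])
    (fun a a' ha ha' => by simp only [CrossedProduct.mul_add, ha, ha']) fun k z => ?_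
  have hc : (ψ g h : ℂ) * ψ (g * h) k = ψ h k * ψ g (h * k) := by
    exact_mod_cast congrArg Units.val (ψ.cocycle g h k)
  simp only [single_mul_single, mul_assoc, map_mul, map_smul, smul_mul_assoc, mul_smul_comm,
    smul_smul, AlgEquiv.mul_apply]
  rw [mul_comm (ψ (g * h) k : ℂ), hc, mul_comm (ψ h k : ℂ)]

instance : Ring (CrossedProduct act ψ) where
  __ := (inferInstance : AddCommGroup (CrossedProduct act ψ))
  left_distrib := CrossedProduct.mul_add
  right_distrib := CrossedProduct.add_mul
  zero_mul := CrossedProduct.zero_mul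
  mul_zero := CrossedProduct.mul_zero
  one_mul := CrossedProduct.one_mul
  mul_one := CrossedProduct.mul_one
  mul_assoc := CrossedProduct.mul_assoc

protected theorem smul_mul (c : ℂ) (a b : CrossedProduct act ψ) : c • a * b = c • (a * b) := by
  refine induction (p := fun a => c • a * b = c • (a * b)) a (by simp)
    (fun a a' ha ha' => by simp only [smul_add, add_mul, ha, ha']) fun g x => ?_
  refine induction (p := fun b => c • single act ψ g x * b = c • (single act ψ g x * b)) b
    (by simp) (fun a a' ha ha' => by simp only [smul_add, mul_add, ha, ha']) fun h y => ?_
  simp only [smul_single, single_mul_single, smul_mul_assoc]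
  rw [smul_comm]

protected theorem mul_smul (c : ℂ) (a b : CrossedProduct act ψ) : a * c • b = c • (a * b) := by
  refine induction (p := fun a => a * c • b = c • (a * b)) a (by simp)
    (fun a a' ha ha' => by simp only [smul_add, add_mul, ha, ha']) fun g x => ?_
  refine induction (p := fun b => single act ψ g x * c • b = c • (single act ψ g x * b)) b
    (by simp) (fun a a' ha ha' => by simp only [smul_add, mul_add, ha, ha']) fun h y => ?_
  simp only [smul_single, single_mul_single, map_smul, mul_smul_comm]
  rw [smul_comm]

instance : Algebra ℂ (CrossedProduct act ψ) :=
  Algebra.ofModule CrossedProduct.smul_mul CrossedProduct.mul_smul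

end CrossedProduct

/-- The twisted group algebra `ℂ_ψ G`: it has the basis `g ∈ G` and `g ∘ h = ψ(g, h) gh`. -/
abbrev TwistedGroupAlgebra {G : Type} [Group G] (ψ : TwoCocycle G) : Type :=
  CrossedProduct (1 : G →* (ℂ ≃ₐ[ℂ] ℂ)) ψ

namespace TwistedGroupAlgebra

variable {G : Type} [Group G] {ψ : TwoCocycle G}

/-- The basis element of `ℂ_ψ G` given by `g`. -/
def of (ψ : TwoCocycle G) (g : G) : TwistedGroupAlgebra ψ := CrossedProduct.single _ _ g 1

theorem of_mul_of (g h : G) : of ψ g * of ψ h = (ψ g h : ℂ) • of ψ (g * h) := by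
  simp [of, CrossedProduct.single_mul_single, CrossedProduct.smul_single]

theorem of_one : of ψ 1 = 1 := rfl

theorem induction {p : TwistedGroupAlgebra ψ → Prop} (a : TwistedGroupAlgebra ψ)
    (h0 : p 0) (hadd : ∀ a b, p a → p b → p (a + b)) (hs : ∀ (c : ℂ) g, p (c • of ψ g)) : p a :=
  CrossedProduct.induction a h0 hadd fun g x => by
    have := hs x g
    rwa [of, CrossedProduct.smul_single, smul_eq_mul, mul_one] at this

/-- The linear extension of a map on the basis `G`. -/
def linLift {A : Type} [Ring A] [Algebra ℂ A] (σ : G → A) : TwistedGroupAlgebra ψ →ₗ[ℂ] A :=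
  Finsupp.linearCombination ℂ σ

theorem linLift_of {A : Type} [Ring A] [Algebra ℂ A] (σ : G → A) (g : G) :
    linLift σ (of ψ g) = σ g :=
  (Finsupp.linearCombination_single ℂ (1 : ℂ) g).trans (one_smul ℂ _)

/-- A map `σ : G → A` with `σ(1) = 1` and `σ(g) σ(h) = ψ(g, h) σ(gh)` extends to `ℂ_ψ G`. -/
def lift {A : Type} [Ring A] [Algebra ℂ A] (σ : G → A) (h1 : σ 1 = 1)
    (hmul : ∀ g h, σ g * σ h = (ψ g h : ℂ) • σ (g * h)) : TwistedGroupAlgebra ψ →ₐ[ℂ] A :=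
  AlgHom.ofLinearMap (linLift σ) ((linLift_of σ 1).trans h1) fun a b => by
    refine induction (p := fun a => linLift σ (a * b) = linLift σ a * linLift σ b) a (by simp)
      (fun a a' ha ha' => by simp only [add_mul, map_add, ha, ha']) fun c g => ?_
    refine induction (p := fun b => linLift σ (c • of ψ g * b) =
      linLift σ (c • of ψ g) * linLift σ b) b (by simp)
      (fun a a' ha ha' => by simp only [mul_add, map_add, ha, ha']) fun d h => ?_
    simp only [smul_mul_assoc, mul_smul_comm, map_smul, of_mul_of, linLift_of, hmul]

theorem lift_of {A : Type} [Ring A] [Algebra ℂ A] (σ : G → A) (h1 : σ 1 = 1)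
    (hmul : ∀ g h, σ g * σ h = (ψ g h : ℂ) • σ (g * h)) (g : G) :
    lift σ h1 hmul (of ψ g) = σ g := linLift_of σ g

instance [Finite G] : FiniteDimensional ℂ (TwistedGroupAlgebra ψ) :=
  inferInstanceAs (Module.Finite ℂ (G →₀ ℂ))

end TwistedGroupAlgebra

/-- `ψ` is a class-function cocycle: the character of every finite-dimensional representation of
`ℂ_ψ G` is constant on conjugacy classes of `G`. -/
def TwoCocycle.IsClassFunction {G : Type} [Group G] (ψ : TwoCocycle G) : Prop :=
  ∀ (V : Type) [AddCommGroup V] [Module ℂ V] [FiniteDimensional ℂ V]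
    (τ : TwistedGroupAlgebra ψ →ₐ[ℂ] Module.End ℂ V) (g h : G),
    LinearMap.trace ℂ V (τ (.of ψ (h * g * h⁻¹))) = LinearMap.trace ℂ V (τ (.of ψ g))

section Symplectic

variable {U : Type} [AddCommGroup U] [Module ℂ U]

/-- The symplectic group `Sp(U)` of a vector space `U` with a bilinear form `ω`. -/
def Sp (ω : LinearMap.BilinForm ℂ U) : Subgroup (U ≃ₗ[ℂ] U) where
  carrier := {f | ∀ x y, ω (f x) (f y) = ω x y}
  mul_mem' hf hg x y := (hf _ _).trans (hg x y)
  one_mem' _ _ := rfl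
  inv_mem' {f} hf x y := by
    have h := hf (f⁻¹ x) (f⁻¹ y)
    rw [← LinearEquiv.mul_apply, ← LinearEquiv.mul_apply, mul_inv_cancel] at h
    exact h.symm

/-- `Id - s` as an endomorphism of `U`. -/
def idSub (s : U ≃ₗ[ℂ] U) : U →ₗ[ℂ] U := LinearMap.id - (s : U →ₗ[ℂ] U)

/-- For `s` of finite order, `U = Im (Id - s) ⊕ Ker (Id - s)`; so the first case in the definition
of `reflForm` below is the only relevant one. -/
theorem isCompl_idSub (s : U ≃ₗ[ℂ] U) (hs : IsOfFinOrder s) :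
    IsCompl (LinearMap.range (idSub s)) (LinearMap.ker (idSub s)) := by
  obtain ⟨n, hn, hsn⟩ := isOfFinOrder_iff_pow_eq_one.1 hs
  have hn' : (n : ℂ) ≠ 0 := by exact_mod_cast hn.ne'
  have hpow : ∀ x, (s ^ n) x = x := fun x => by rw [hsn]; rfl
  have hsucc : ∀ i x, (s ^ (i + 1)) x = (s ^ i) (s x) := fun i x => by rw [pow_succ]; rfl
  have hsucc' : ∀ i x, (s ^ (i + 1)) x = s ((s ^ i) x) := fun i x => by rw [pow_succ']; rfl
  refine ⟨Submodule.disjoint_def.2 ?_, codisjoint_iff.2 (eq_top_iff.2 fun y _ => ?_)⟩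
  · rintro _ ⟨y, rfl⟩ hx
    have hx : s (idSub s y) = idSub s y := (sub_eq_zero.1 hx).symm
    have hfix : ∀ i : ℕ, (s ^ i) (idSub s y) = idSub s y := by
      intro i
      induction i with
      | zero => rfl
      | succ i ih => rw [hsucc, hx, ih]
    have h1 : ∑ i ∈ Finset.range n, (s ^ i) (idSub s y) = (n : ℂ) • idSub s y := by
      simp [hfix, Nat.cast_smul_eq_nsmul]
    have h2 : ∑ i ∈ Finset.range n, (s ^ i) (idSub s y) = 0 := by
      have : ∀ i, (s ^ i) (idSub s y) = (s ^ i) y - (s ^ (i + 1)) y := fun i => by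
        rw [hsucc]; simp [idSub]
      simp only [this]
      rw [Finset.sum_range_sub', hpow]
      simp
    exact (smul_eq_zero.1 (h1.symm.trans h2)).resolve_left hn'
  · have hr : ∀ i, y - (s ^ i) y ∈ LinearMap.range (idSub s) := by
      intro i
      induction i with
      | zero => simp
      | succ i ih =>
        have : y - (s ^ (i + 1)) y = (y - (s ^ i) y) + idSub s ((s ^ i) y) := by
          rw [hsucc']; simp [idSub]
        rw [this]
        exact add_mem ih ⟨_, rfl⟩
    have hk : ∑ i ∈ Finset.range n, (s ^ i) y ∈ LinearMap.ker (idSub s) := by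
      rw [LinearMap.mem_ker]
      have : idSub s (∑ i ∈ Finset.range n, (s ^ i) y)
          = ∑ i ∈ Finset.range n, ((s ^ i) y - (s ^ (i + 1)) y) := by
        rw [map_sum]
        exact Finset.sum_congr rfl fun i _ => by rw [hsucc']; simp [idSub]
      rw [this, Finset.sum_range_sub', hpow]
      simp
    have hy : y = (n : ℂ)⁻¹ • ∑ i ∈ Finset.range n, (y - (s ^ i) y)
        + (n : ℂ)⁻¹ • ∑ i ∈ Finset.range n, (s ^ i) y := by
      rw [← smul_add, ← Finset.sum_add_distrib]
      simp only [sub_add_cancel, Finset.sum_const, Finset.card_range]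
      rw [← Nat.cast_smul_eq_nsmul ℂ, smul_smul, inv_mul_cancel₀ hn', one_smul]
    rw [hy]
    exact Submodule.add_mem_sup (Submodule.smul_mem _ _ (Submodule.sum_mem _ fun i _ => hr i))
      (Submodule.smul_mem _ _ hk)

open Classical in
/-- The form `ω_s`: it has `Ker (Id - s)` in its radical and coincides with `ω` on
`Im (Id - s)`. -/
def reflForm (ω : LinearMap.BilinForm ℂ U) (s : U ≃ₗ[ℂ] U) (x y : U) : ℂ :=
  if h : IsCompl (LinearMap.range (idSub s)) (LinearMap.ker (idSub s)) then
    ω (Submodule.projection _ _ h x) (Submodule.projection _ _ h y)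
  else 0

variable {ω : LinearMap.BilinForm ℂ U} {G : Type} [Group G]

/-- The set `S_ψ(G, U)` of the `ψ`-regular elements of `G` that act on `U` by symplectic
reflections, that is by elements `f ∈ Sp(U)` with `rank (Id - f) = 2`. -/
def regularReflections (φ : G →* Sp ω) (ψ : TwoCocycle G) : Set G :=
  {s | Module.finrank ℂ (LinearMap.range (idSub (φ s : U ≃ₗ[ℂ] U))) = 2 ∧ ψ.IsRegular s}

/-- The action of `G` on the tensor algebra `TU` induced by the action on `U`. -/
def tensorAction (φ : G →* Sp ω) : G →* (TensorAlgebra ℂ U ≃ₐ[ℂ] TensorAlgebra ℂ U) :=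
  have key : ∀ f g : U ≃ₗ[ℂ] U,
      (TensorAlgebra.lift ℂ (TensorAlgebra.ι ℂ ∘ₗ (f : U →ₗ[ℂ] U))).comp
        (TensorAlgebra.lift ℂ (TensorAlgebra.ι ℂ ∘ₗ (g : U →ₗ[ℂ] U))) =
      TensorAlgebra.lift ℂ (TensorAlgebra.ι ℂ ∘ₗ ((f * g : U ≃ₗ[ℂ] U) : U →ₗ[ℂ] U)) := by
    intro f g
    ext x
    simp
  have key1 : TensorAlgebra.lift ℂ (TensorAlgebra.ι ℂ ∘ₗ ((1 : U ≃ₗ[ℂ] U) : U →ₗ[ℂ] U)) =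
      AlgHom.id ℂ _ := by
    ext x
    simp
  { toFun g := AlgEquiv.ofAlgHom
      (TensorAlgebra.lift ℂ (TensorAlgebra.ι ℂ ∘ₗ ((φ g : U ≃ₗ[ℂ] U) : U →ₗ[ℂ] U)))
      (TensorAlgebra.lift ℂ (TensorAlgebra.ι ℂ ∘ₗ ((φ g⁻¹ : U ≃ₗ[ℂ] U) : U →ₗ[ℂ] U)))
      (by rw [key, ← Subgroup.coe_mul, ← map_mul, mul_inv_cancel, map_one]; exact key1)
      (by rw [key, ← Subgroup.coe_mul, ← map_mul, inv_mul_cancel, map_one]; exact key1)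
    map_one' := AlgEquiv.ext fun x => by
      have := DFunLike.congr_fun key1 x
      simpa using this
    map_mul' g h := AlgEquiv.ext fun x => by
      have := DFunLike.congr_fun (key (φ g) (φ h)) x
      simpa using this.symm }

/-- The semidirect product `(TU) ⋊ ℂ_ψ G`. -/
abbrev SmashAlgebra (φ : G →* Sp ω) (ψ : TwoCocycle G) : Type :=
  CrossedProduct (tensorAction φ) ψ

/-- The relations
`y ⊗ x - x ⊗ y = ω(x, y) · 1 + ∑_{s ∈ S_ψ(G, U)} c(s) ω_s(x, y) s` for `x, y ∈ U`. -/
inductive SRARel (φ : G →* Sp ω) (ψ : TwoCocycle G) (c : G → ℂ) :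
    SmashAlgebra φ ψ → SmashAlgebra φ ψ → Prop
  | comm (x y : U) : SRARel φ ψ c
      (.single _ _ 1 (TensorAlgebra.ι ℂ y * TensorAlgebra.ι ℂ x
        - TensorAlgebra.ι ℂ x * TensorAlgebra.ι ℂ y))
      (ω x y • 1 + ∑ᶠ s ∈ regularReflections φ ψ,
        (c s * reflForm ω (φ s) x y) • CrossedProduct.single _ _ s 1)

/-- The twisted symplectic reflection algebra `H_c(G, U, ψ)`: the quotient of `(TU) ⋊ ℂ_ψ G` by the
two-sided ideal generated by the differences of the two sides of the relations `SRARel`. Only the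
values of `c` on `S_ψ(G, U)` matter. -/
def SRA (φ : G →* Sp ω) (ψ : TwoCocycle G) (c : G → ℂ) : Type := RingQuot (SRARel φ ψ c)

namespace SRA

variable (φ : G →* Sp ω) (ψ : TwoCocycle G) (c : G → ℂ)

instance : Ring (SRA φ ψ c) := inferInstanceAs (Ring (RingQuot (SRARel φ ψ c)))
instance : Algebra ℂ (SRA φ ψ c) := inferInstanceAs (Algebra ℂ (RingQuot (SRARel φ ψ c)))

/-- The quotient map `(TU) ⋊ ℂ_ψ G → H_c(G, U, ψ)`. -/
def mk : SmashAlgebra φ ψ →ₐ[ℂ] SRA φ ψ c := RingQuot.mkAlgHom ℂ (SRARel φ ψ c)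

/-- The canonical homomorphism `ℂ_ψ G → H_c(G, U, ψ)`, sending `g` to the class of `1 ⊗ g`. -/
def ofGroupAlgebra : TwistedGroupAlgebra ψ →ₐ[ℂ] SRA φ ψ c :=
  (mk φ ψ c).comp <| TwistedGroupAlgebra.lift (fun g => CrossedProduct.single _ _ g 1) rfl
    fun g h => by simp [CrossedProduct.single_mul_single, CrossedProduct.smul_single]

end SRA

end Symplectic

/-- The algebra structure on the corner `e A e` (which is `e A` if `e` is central). -/
instance {A : Type} [Ring A] [Algebra ℂ A] {e : A} (he : IsIdempotentElem e) :
    Algebra ℂ he.Corner :=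
  letI : SMul ℂ he.Corner := ⟨fun c x => ⟨c • x.1, by
    obtain ⟨h1, h2⟩ := (Subsemigroup.mem_corner_iff he).1 x.2
    exact (Subsemigroup.mem_corner_iff he).2 ⟨by rw [mul_smul_comm, h1], by rw [smul_mul_assoc, h2]⟩⟩⟩
  letI : Module ℂ he.Corner := 
    { one_smul := fun x => Subtype.ext (one_smul ℂ x.1)
      mul_smul := fun c d x => Subtype.ext (mul_smul c d x.1)
      smul_zero := fun c => Subtype.ext (smul_zero (A := A) c)
      smul_add := fun c x y => Subtype.ext (smul_add c x.1 y.1)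
      add_smul := fun c d x => Subtype.ext (add_smul c d x.1)
      zero_smul := fun x => Subtype.ext (zero_smul ℂ x.1) }
  Algebra.ofModule (fun c x y => Subtype.ext (smul_mul_assoc c x.1 y.1))
    (fun c x y => Subtype.ext (mul_smul_comm c x.1 y.1))


open CategoryTheory MonoidalCategory MonoidalLeftAction TensorProduct

/-- An object of `Rep(G, ψ)`, the category of finite-dimensional representations of `ℂ_ψ G`. The
homomorphism `π : G → W` plays no role here; it is recorded because it determines the structure of
a module category over `Rep(W)` below. -/
structure TwistedRep {G W : Type} [Group G] [Group W] (π : G →* W) (ψ : TwoCocycle G) where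
  V : Type
  [addCommGroup : AddCommGroup V]
  [module : Module ℂ V]
  [finiteDimensional : FiniteDimensional ℂ V]
  ρ : TwistedGroupAlgebra ψ →ₐ[ℂ] Module.End ℂ V

namespace TwistedRep

attribute [instance] addCommGroup module finiteDimensional

variable {G W : Type} [Group G] [Group W] {π : G →* W} {ψ : TwoCocycle G}

/-- A homomorphism of representations of `ℂ_ψ G`. -/
@[ext]
structure Hom (M N : TwistedRep π ψ) where
  toLin : M.V →ₗ[ℂ] N.V
  comm : ∀ a, toLin ∘ₗ M.ρ a = N.ρ a ∘ₗ toLin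

instance : Category (TwistedRep π ψ) where
  Hom M N := Hom M N
  id M := ⟨LinearMap.id, fun _ => rfl⟩
  comp f g := ⟨g.toLin ∘ₗ f.toLin, fun a => by
    rw [LinearMap.comp_assoc, f.comm, ← LinearMap.comp_assoc, g.comm, LinearMap.comp_assoc]⟩

variable {M N P : TwistedRep π ψ}

@[ext]
theorem hom_ext {f g : M ⟶ N} (h : f.toLin = g.toLin) : f = g := Hom.ext h

@[simp] theorem id_toLin : Hom.toLin (𝟙 M) = LinearMap.id := rfl

@[simp] theorem comp_toLin (f : M ⟶ N) (g : N ⟶ P) : (f ≫ g).toLin = g.toLin ∘ₗ f.toLin := rfl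

/-- It is enough to check compatibility with the basis `G` of `ℂ_ψ G`. -/
def homOfGroup (f : M.V →ₗ[ℂ] N.V) (hf : ∀ g, f ∘ₗ M.ρ (.of ψ g) = N.ρ (.of ψ g) ∘ₗ f) :
    M ⟶ N where
  toLin := f
  comm a := by
    refine TwistedGroupAlgebra.induction (p := fun a => f ∘ₗ M.ρ a = N.ρ a ∘ₗ f) a (by simp)
      (fun a b ha hb => by
        rw [map_add, map_add, LinearMap.comp_add, LinearMap.add_comp, ha, hb]) fun c g => ?_
    rw [map_smul, map_smul, LinearMap.comp_smul, LinearMap.smul_comp, hf]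

@[simp] theorem homOfGroup_toLin (f : M.V →ₗ[ℂ] N.V)
    (hf : ∀ g, f ∘ₗ M.ρ (.of ψ g) = N.ρ (.of ψ g) ∘ₗ f) : (homOfGroup f hf).toLin = f := rfl

/-- An invertible linear map that commutes with the basis `G` is an isomorphism. -/
def isoOfGroup (f : M.V ≃ₗ[ℂ] N.V)
    (hf : ∀ g, (f : M.V →ₗ[ℂ] N.V) ∘ₗ M.ρ (.of ψ g) = N.ρ (.of ψ g) ∘ₗ (f : M.V →ₗ[ℂ] N.V)) :
    M ≅ N where
  hom := homOfGroup f hf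
  inv := homOfGroup f.symm fun g => LinearMap.ext fun x => by
    have := LinearMap.congr_fun (hf g) (f.symm x)
    simp only [LinearMap.comp_apply, LinearEquiv.coe_coe, LinearEquiv.apply_symm_apply] at this ⊢
    rw [← this, LinearEquiv.symm_apply_apply]
  hom_inv_id := by ext x; simp
  inv_hom_id := by ext x; simp

instance : Zero (M ⟶ N) := ⟨⟨0, fun _ => by simp⟩⟩
instance : Add (M ⟶ N) := ⟨fun f g => ⟨f.toLin + g.toLin, fun a => by
  rw [LinearMap.add_comp, LinearMap.comp_add, f.comm, g.comm]⟩⟩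
instance : Neg (M ⟶ N) := ⟨fun f => ⟨-f.toLin, fun a => by
  rw [LinearMap.neg_comp, LinearMap.comp_neg, f.comm]⟩⟩

@[simp] theorem zero_toLin : Hom.toLin (0 : M ⟶ N) = 0 := rfl
@[simp] theorem add_toLin (f g : M ⟶ N) : (f + g).toLin = f.toLin + g.toLin := rfl
@[simp] theorem neg_toLin (f : M ⟶ N) : (-f).toLin = -f.toLin := rfl

instance : Preadditive (TwistedRep π ψ) where
  homGroup M N :=
    { add_assoc := fun f g h => by ext1; simp [add_assoc]
      zero_add := fun f => by ext1; simp
      add_zero := fun f => by ext1; simp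
      neg_add_cancel := fun f => by ext1; simp
      add_comm := fun f g => by ext1; simp [add_comm]
      nsmul := nsmulRec
      zsmul := zsmulRec }
  add_comp := fun _ _ _ f g h => by ext1; exact LinearMap.comp_add _ _ _
  comp_add := fun _ _ _ f g h => by ext1; exact LinearMap.add_comp _ _ _

/-- The representation given by a finite-dimensional `ℂ_ψ G`-module. -/
def ofModule (π : G →* W) (V : Type) [AddCommGroup V] [Module ℂ V] [FiniteDimensional ℂ V]
    [Module (TwistedGroupAlgebra ψ) V] [IsScalarTower ℂ (TwistedGroupAlgebra ψ) V] :
    TwistedRep π ψ where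
  V := V
  ρ := Algebra.lsmul ℂ ℂ V

/-- The character of a representation of `ℂ_ψ G`. -/
def character (M : TwistedRep π ψ) (g : G) : ℂ := LinearMap.trace ℂ M.V (M.ρ (.of ψ g))

theorem tensor_aux (X : FDRep ℂ W) (M : TwistedRep π ψ) (g h : G) :
    TensorProduct.map (X.ρ (π g)) (M.ρ (.of ψ g)) * TensorProduct.map (X.ρ (π h)) (M.ρ (.of ψ h)) =
      (ψ g h : ℂ) • TensorProduct.map (X.ρ (π (g * h))) (M.ρ (.of ψ (g * h))) := by
  rw [← TensorProduct.map_mul, ← map_mul, ← map_mul, ← map_mul, TwistedGroupAlgebra.of_mul_of,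
    map_smul, TensorProduct.map_smul_right]

theorem tensor_aux_one (X : FDRep ℂ W) (M : TwistedRep π ψ) :
    TensorProduct.map (X.ρ (π 1)) (M.ρ (.of ψ 1)) = 1 := by
  rw [map_one, map_one, TwistedGroupAlgebra.of_one, map_one]
  exact TensorProduct.map_id

/-- The representation `X ⊗ M`, on which `g ∈ G` acts by `π(g) ⊗ g`. -/
def tensor (X : FDRep ℂ W) (M : TwistedRep π ψ) : TwistedRep π ψ where
  V := X ⊗[ℂ] M.V
  ρ := TwistedGroupAlgebra.lift (fun g => TensorProduct.map (X.ρ (π g)) (M.ρ (.of ψ g)))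
    (tensor_aux_one X M) (tensor_aux X M)

theorem tensor_ρ_of (X : FDRep ℂ W) (M : TwistedRep π ψ) (g : G) :
    (tensor X M).ρ (.of ψ g) = TensorProduct.map (X.ρ (π g)) (M.ρ (.of ψ g)) :=
  TwistedGroupAlgebra.lift_of _ (tensor_aux_one X M) (tensor_aux X M) g

/-- The linear map underlying a morphism of representations of `W`. -/
def fdLin {X Y : FDRep ℂ W} (f : X ⟶ Y) : X →ₗ[ℂ] Y := f.hom.hom.hom

theorem fdLin_comm {X Y : FDRep ℂ W} (f : X ⟶ Y) (w : W) :
    fdLin f ∘ₗ X.ρ w = Y.ρ w ∘ₗ fdLin f :=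
  congrArg (fun k => k.hom.hom) (f.comm w)

/-- The action of `Rep(W)` on `Rep(G, ψ)` by tensor products. -/
instance : MonoidalLeftAction (FDRep ℂ W) (TwistedRep π ψ) where
  actionObj X M := tensor X M
  actionHomLeft {X Y} f M := homOfGroup (M := tensor X M) (N := tensor Y M)
    (TensorProduct.map (fdLin f) LinearMap.id) fun g => by
      rw [tensor_ρ_of, tensor_ρ_of]
      exact TensorProduct.ext' fun x m =>
        congrArg (· ⊗ₜ[ℂ] M.ρ (.of ψ g) m) (LinearMap.congr_fun (fdLin_comm f (π g)) x)
  actionHomRight X {M N} f := homOfGroup (M := tensor X M) (N := tensor X N)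
    (TensorProduct.map LinearMap.id f.toLin) fun g => by
      rw [tensor_ρ_of, tensor_ρ_of]
      exact TensorProduct.ext' fun x m =>
        congrArg (X.ρ (π g) x ⊗ₜ[ℂ] ·) (LinearMap.congr_fun (f.comm (.of ψ g)) m)
  actionAssocIso X Y M := isoOfGroup (M := tensor (X ⊗ Y) M) (N := tensor X (tensor Y M))
    (TensorProduct.assoc ℂ X Y M.V) fun g => by
      rw [tensor_ρ_of, tensor_ρ_of, tensor_ρ_of]
      exact TensorProduct.ext_threefold fun x y m => rfl
  actionUnitIso M := isoOfGroup (M := tensor (𝟙_ (FDRep ℂ W)) M) (N := M)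
    (TensorProduct.lid ℂ M.V) fun g => by
      rw [tensor_ρ_of]
      refine TensorProduct.ext' fun c m => ?_
      exact (map_smul (M.ρ (.of ψ g)) (show ℂ from c) m).symm
  actionHom_def f g := rfl
  actionHomRight_id X M := by ext1; exact TensorProduct.map_id
  id_actionHomLeft X M := by ext1; exact TensorProduct.map_id
  actionHom_comp f₁ f₂ g₁ g₂ := by ext1; exact TensorProduct.ext' fun x m => rfl
  actionAssocIso_hom_naturality f g h := by
    ext1; exact TensorProduct.ext_threefold fun x y m => rfl
  actionUnitIso_hom_naturality f := by
    ext1; exact TensorProduct.ext' fun (c : ℂ) m => map_smul f.toLin c m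
  whiskerLeft_actionHomLeft X _ _ f M := by
    ext1; exact TensorProduct.ext_threefold fun x y m => rfl
  whiskerRight_actionHomLeft X f M := by
    ext1; exact TensorProduct.ext_threefold fun x y m => rfl
  associator_actionHom X Y Z M := by
    ext1; exact TensorProduct.ext_fourfold fun x y z m => rfl
  leftUnitor_actionHom X M := by
    ext1; exact TensorProduct.ext_threefold fun c x m => rfl
  rightUnitor_actionHom X M := by
    ext1; exact TensorProduct.ext_threefold fun x c m =>
      TensorProduct.smul_tmul (show ℂ from c) x m

end TwistedRep

section ModuleCategories

open Limits

/-- A full subcategory of a module category `D` over `C` that is closed under isomorphisms and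
under the action of `C`. -/
structure ModuleSubcategory (C D : Type 1) [Category.{0} C] [MonoidalCategory C] [Category.{0} D]
    [MonoidalLeftAction C D] where
  prop : ObjectProperty D
  prop_of_iso : ∀ {M N : D}, (M ≅ N) → prop M → prop N
  prop_action : ∀ (X : C) {M : D}, prop M → prop (X ⊙ₗ M)

namespace ModuleSubcategory

variable {C D : Type 1} [Category.{0} C] [MonoidalCategory C] [Category.{0} D]
  [MonoidalLeftAction C D]

/-- The underlying category of a module subcategory. -/
abbrev Cat (S : ModuleSubcategory C D) : Type 1 := S.prop.FullSubcategory

/-- A module subcategory is itself a module category, with the restricted action. -/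
instance (S : ModuleSubcategory C D) : MonoidalLeftAction C S.prop.FullSubcategory where
  actionObj X M := ⟨X ⊙ₗ M.obj, S.prop_action X M.property⟩
  actionHomLeft f M := ObjectProperty.homMk (f ⊵ₗ M.obj)
  actionHomRight X _ _ f := ObjectProperty.homMk (X ⊴ₗ f.hom)
  actionHom f g := ObjectProperty.homMk (f ⊙ₗₘ g.hom)
  actionAssocIso X Y M := ObjectProperty.isoMk _ (αₗ X Y M.obj)
  actionUnitIso M := ObjectProperty.isoMk _ (λₗ M.obj)
  actionHom_def f g := ObjectProperty.hom_ext _ (MonoidalLeftAction.actionHom_def f g.hom)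
  actionHomRight_id X M :=
    ObjectProperty.hom_ext _ (MonoidalLeftAction.actionHomRight_id X M.obj)
  id_actionHomLeft X M :=
    ObjectProperty.hom_ext _ (MonoidalLeftAction.id_actionHomLeft X M.obj)
  actionHom_comp f₁ f₂ g₁ g₂ :=
    ObjectProperty.hom_ext _ (MonoidalLeftAction.actionHom_comp f₁ f₂ g₁.hom g₂.hom)
  actionAssocIso_hom_naturality f g h :=
    ObjectProperty.hom_ext _ (MonoidalLeftAction.actionAssocIso_hom_naturality f g h.hom)
  actionUnitIso_hom_naturality f :=
    ObjectProperty.hom_ext _ (MonoidalLeftAction.actionUnitIso_hom_naturality f.hom)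
  whiskerLeft_actionHomLeft X _ _ f M :=
    ObjectProperty.hom_ext _ (MonoidalLeftAction.whiskerLeft_actionHomLeft X f M.obj)
  whiskerRight_actionHomLeft X f M :=
    ObjectProperty.hom_ext _ (MonoidalLeftAction.whiskerRight_actionHomLeft X f M.obj)
  associator_actionHom X Y Z M :=
    ObjectProperty.hom_ext _ (MonoidalLeftAction.associator_actionHom X Y Z M.obj)
  leftUnitor_actionHom X M :=
    ObjectProperty.hom_ext _ (MonoidalLeftAction.leftUnitor_actionHom X M.obj)
  rightUnitor_actionHom X M :=
    ObjectProperty.hom_ext _ (MonoidalLeftAction.rightUnitor_actionHom X M.obj)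

/-- The module category `D` is the (internal) direct sum of the module subcategories `S i`: there
are no nonzero morphisms between objects of different `S i`, and every object of `D` is a direct sum
of objects of the `S i`. Equivalently, `(M i) ↦ ⨁ M i` is an equivalence from the product of the
`S i`, with coordinatewise structure, to `D`. -/
structure IsDirectSum [Preadditive D] {ι : Type} (S : ι → ModuleSubcategory C D) : Prop where
  hom_eq_zero : ∀ i j, i ≠ j → ∀ M N : D, (S i).prop M → (S j).prop N → ∀ f : M ⟶ N, f = 0
  exists_decomposition : ∀ M : D, ∃ N : ι → D, (∀ i, (S i).prop (N i)) ∧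
    ∃ b : Bicone N, Nonempty b.IsBilimit ∧ Nonempty (b.pt ≅ M)

end ModuleSubcategory

/-- A module category is indecomposable if it is nonzero and is not the direct sum of two nonzero
module categories. -/
def IsIndecomposableModuleCategory (C D : Type 1) [Category.{0} C] [MonoidalCategory C]
    [Category.{0} D] [Preadditive D] [MonoidalLeftAction C D] : Prop :=
  (∃ M : D, ¬ IsZero M) ∧
    ∀ S : Fin 2 → ModuleSubcategory C D, ModuleSubcategory.IsDirectSum S →
      ∃ i, ∀ M : D, (S i).prop M → IsZero M

end ModuleCategories

section Statement

variable {G W : Type} [Group G] [Group W] {π : G →* W} {ψ : TwoCocycle G}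

instance [Finite G] (L : Submodule (TwistedGroupAlgebra ψ) (TwistedGroupAlgebra ψ)) :
    FiniteDimensional ℂ L :=
  inferInstanceAs (FiniteDimensional ℂ (L.restrictScalars ℂ))

/-- Let `Rep(G, ψ)` be the direct sum of the `S i`. The regular representation decomposes as
`ℂ_ψ G = ⨁ L i` with `L i` in `S i`, and `1 = ∑ e i` with `e i ∈ L i`. -/
def IsBlockDecomposition [Finite G] {ι : Type} [Fintype ι]
    (S : ι → ModuleSubcategory (FDRep ℂ W) (TwistedRep π ψ)) (e : ι → TwistedGroupAlgebra ψ) :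
    Prop :=
  ∃ L : ι → Submodule (TwistedGroupAlgebra ψ) (TwistedGroupAlgebra ψ),
    iSupIndep L ∧ iSup L = ⊤ ∧ (∀ i, (S i).prop (TwistedRep.ofModule π (L i))) ∧
      (∀ i, e i ∈ L i) ∧ ∑ i, e i = 1

/-- A chosen element of a conjugacy class. -/
def ConjClasses.rep {K : Type} [Group K] (D : ConjClasses K) : K :=
  Quotient.out (s := IsConj.setoid K) D

/-- Given a functor `F` from a module subcategory `S` of `Rep(G, ψ)` to `Rep(H, ζ)`, the numbers
`α D E` (for conjugacy classes `D` of `G` and `E` of `H`) are such that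
`χ_M(g) = ∑_E α(D, E) χ_{F(M)}(E)` for every `g ∈ D` and every simple object `M` of `S`,
where `E` runs over the conjugacy classes of `ζ`-regular elements of `H` that are contained in the
conjugacy class of `π(g)` in `W`. -/
def IsCharacterCoefficients {S : ModuleSubcategory (FDRep ℂ W) (TwistedRep π ψ)} {H : Subgroup W}
    {ζ : TwoCocycle H} (F : S.Cat ⥤ TwistedRep H.subtype ζ)
    (α : ConjClasses G → ConjClasses H → ℂ) : Prop :=
  ∀ (g : G) (M : S.Cat), Simple M →
    M.obj.character g =
      ∑ᶠ E ∈ {E : ConjClasses H | (∀ h ∈ E.carrier, ζ.IsRegular h) ∧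
          E.map H.subtype = ConjClasses.mk (π g)},
        α (ConjClasses.mk g) E * (F.obj M).character E.rep

/-- The function
`c'(h) = (α(e) |E|)⁻¹ ∑_D α(D, E) c(D) |D|`,
where `E` is the conjugacy class of `h` in `H`, and `D` runs over the conjugacy classes of
`ψ`-regular reflections in `G` such that `π(D)` is the conjugacy class of `h` in `W`. -/
def inducedParameter {U : Type} [AddCommGroup U] [Module ℂ U] {ω : LinearMap.BilinForm ℂ U}
    (φ : G →* Sp ω) (π : G →* W) (ψ : TwoCocycle G) (c : G → ℂ) {H : Subgroup W}
    (α : ConjClasses G → ConjClasses H → ℂ) (h : H) : ℂ :=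
  (∑ᶠ D ∈ {D : ConjClasses G | D.carrier ⊆ regularReflections φ ψ ∧
        D.map π = ConjClasses.mk (h : W)},
      α D (ConjClasses.mk h) * c D.rep * (D.carrier.ncard : ℂ)) /
    (α (ConjClasses.mk 1) (ConjClasses.mk 1) * ((ConjClasses.mk h).carrier.ncard : ℂ))

end Statement

end

open CategoryTheory

/-!
Write `ℂ_ψ G` with its `W`-grading, in which `g` has degree `π(g)`. The module subcategories `C_i`
are the blocks cut out by orthogonal central idempotents `e_i`: a representation `M` lies in `C_i`
exactly if `e_i` acts on it as the identity (`ModuleSubcategory.prop_iff_ρ_block`). Since `C_i` is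
closed under tensoring with representations of `W`, the idempotent `e_i` has degree `1`
(`ModuleSubcategory.block_mem_degPart`). Therefore it commutes with `U` and remains central in the
symplectic reflection algebra.

The heart of the proof is that a module equivalence `F : C_i ⥤ Rep(H, ζ)` is given by a corner of
`ℂ_ψ G`. Let `Q` be the preimage of the regular representation `ℂ_ζ H`. Because `F` is a fully
faithful module functor, morphisms `X ⊗ ℂ_ζ H ⟶ F N` correspond to morphisms `X ⊗ Q ⟶ N`. For
`X = ℂ[W]`, the grading of `ℂ_ζ H` by `H ⊆ W` thus becomes a `W`-grading of `Q`, compatible with the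
action of `ℂ_ψ G` and with the right action of `ℂ_ζ H`. Endomorphisms of `Q` that preserve the
grading are scalars, so that `Q` is generated by a vector of degree `1` and embeds in `ℂ_ψ G` by a
graded map (`TwistedRep.exists_graded_section`). This gives elements `τ(h)` of degree `h` that
multiply like the basis of `ℂ_ζ H` and span the corner `τ(1) ℂ_ψ G τ(1)`; moreover `F M = τ(1) M`
for all `M`, with `h` acting as `τ(h)` (`TwistedRep.exists_gradedCorner`). As `F` is faithful, `e_i`
lies in the two-sided ideal generated by `τ(1)` (`mem_span_corner`).

For a class function `f` on `G` supported on regular elements, the part of `∑ f(g) g` of degree `w`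
commutes with `τ(1)`. Its product with `τ(1)` is an element of degree `w` of the corner, so it is
`β(h) τ(h)` if `w = h ∈ H` and zero otherwise (`IsGradedCorner.exists_transfer`). The sum of all
conjugates of `τ(1)` is central of degree `1` and hence acts on the block by a scalar. Taking
traces, sums of `f χ_M` become proportional to sums of `β χ_{F(M)}` (`exists_trace_identity`). For
the indicator functions `f` of conjugacy classes, this gives the numbers `α`
(`exists_isCharacterCoefficients`). Since a class function on regular elements that is orthogonal to
all irreducible characters vanishes (`eq_zero_of_sum_character`), any other choice of `α` leads to
the same formula for `β` when `f` is the extension of `c` by zero, and it says that `β = c'` on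
reflections (`IsCharacterCoefficients.eq_inducedParameter`).

Finally, the corner passes to the symplectic reflection algebras. Since `τ(h)` has degree `h`, it
commutes with `U` up to the action of `h`, and multiplication by `τ(1)` turns the relations of
`H_c(G, U, ψ)` into those of `H_{c'}(H, U, ζ)`. So `τ(1) H_c(G, U, ψ) τ(1)` is isomorphic to
`H_{c'}(H, U, ζ)`. Injectivity does not require a basis of these algebras: the projection
`x ↦ τ(1) x τ(1)` of `ℂ_ψ G` also respects the relations and extends to an inverse map
(`SRA.exists_embedding`, `SRA.exists_retraction`). As `τ(1)` generates the ideal of `e_i`, the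
algebra `e_i H_c(G, U, ψ)` is Morita equivalent to this corner (`isMoritaEquivalent_of_corner`,
`isMoritaEquivalent_corner_SRA`).
-/

/-! ### Lifting morphisms along a module functor -/

section ActionLift

open MonoidalCategory MonoidalLeftAction Functor.LaxLeftLinear Functor.OplaxLeftLinear
  Functor.LeftLinear

variable {C D D' : Type*} [Category C] [MonoidalCategory C] [Category D] [Category D']
  [MonoidalLeftAction C D] [MonoidalLeftAction C D'] (F : D ⥤ D') [F.Full]
  [F.LeftLinear C] {Q : D} {B : D'} (θ : F.obj Q ≅ B)

/-- If `F` is a fully faithful `C`-module functor and `F Q ≅ B`, then morphisms `X ⊙ B ⟶ F N`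
correspond to morphisms `X ⊙ Q ⟶ N`. -/
noncomputable def actionLift {X : C} {N : D} (k : X ⊙ₗ B ⟶ F.obj N) : X ⊙ₗ Q ⟶ N :=
  F.preimage (δₗ F X Q ≫ X ⊴ₗ θ.hom ≫ k)

theorem map_actionLift {X : C} {N : D} (k : X ⊙ₗ B ⟶ F.obj N) :
    F.map (actionLift F θ k) = δₗ F X Q ≫ X ⊴ₗ θ.hom ≫ k :=
  F.map_preimage _

theorem actionLift_injective {X : C} {N : D} {k k' : X ⊙ₗ B ⟶ F.obj N}
    (h : actionLift F θ k = actionLift F θ k') : k = k' := by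
  have := congrArg F.map h
  rw [map_actionLift, map_actionLift] at this
  have h2 := congrArg (fun t => X ⊴ₗ θ.inv ≫ μₗ F X Q ≫ t) this
  simpa [← actionHomRight_comp_assoc] using h2

variable [F.Faithful]

theorem exists_actionLift_eq {X : C} {N : D} (m : X ⊙ₗ Q ⟶ N) :
    ∃ k : X ⊙ₗ B ⟶ F.obj N, actionLift F θ k = m := by
  refine ⟨X ⊴ₗ θ.inv ≫ μₗ F X Q ≫ F.map m, F.map_injective ?_⟩
  rw [map_actionLift, ← actionHomRight_comp_assoc]
  simp

theorem actionLift_comp {X : C} {N N' : D} (k : X ⊙ₗ B ⟶ F.obj N) (m : N ⟶ N') :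
    actionLift F θ (k ≫ F.map m) = actionLift F θ k ≫ m :=
  F.map_injective (by simp [map_actionLift])

theorem actionLift_whisker {X Y : C} (f : Y ⟶ X) {N : D} (k : X ⊙ₗ B ⟶ F.obj N) :
    actionLift F θ (f ⊵ₗ B ≫ k) = f ⊵ₗ Q ≫ actionLift F θ k :=
  F.map_injective (by
    simp only [map_actionLift, F.map_comp, δₗ_naturality_left_assoc]
    rw [← action_exchange_assoc])

theorem actionLift_precomp {X : C} {N : D} (r : Q ⟶ Q) (k : X ⊙ₗ B ⟶ F.obj N) :
    actionLift F θ (X ⊴ₗ (θ.inv ≫ F.map r ≫ θ.hom) ≫ k) = X ⊴ₗ r ≫ actionLift F θ k :=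
  F.map_injective (by
    simp only [map_actionLift, F.map_comp, δₗ_naturality_right_assoc]
    rw [← actionHomRight_comp_assoc, ← actionHomRight_comp_assoc]
    simp)

theorem actionLift_assoc {X Y : C} {N : D} (k' : Y ⊙ₗ B ⟶ B) (k : X ⊙ₗ B ⟶ F.obj N) :
    actionLift F θ ((αₗ X Y B).hom ≫ X ⊴ₗ k' ≫ k) =
      (αₗ X Y Q).hom ≫ X ⊴ₗ actionLift F θ (k' ≫ θ.inv) ≫ actionLift F θ k :=
  F.map_injective (by
    simp only [map_actionLift, F.map_comp, δₗ_naturality_right_assoc]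
    simp only [actionHomRight_comp, Category.assoc]
    have h1 : X ⊴ₗ θ.inv ≫ X ⊴ₗ θ.hom ≫ k = k := by
      rw [← actionHomRight_comp_assoc]; simp
    rw [h1]
    have h2 := δₗ_associativity F X Y Q
    rw [← reassoc_of% h2, tensor_actionHomRight]
    simp)

theorem actionLift_unit :
    actionLift F θ ((λₗ[C] B).hom ≫ θ.inv) = (λₗ[C] Q).hom :=
  F.map_injective (by
    rw [map_actionLift, unit_actionHomRight]
    simp)

end ActionLift

/-! ### The twisted group algebra -/

namespace TwistedGroupAlgebra

variable {G : Type} [Group G] {ψ : TwoCocycle G}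

/-- The coefficient of `g`. -/
noncomputable def coeff (g : G) : TwistedGroupAlgebra ψ →ₗ[ℂ] ℂ := Finsupp.lapply (R := ℂ) g

open Classical in
theorem coeff_of (g h : G) : coeff g (of ψ h) = if h = g then 1 else 0 :=
  Finsupp.single_apply

theorem ext_coeff {a b : TwistedGroupAlgebra ψ} (h : ∀ g, coeff g a = coeff g b) : a = b :=
  Finsupp.ext h

theorem eq_sum_coeff [Fintype G] (a : TwistedGroupAlgebra ψ) : a = ∑ g, coeff g a • of ψ g := by
  classical
  refine ext_coeff fun g => ?_
  simp [map_sum, coeff_of]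

/-- The basis element of `g`, as a unit. -/
noncomputable def ofUnit (ψ : TwoCocycle G) (g : G) : (TwistedGroupAlgebra ψ)ˣ where
  val := of ψ g
  inv := (ψ g g⁻¹ : ℂ)⁻¹ • of ψ g⁻¹
  val_inv := by
    rw [mul_smul_comm, of_mul_of, mul_inv_cancel, of_one, smul_smul, inv_mul_cancel₀ (by simp),
      one_smul]
  inv_val := by
    have h : ψ g⁻¹ g = ψ g g⁻¹ := by
      have := ψ.cocycle g g⁻¹ g
      simpa [ψ.one_left, ψ.one_right] using this.symm
    rw [smul_mul_assoc, of_mul_of, inv_mul_cancel, of_one, smul_smul, h,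
      inv_mul_cancel₀ (by simp), one_smul]

@[simp] theorem val_ofUnit (g : G) : (ofUnit ψ g : TwistedGroupAlgebra ψ) = of ψ g := rfl

theorem of_mul_inv_ofUnit (g : G) :
    of ψ g * ((ofUnit ψ g)⁻¹ : (TwistedGroupAlgebra ψ)ˣ) = 1 := (ofUnit ψ g).mul_inv

theorem inv_ofUnit_mul_of (g : G) :
    ((ofUnit ψ g)⁻¹ : (TwistedGroupAlgebra ψ)ˣ) * of ψ g = 1 := (ofUnit ψ g).inv_mul

theorem val_inv_ofUnit (g : G) :
    (((ofUnit ψ g)⁻¹ : (TwistedGroupAlgebra ψ)ˣ) : TwistedGroupAlgebra ψ) =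
      (ψ g g⁻¹ : ℂ)⁻¹ • of ψ g⁻¹ := rfl

theorem of_mul_eq_smul (g h : G) :
    of ψ (g * h) = (ψ g h : ℂ)⁻¹ • (of ψ g * of ψ h) := by
  rw [of_mul_of, smul_smul, inv_mul_cancel₀ (by simp), one_smul]

theorem inv_ofUnit_mul (g h : G) :
    (((ofUnit ψ (g * h))⁻¹ : (TwistedGroupAlgebra ψ)ˣ) : TwistedGroupAlgebra ψ) =
      (ψ g h : ℂ) • (((ofUnit ψ h)⁻¹ : (TwistedGroupAlgebra ψ)ˣ) *
        ((ofUnit ψ g)⁻¹ : (TwistedGroupAlgebra ψ)ˣ)) := by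
  refine Units.inv_eq_of_mul_eq_one_right ?_
  rw [val_ofUnit, of_mul_eq_smul, smul_mul_smul_comm, inv_mul_cancel₀ (by simp), one_smul,
    mul_assoc, ← mul_assoc (of ψ h), of_mul_inv_ofUnit, one_mul, of_mul_inv_ofUnit]

section Average

variable [Fintype G] {V V' : Type} [AddCommGroup V] [Module ℂ V] [AddCommGroup V'] [Module ℂ V']
  (ρ : TwistedGroupAlgebra ψ →ₐ[ℂ] Module.End ℂ V)
  (ρ' : TwistedGroupAlgebra ψ →ₐ[ℂ] Module.End ℂ V')

/-- The average of a linear map over `G`. -/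
noncomputable def average (f : V →ₗ[ℂ] V') : V →ₗ[ℂ] V' :=
  (Fintype.card G : ℂ)⁻¹ • ∑ g : G,
    ρ' ((ofUnit ψ g)⁻¹ : (TwistedGroupAlgebra ψ)ˣ) ∘ₗ f ∘ₗ ρ (of ψ g)

theorem average_comm (f : V →ₗ[ℂ] V') (a : TwistedGroupAlgebra ψ) (v : V) :
    average ρ ρ' f (ρ a v) = ρ' a (average ρ ρ' f v) := by
  refine induction (p := fun a => average ρ ρ' f (ρ a v) = ρ' a (average ρ ρ' f v)) a (by simp)
    (fun a b ha hb => by simp only [map_add, LinearMap.add_apply, ha, hb]) fun c h => ?_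
  simp only [map_smul, LinearMap.smul_apply]
  congr 1
  simp only [average, LinearMap.smul_apply, LinearMap.sum_apply, LinearMap.comp_apply, map_smul,
    map_sum]
  congr 1
  refine Fintype.sum_equiv (Equiv.mulRight h) _ _ fun g => ?_
  simp only [Equiv.coe_mulRight]
  rw [inv_ofUnit_mul, of_mul_eq_smul, map_smul, map_smul, LinearMap.smul_apply,
    LinearMap.smul_apply, map_smul f, map_smul,
    map_smul, map_smul, smul_smul, mul_inv_cancel₀ (by simp), one_smul, map_mul, map_mul,
    Module.End.mul_apply, Module.End.mul_apply,
    ← Module.End.mul_apply (ρ' (of ψ h)), ← map_mul, of_mul_inv_ofUnit, map_one,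
    Module.End.one_apply]

end Average

section Semisimple

instance [Finite G] : IsSemisimpleRing (TwistedGroupAlgebra ψ) where
  exists_isCompl L := by
    have := Fintype.ofFinite G
    obtain ⟨p, hp⟩ := (L.restrictScalars ℂ).exists_isCompl
    let q : TwistedGroupAlgebra ψ →ₗ[ℂ] TwistedGroupAlgebra ψ := Submodule.projection _ _ hp
    let ρ := Algebra.lsmul ℂ ℂ (A := TwistedGroupAlgebra ψ) (TwistedGroupAlgebra ψ)
    have hmem : ∀ a, average ρ ρ q a ∈ L := fun a => by
      simp only [average, LinearMap.smul_apply, LinearMap.sum_apply]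
      refine (L.restrictScalars ℂ).smul_mem _ ((L.restrictScalars ℂ).sum_mem fun g _ => ?_)
      exact L.smul_mem _ (Submodule.projection_apply_mem hp _)
    have hid : ∀ a ∈ L, average ρ ρ q a = a := fun a ha => by
      have h : ∀ g, ρ ((ofUnit ψ g)⁻¹ : (TwistedGroupAlgebra ψ)ˣ) (q (ρ (of ψ g) a)) = a :=
        fun g => by
          have hq : q (ρ (of ψ g) a) = ρ (of ψ g) a :=
            Submodule.projection_apply_left hp ⟨_, L.smul_mem (of ψ g) ha⟩
          rw [hq, ← Module.End.mul_apply, ← map_mul, inv_ofUnit_mul_of, map_one,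
            Module.End.one_apply]
      simp only [average, LinearMap.smul_apply, LinearMap.sum_apply, LinearMap.comp_apply, h,
        Finset.sum_const, Finset.card_univ]
      rw [← Nat.cast_smul_eq_nsmul ℂ, smul_smul, inv_mul_cancel₀ (by simp), one_smul]
    let P : TwistedGroupAlgebra ψ →ₗ[TwistedGroupAlgebra ψ] L :=
      { toFun a := ⟨average ρ ρ q a, hmem a⟩
        map_add' a b := Subtype.ext (map_add _ a b)
        map_smul' a b := Subtype.ext (average_comm ρ ρ q a b) }
    exact ⟨_, LinearMap.isCompl_of_proj (f := P) fun x => Subtype.ext (hid x x.2)⟩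

/-- A central element with vanishing trace on every simple module acts as zero on each of them, by
Schur's lemma, hence it is zero by semisimplicity. -/
theorem eq_zero_of_central_of_trace [Finite G] {z : TwistedGroupAlgebra ψ}
    (hz : ∀ a, Commute z a)
    (htr : ∀ N : Submodule (TwistedGroupAlgebra ψ) (TwistedGroupAlgebra ψ),
      IsSimpleModule (TwistedGroupAlgebra ψ) N →
        LinearMap.trace ℂ N (Algebra.lsmul ℂ ℂ N z) = 0) : z = 0 := by
  let A : Submodule (TwistedGroupAlgebra ψ) (TwistedGroupAlgebra ψ) :=
    { carrier := {a | z * a = 0}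
      add_mem' := fun {a b} ha hb => by
        simp only [Set.mem_ofPred_eq] at *
        rw [mul_add, ha, hb, add_zero]
      zero_mem' := mul_zero z
      smul_mem' := fun c a ha => by
        simp only [Set.mem_ofPred_eq, smul_eq_mul] at *
        rw [← mul_assoc, (hz c).eq, mul_assoc, ha, mul_zero] }
  suffices h : (1 : TwistedGroupAlgebra ψ) ∈ A by
    have : z * 1 = 0 := h
    rwa [mul_one] at this
  have htop : A = ⊤ := by
    rw [eq_top_iff, ← IsSemisimpleModule.sSup_simples_eq_top]
    refine sSup_le fun N hN => ?_
    have hN : IsSimpleModule (TwistedGroupAlgebra ψ) N := hN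
    have := hN.nontrivial
    obtain ⟨μ, hμ⟩ := Module.End.exists_eigenvalue (Algebra.lsmul ℂ ℂ N z)
    obtain ⟨v, hv⟩ := hμ.exists_hasEigenvector
    let f : N →ₗ[TwistedGroupAlgebra ψ] N :=
      { toFun x := z • x - μ • x
        map_add' x y := by rw [smul_add, smul_add]; abel
        map_smul' c x := by
          rw [RingHom.id_apply, smul_sub, smul_smul, smul_smul, (hz c).eq, smul_comm c μ x] }
    have hf : f = 0 := by
      refine (LinearMap.injective_or_eq_zero f).resolve_left fun hinj => hv.2 (hinj ?_)
      rw [map_zero]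
      exact sub_eq_zero.2 hv.apply_eq_smul
    have hsc : ∀ x : N, z • x = μ • x := fun x => sub_eq_zero.1 (LinearMap.congr_fun hf x)
    have hμ0 : μ = 0 := by
      have h := htr N hN
      have h2 : Algebra.lsmul ℂ ℂ N z = μ • LinearMap.id := LinearMap.ext hsc
      rw [h2, map_smul, LinearMap.trace_id, smul_eq_mul] at h
      refine (mul_eq_zero.1 h).resolve_right ?_
      exact_mod_cast Module.finrank_pos.ne'
    intro x hx
    have := congrArg Subtype.val (hsc ⟨x, hx⟩)
    rw [hμ0, zero_smul] at this
    exact this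
  rw [htop]
  trivial

end Semisimple

section ConjSum

theorem commute_of_forall_of {z : TwistedGroupAlgebra ψ} (h : ∀ g, Commute z (of ψ g))
    (a : TwistedGroupAlgebra ψ) : Commute z a :=
  induction (p := fun a => Commute z a) a (Commute.zero_right z)
    (fun _ _ ha hb => ha.add_right hb) fun c g => (h g).smul_right c

theorem trace_conj {V : Type} [AddCommGroup V] [Module ℂ V]
    (ρ : TwistedGroupAlgebra ψ →ₐ[ℂ] Module.End ℂ V) (g : G) (a : TwistedGroupAlgebra ψ) :
    LinearMap.trace ℂ V (ρ (of ψ g * a * ((ofUnit ψ g)⁻¹ : (TwistedGroupAlgebra ψ)ˣ))) =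
      LinearMap.trace ℂ V (ρ a) := by
  rw [map_mul, LinearMap.trace_mul_comm, ← map_mul, ← mul_assoc, inv_ofUnit_mul_of, one_mul]

variable [Fintype G]

/-- The sum of all conjugates of `a` by the basis elements of `ℂ_ψ G`. -/
noncomputable def conjSum (a : TwistedGroupAlgebra ψ) : TwistedGroupAlgebra ψ :=
  ∑ g : G, of ψ g * a * ((ofUnit ψ g)⁻¹ : (TwistedGroupAlgebra ψ)ˣ)

theorem commute_conjSum (a b : TwistedGroupAlgebra ψ) : Commute (conjSum a) b := by
  refine commute_of_forall_of (fun h => ?_) b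
  rw [commute_iff_eq, conjSum, Finset.sum_mul, Finset.mul_sum]
  refine (Fintype.sum_equiv (Equiv.mulLeft h) _ _ fun g => ?_).symm
  rw [Equiv.coe_mulLeft, inv_ofUnit_mul, of_mul_eq_smul, smul_mul_assoc, smul_mul_smul_comm,
    inv_mul_cancel₀ (by simp), one_smul]
  simp only [mul_assoc, inv_ofUnit_mul_of, mul_one]

theorem trace_mul_conjSum {V : Type} [AddCommGroup V] [Module ℂ V]
    (ρ : TwistedGroupAlgebra ψ →ₐ[ℂ] Module.End ℂ V) {z : TwistedGroupAlgebra ψ}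
    (hz : ∀ b, Commute z b) (a : TwistedGroupAlgebra ψ) :
    LinearMap.trace ℂ V (ρ (z * conjSum a)) =
      Fintype.card G * LinearMap.trace ℂ V (ρ (z * a)) := by
  have h : ∀ g, LinearMap.trace ℂ V
      (ρ (z * (of ψ g * a * ((ofUnit ψ g)⁻¹ : (TwistedGroupAlgebra ψ)ˣ)))) =
      LinearMap.trace ℂ V (ρ (z * a)) := fun g => by
    rw [← trace_conj ρ g (z * a), ← mul_assoc, ← mul_assoc, ← mul_assoc, (hz (of ψ g)).eq]
  rw [conjSum, Finset.mul_sum, map_sum, map_sum, Finset.sum_congr rfl fun g _ => h g]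
  simp

end ConjSum

/-! ### Class-function cocycles -/

section ClassFunction

theorem of_mul_of_conj (g t : G) :
    of ψ g * of ψ t = ((ψ g t : ℂ) * (ψ (g * t * g⁻¹) g : ℂ)⁻¹) •
      (of ψ (g * t * g⁻¹) * of ψ g) := by
  rw [of_mul_of, of_mul_of, smul_smul, inv_mul_cancel_right₀ (by simp), inv_mul_cancel_right]

theorem conj_of (g t : G) :
    of ψ g * of ψ t * ((ofUnit ψ g)⁻¹ : (TwistedGroupAlgebra ψ)ˣ) =
      ((ψ g t : ℂ) * (ψ (g * t * g⁻¹) g : ℂ)⁻¹) • of ψ (g * t * g⁻¹) := by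
  rw [of_mul_of_conj, smul_mul_assoc, mul_assoc (of ψ _), of_mul_inv_ofUnit, mul_one]

/-- Characters vanish on elements that are not regular. -/
theorem trace_of_eq_zero {V : Type} [AddCommGroup V] [Module ℂ V]
    (ρ : TwistedGroupAlgebra ψ →ₐ[ℂ] Module.End ℂ V) {g : G} (hg : ¬ ψ.IsRegular g) :
    LinearMap.trace ℂ V (ρ (of ψ g)) = 0 := by
  simp only [TwoCocycle.IsRegular, not_forall] at hg
  obtain ⟨h, hc, hne⟩ := hg
  have h1 := trace_conj ρ h (of ψ g)
  have hconj : h * g * h⁻¹ = g := by rw [← hc.eq, mul_inv_cancel_right]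
  rw [conj_of, hconj, map_smul, map_smul, smul_eq_mul] at h1
  by_contra h0
  refine hne (Units.ext ?_)
  have h2 := mul_right_cancel₀ h0 (h1.trans (one_mul _).symm)
  rw [← div_eq_mul_inv, div_eq_one_iff_eq (by simp)] at h2
  exact h2.symm

/-- For a class-function cocycle, conjugating a regular basis element gives a basis element
without a scalar factor. Otherwise every character would vanish at this element, and so would the
sum of its conjugates, which is central. -/
theorem of_mul_of_conj_of_isRegular [Finite G] (hψ : ψ.IsClassFunction) {t : G}
    (ht : ψ.IsRegular t) (g : G) : of ψ g * of ψ t = of ψ (g * t * g⁻¹) * of ψ g := by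
  classical
  have := Fintype.ofFinite G
  rw [of_mul_of_conj]
  suffices h : ((ψ g t : ℂ) * (ψ (g * t * g⁻¹) g : ℂ)⁻¹) = 1 by rw [h, one_smul]
  by_contra hne
  have htr : ∀ (V : Type) [AddCommGroup V] [Module ℂ V] [FiniteDimensional ℂ V]
      (τ : TwistedGroupAlgebra ψ →ₐ[ℂ] Module.End ℂ V),
      LinearMap.trace ℂ V (τ (of ψ t)) = 0 := by
    intro V _ _ _ τ
    have h1 := trace_conj τ g (of ψ t)
    rw [conj_of, map_smul, map_smul, hψ V τ t g, smul_eq_mul] at h1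
    by_contra h0
    exact hne (mul_right_cancel₀ h0 (h1.trans (one_mul _).symm))
  have hz : conjSum (of ψ t) = 0 := by
    refine eq_zero_of_central_of_trace (commute_conjSum _) fun N _ => ?_
    have h := trace_mul_conjSum (Algebra.lsmul ℂ ℂ (A := TwistedGroupAlgebra ψ) N)
      (z := 1) (fun b => Commute.one_left b) (of ψ t)
    rw [one_mul, one_mul] at h
    rw [h, htr, mul_zero]
  have hc : coeff t (conjSum (of ψ t)) = ∑ k : G, if k * t * k⁻¹ = t then (1 : ℂ) else 0 := by
    rw [conjSum, map_sum]
    refine Finset.sum_congr rfl fun k _ => ?_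
    rw [conj_of, map_smul, coeff_of, smul_eq_mul]
    split_ifs with hk
    · have hk' : Commute t k := by
        rw [commute_iff_eq, ← mul_inv_eq_iff_eq_mul.1 hk]
      rw [hk, mul_one, ht k hk', mul_inv_cancel₀ (by simp)]
    · rw [mul_zero]
  rw [hz, map_zero, Finset.sum_boole] at hc
  have : (Finset.univ.filter fun k : G => k * t * k⁻¹ = t).card = 0 := by exact_mod_cast hc.symm
  rw [Finset.card_eq_zero] at this
  have h1 : (1 : G) ∈ Finset.univ.filter fun k : G => k * t * k⁻¹ = t := by simp
  rw [this] at h1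
  simp at h1

end ClassFunction

/-! ### The grading of the twisted group algebra by the quotient group -/

section Degree

variable {W : Type} [Group W] (π : G →* W)

/-- The part of `ℂ_ψ G` of degree `w` for the `W`-grading in which `g` has degree `π(g)`. -/
noncomputable def degPart (ψ : TwoCocycle G) (w : W) : Submodule ℂ (TwistedGroupAlgebra ψ) :=
  Submodule.span ℂ (of ψ '' {g | π g = w})

variable {π}

theorem of_mem_degPart {g : G} {w : W} (h : π g = w) : of ψ g ∈ degPart π ψ w :=
  Submodule.subset_span ⟨g, h, rfl⟩

theorem mul_mem_degPart {a b : TwistedGroupAlgebra ψ} {v w : W} (ha : a ∈ degPart π ψ v)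
    (hb : b ∈ degPart π ψ w) : a * b ∈ degPart π ψ (v * w) := by
  refine Submodule.span_induction (p := fun a _ => a * b ∈ degPart π ψ (v * w)) ?_ (by simp)
    (fun x y _ _ hx hy => by rw [add_mul]; exact add_mem hx hy)
    (fun c x _ hx => by rw [smul_mul_assoc]; exact Submodule.smul_mem _ _ hx) ha
  rintro _ ⟨g, hg, rfl⟩
  refine Submodule.span_induction (p := fun b _ => of ψ g * b ∈ degPart π ψ (v * w)) ?_ (by simp)
    (fun x y _ _ hx hy => by rw [mul_add]; exact add_mem hx hy)
    (fun c x _ hx => by rw [mul_smul_comm]; exact Submodule.smul_mem _ _ hx) hb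
  rintro _ ⟨h, hh, rfl⟩
  rw [of_mul_of]
  exact Submodule.smul_mem _ _ (of_mem_degPart (by rw [map_mul, hg, hh]))

theorem mem_degPart_of_coeff [Finite G] {a : TwistedGroupAlgebra ψ} {w : W}
    (h : ∀ g, coeff g a ≠ 0 → π g = w) : a ∈ degPart π ψ w := by
  have := Fintype.ofFinite G
  rw [eq_sum_coeff a]
  refine Submodule.sum_mem _ fun g _ => ?_
  by_cases hg : coeff g a = 0
  · simp [hg]
  · exact Submodule.smul_mem _ _ (of_mem_degPart (h g hg))

variable (π) in
open Classical in
/-- The projection of `ℂ_ψ G` to its part of degree `w`. -/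
noncomputable def degProj (ψ : TwoCocycle G) (w : W) :
    TwistedGroupAlgebra ψ →ₗ[ℂ] TwistedGroupAlgebra ψ :=
  linLift fun g => if π g = w then of ψ g else 0

open Classical in
theorem degProj_of (w : W) (g : G) : degProj π ψ w (of ψ g) = if π g = w then of ψ g else 0 :=
  linLift_of _ g

theorem degProj_mem (w : W) (a : TwistedGroupAlgebra ψ) : degProj π ψ w a ∈ degPart π ψ w := by
  classical
  refine induction (p := fun a => degProj π ψ w a ∈ degPart π ψ w) a (by simp)
    (fun a b ha hb => by rw [map_add]; exact add_mem ha hb) fun c g => ?_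
  rw [map_smul, degProj_of]
  refine Submodule.smul_mem _ _ ?_
  split_ifs with h
  · exact of_mem_degPart h
  · exact zero_mem _

open Classical in
theorem degProj_apply_of_mem {a : TwistedGroupAlgebra ψ} {v : W} (w : W)
    (ha : a ∈ degPart π ψ v) : degProj π ψ w a = if v = w then a else 0 := by
  refine Submodule.span_induction (p := fun a _ => degProj π ψ w a = if v = w then a else 0)
    ?_ (by simp) ?_ ?_ ha
  · rintro _ ⟨g, rfl, rfl⟩
    exact degProj_of _ _
  · intro x y _ _ hx hy
    rw [map_add, hx, hy]
    split_ifs <;> simp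
  · intro c x _ hx
    rw [map_smul, hx]
    split_ifs <;> simp

theorem sum_degProj [Fintype W] (a : TwistedGroupAlgebra ψ) : ∑ w, degProj π ψ w a = a := by
  classical
  refine induction (p := fun a => ∑ w, degProj π ψ w a = a) a (by simp)
    (fun a b ha hb => by simp only [map_add, Finset.sum_add_distrib, ha, hb]) fun c g => ?_
  simp [degProj_of]

theorem of_mul_degProj (g : G) (w : W) (a : TwistedGroupAlgebra ψ) :
    of ψ g * degProj π ψ w a = degProj π ψ (π g * w) (of ψ g * a) := by
  classical
  refine induction (p := fun a => of ψ g * degProj π ψ w a = degProj π ψ (π g * w) (of ψ g * a)) a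
    (by simp) (fun a b ha hb => by simp only [map_add, mul_add, ha, hb]) fun c h => ?_
  simp only [map_smul, mul_smul_comm, degProj_of, of_mul_of, map_mul, mul_right_inj]
  split_ifs <;> simp [of_mul_of]

theorem degProj_mul_of (g : G) (w : W) (a : TwistedGroupAlgebra ψ) :
    degProj π ψ w a * of ψ g = degProj π ψ (w * π g) (a * of ψ g) := by
  classical
  refine induction (p := fun a => degProj π ψ w a * of ψ g = degProj π ψ (w * π g) (a * of ψ g)) a
    (by simp) (fun a b ha hb => by simp only [map_add, add_mul, ha, hb]) fun c h => ?_
  simp only [map_smul, smul_mul_assoc, degProj_of, of_mul_of, map_mul, mul_left_inj]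
  split_ifs <;> simp [of_mul_of]

end Degree

end TwistedGroupAlgebra

/-! ### Representations and their tensor products -/

namespace TwistedRep

open MonoidalCategory MonoidalLeftAction TensorProduct

variable {G W : Type} [Group G] [Group W] {π : G →* W} {ψ : TwoCocycle G}

/-- A `ℂ_ψ G`-linear map, as a morphism of representations. -/
noncomputable def ofLinear (π : G →* W) {V V' : Type} [AddCommGroup V] [Module ℂ V]
    [FiniteDimensional ℂ V]
    [Module (TwistedGroupAlgebra ψ) V] [IsScalarTower ℂ (TwistedGroupAlgebra ψ) V]
    [AddCommGroup V'] [Module ℂ V'] [FiniteDimensional ℂ V']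
    [Module (TwistedGroupAlgebra ψ) V'] [IsScalarTower ℂ (TwistedGroupAlgebra ψ) V']
    (f : V →ₗ[TwistedGroupAlgebra ψ] V') : ofModule (ψ := ψ) π V ⟶ ofModule (ψ := ψ) π V' where
  toLin := f.restrictScalars ℂ
  comm a := LinearMap.ext fun v => f.map_smul a v

theorem hom_comm_apply {M N : TwistedRep π ψ} (f : M ⟶ N) (a : TwistedGroupAlgebra ψ) (m : M.V) :
    f.toLin (M.ρ a m) = N.ρ a (f.toLin m) :=
  LinearMap.congr_fun (f.comm a) m

/-- The morphism from a left ideal to a representation given by acting on a vector. -/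
noncomputable def orbitHom [Finite G]
    (L : Submodule (TwistedGroupAlgebra ψ) (TwistedGroupAlgebra ψ))
    (M : TwistedRep π ψ) (m : M.V) : ofModule π L ⟶ M where
  toLin := (LinearMap.applyₗ m) ∘ₗ M.ρ.toLinearMap ∘ₗ (L.subtype.restrictScalars ℂ)
  comm a := LinearMap.ext fun x => by
    change M.ρ (a * x.1) m = M.ρ a (M.ρ x.1 m)
    rw [map_mul, Module.End.mul_apply]

section Tensor

/-- The bilinear map `(x, m) ↦ x ⊗ m`. -/
noncomputable def tmul (X : FDRep ℂ W) (M : TwistedRep π ψ) :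
    X →ₗ[ℂ] M.V →ₗ[ℂ] (X ⊙ₗ M).V :=
  TensorProduct.mk ℂ X M.V

variable {X Y : FDRep ℂ W} {M N : TwistedRep π ψ}

theorem ρ_of_tmul (g : G) (x : X) (m : M.V) :
    (X ⊙ₗ M).ρ (.of ψ g) (tmul X M x m) = tmul X M (X.ρ (π g) x) (M.ρ (.of ψ g) m) :=
  LinearMap.congr_fun (tensor_ρ_of X M g) (x ⊗ₜ[ℂ] m)

theorem tensor_hom_ext {f f' : X ⊙ₗ M ⟶ N}
    (h : ∀ x m, f.toLin (tmul X M x m) = f'.toLin (tmul X M x m)) : f = f' :=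
  hom_ext (TensorProduct.ext' h)

/-- The morphism `X ⊗ M ⟶ N` given by an equivariant bilinear map. -/
noncomputable def tensorHom (f : X →ₗ[ℂ] M.V →ₗ[ℂ] N.V)
    (hf : ∀ g x m, f (X.ρ (π g) x) (M.ρ (.of ψ g) m) = N.ρ (.of ψ g) (f x m)) : X ⊙ₗ M ⟶ N :=
  homOfGroup (M := tensor X M) (TensorProduct.lift f) fun g => by
    rw [tensor_ρ_of]
    exact TensorProduct.ext' fun x m => hf g x m

theorem tensorHom_tmul (f : X →ₗ[ℂ] M.V →ₗ[ℂ] N.V)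
    (hf : ∀ g x m, f (X.ρ (π g) x) (M.ρ (.of ψ g) m) = N.ρ (.of ψ g) (f x m)) (x : X) (m : M.V) :
    (tensorHom f hf).toLin (tmul X M x m) = f x m := rfl

theorem actionHomRight_tmul (f : M ⟶ N) (x : X) (m : M.V) :
    Hom.toLin (X ⊴ₗ f) (tmul X M x m) = tmul X N x (f.toLin m) := rfl

theorem actionHomLeft_tmul (f : X ⟶ Y) (x : X) (m : M.V) :
    Hom.toLin (f ⊵ₗ M) (tmul X M x m) = tmul Y M (fdLin f x) m := rfl

/-- The bilinear map `(x, y) ↦ x ⊗ y` for representations of `W`. -/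
noncomputable def fdTmul (X Y : FDRep ℂ W) : X →ₗ[ℂ] Y →ₗ[ℂ] (X ⊗ Y : FDRep ℂ W) :=
  TensorProduct.mk ℂ X Y

theorem fdTmul_induction {p : (X ⊗ Y : FDRep ℂ W) → Prop} (t : (X ⊗ Y : FDRep ℂ W)) (h0 : p 0)
    (ht : ∀ x y, p (fdTmul X Y x y)) (hadd : ∀ t t', p t → p t' → p (t + t')) : p t :=
  TensorProduct.induction_on (motive := p) t h0 ht hadd

theorem actionAssocIso_tmul (x : X) (y : Y) (m : M.V) :
    Hom.toLin (αₗ X Y M).hom (tmul (X ⊗ Y) M (fdTmul X Y x y) m) =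
      tmul X (Y ⊙ₗ M) x (tmul Y M y m) := rfl

/-- The scalar `c`, as an element of the trivial representation of `W`. -/
def fdScalar (c : ℂ) : (𝟙_ (FDRep ℂ W) : FDRep ℂ W) := c

theorem actionUnitIso_tmul (c : ℂ) (m : M.V) :
    Hom.toLin (λₗ[FDRep ℂ W] M).hom (tmul (𝟙_ (FDRep ℂ W)) M (fdScalar c) m) = c • m := rfl

/-- An equivariant linear map, as a morphism of representations of `W`. -/
def fdHom (f : X →ₗ[ℂ] Y) (hf : ∀ w x, f (X.ρ w x) = Y.ρ w (f x)) : X ⟶ Y :=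
  ⟨⟨ModuleCat.ofHom f⟩, fun w => by
    ext x
    exact hf w x⟩

end Tensor

section LeftRegular

variable (W) [Finite W]

/-- The left regular representation of `W`. -/
noncomputable def leftRegularRep : FDRep ℂ W :=
  FDRep.of (V := W →₀ ℂ)
    { toFun w := Finsupp.lmapDomain ℂ ℂ (w * ·)
      map_one' := by ext; simp
      map_mul' v w := by ext; simp [mul_assoc] }

/-- The basis of the left regular representation. -/
noncomputable def leftRegularBasis : Module.Basis W ℂ (leftRegularRep W) :=
  Finsupp.basisSingleOne (R := ℂ) (ι := W)

variable {W}

theorem leftRegularRep_ρ_basis (v w : W) :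
    (leftRegularRep W).ρ v (leftRegularBasis W w) = leftRegularBasis W (v * w) := by
  have h : ∀ u, leftRegularBasis W u = (Finsupp.single u (1 : ℂ) : W →₀ ℂ) :=
    fun u => Finsupp.coe_basisSingleOne (R := ℂ) (ι := W) ▸ rfl
  rw [h, h]
  exact Finsupp.mapDomain_single

end LeftRegular

section Regular

/-- The regular representation `ℂ_ψ G`. -/
noncomputable def regular [Finite G] (π : G →* W) (ψ : TwoCocycle G) : TwistedRep π ψ :=
  ofModule π (TwistedGroupAlgebra ψ)

variable [Finite G]

/-- The underlying space of the regular representation is `ℂ_ψ G`. -/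
noncomputable def toRegular (π : G →* W) (ψ : TwoCocycle G) :
    TwistedGroupAlgebra ψ ≃ₗ[ℂ] (regular π ψ).V := LinearEquiv.refl ℂ _

theorem ρ_toRegular (a b : TwistedGroupAlgebra ψ) :
    (regular π ψ).ρ a (toRegular π ψ b) = toRegular π ψ (a * b) := rfl

end Regular

end TwistedRep

/-! ### The blocks of `Rep(G, ψ)` -/

namespace ModuleSubcategory

open MonoidalCategory MonoidalLeftAction TensorProduct TwistedRep TwistedGroupAlgebra

variable {G W : Type} [Group G] [Group W] {π : G →* W} {ψ : TwoCocycle G} {ι : Type}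
  {S : ι → ModuleSubcategory (FDRep ℂ W) (TwistedRep π ψ)}

/-- A representation lies in the subcategory `S i` if it receives no nonzero morphism from the
others. -/
theorem prop_of_forall_hom_eq_zero [Fintype ι] (hS : IsDirectSum S) {i : ι}
    {M : TwistedRep π ψ} (hM : ∀ j, j ≠ i → ∀ N, (S j).prop N → ∀ f : N ⟶ M, f = 0) :
    (S i).prop M := by
  classical
  obtain ⟨N, hN, b, ⟨hb⟩, ⟨θ⟩⟩ := hS.exists_decomposition M
  have h0 : ∀ j, j ≠ i → b.ι j = 0 := fun j hj => by
    rw [← cancel_mono θ.hom, hM j hj _ (hN j) (b.ι j ≫ θ.hom), Limits.zero_comp]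
  have h1 : b.π i ≫ b.ι i = 𝟙 b.pt := by
    rw [← Limits.IsBilimit.total hb, Finset.sum_eq_single i
      (fun j _ hj => by rw [h0 j hj, Limits.comp_zero])
      (by simp)]
  exact (S i).prop_of_iso ((Iso.mk (b.ι i) (b.π i) (Limits.bicone_ι_π_self b i) h1) ≪≫ θ) (hN i)

section Block

variable [Finite G] [Fintype ι] {e : ι → TwistedGroupAlgebra ψ}

/-- The element `e i` acts as zero on the subcategories other than `S i`: acting on a vector of `M`
is a morphism from the left ideal `L i ∈ S i` to `M`, which has to vanish. -/
theorem ρ_block_of_ne (hS : IsDirectSum S) (he : IsBlockDecomposition S e) {i j : ι} (hij : i ≠ j)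
    {M : TwistedRep π ψ} (hM : (S j).prop M) : M.ρ (e i) = 0 := by
  obtain ⟨L, -, -, hL, heL, -⟩ := he
  ext m
  have h := hS.hom_eq_zero i j hij _ _ (hL i) hM (orbitHom (L i) M m)
  exact LinearMap.congr_fun (congrArg Hom.toLin h) ⟨e i, heL i⟩

theorem ρ_block_self (hS : IsDirectSum S) (he : IsBlockDecomposition S e) {i : ι}
    {M : TwistedRep π ψ} (hM : (S i).prop M) : M.ρ (e i) = 1 := by
  classical
  have h1 : M.ρ (∑ j, e j) = 1 := by
    obtain ⟨L, -, -, -, -, h1⟩ := he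
    rw [h1, map_one]
  rw [map_sum, Finset.sum_eq_single i (fun j _ hj => ρ_block_of_ne hS he hj hM) (by simp)] at h1
  exact h1

/-- The subcategory `S i` consists of the representations on which `e i` acts as the identity. -/
theorem prop_iff_ρ_block (hS : IsDirectSum S) (he : IsBlockDecomposition S e) {i : ι}
    {M : TwistedRep π ψ} : (S i).prop M ↔ M.ρ (e i) = 1 := by
  refine ⟨ρ_block_self hS he, fun h => prop_of_forall_hom_eq_zero hS fun j hj N hN f => ?_⟩
  ext n
  have := hom_comm_apply f (e i) n
  rw [ρ_block_of_ne hS he hj.symm hN, h] at this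
  simpa using this.symm

theorem block_mul_self (hS : IsDirectSum S) (he : IsBlockDecomposition S e)
    (i : ι) : e i * e i = e i := by
  obtain ⟨L, -, -, hL, heL, -⟩ := id he
  exact congrArg Subtype.val (LinearMap.congr_fun (ρ_block_self hS he (hL i)) ⟨e i, heL i⟩)

theorem commute_block (hS : IsDirectSum S) (he : IsBlockDecomposition S e) (i : ι)
    (a : TwistedGroupAlgebra ψ) : Commute (e i) a := by
  classical
  obtain ⟨L, -, -, hL, heL, h1⟩ := id he
  have h2 : ∀ j, e i * (a * e j) = if j = i then a * e i else 0 := fun j => by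
    have hmem : a * e j ∈ L j := (L j).smul_mem a (heL j)
    split_ifs with hj
    · subst hj
      exact congrArg Subtype.val (LinearMap.congr_fun (ρ_block_self hS he (hL j)) ⟨_, hmem⟩)
    · exact congrArg Subtype.val
        (LinearMap.congr_fun (ρ_block_of_ne hS he (Ne.symm hj) (hL j)) ⟨_, hmem⟩)
  calc e i * a = e i * (a * ∑ j, e j) := by rw [h1, mul_one]
    _ = a * e i := by simp [Finset.mul_sum, h2]

theorem isBlockDecomposition_unique (hS : IsDirectSum S) {e' : ι → TwistedGroupAlgebra ψ}
    (he : IsBlockDecomposition S e) (he' : IsBlockDecomposition S e') : e = e' := by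
  classical
  obtain ⟨L, -, -, hL, heL, h1⟩ := id he
  have h2 : ∀ i j, e' i * e j = if j = i then e i else 0 := fun i j => by
    split_ifs with hj
    · subst hj
      exact congrArg Subtype.val (LinearMap.congr_fun (ρ_block_self hS he' (hL j)) ⟨_, heL j⟩)
    · exact congrArg Subtype.val
        (LinearMap.congr_fun (ρ_block_of_ne hS he' (Ne.symm hj) (hL j)) ⟨_, heL j⟩)
  funext i
  have : e' i * ∑ j, e j = e i := by simp [Finset.mul_sum, h2]
  rw [← this, h1, mul_one]

/-- The elements `e i` act on `X ⊗ M` as `id ⊗ e i`, since the subcategories `S i` are closed under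
the action of `Rep(W)`. -/
theorem ρ_block_tmul (hS : IsDirectSum S) (he : IsBlockDecomposition S e) (i : ι)
    (X : FDRep ℂ W) (M : TwistedRep π ψ) (x : X) (m : M.V) :
    (X ⊙ₗ M).ρ (e i) (tmul X M x m) = tmul X M x (M.ρ (e i) m) := by
  classical
  obtain ⟨L, -, -, hL, heL, h1⟩ := id he
  have h2 : ∀ k, (X ⊙ₗ M).ρ (e i) (tmul X M x (M.ρ (e k) m)) =
      if k = i then tmul X M x (M.ρ (e i) m) else 0 := fun k => by
    let f := orbitHom (π := π) (L k) M m
    obtain ⟨n, hn⟩ : ∃ n, f.toLin n = M.ρ (e k) m := ⟨(⟨e k, heL k⟩ : L k), rfl⟩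
    have hk := (S k).prop_action X (hL k)
    rw [← hn, ← actionHomRight_tmul, ← hom_comm_apply]
    split_ifs with h
    · subst h
      rw [ρ_block_self hS he hk, Module.End.one_apply, actionHomRight_tmul, hn]
    · rw [ρ_block_of_ne hS he (Ne.symm h) hk, LinearMap.zero_apply, map_zero]
  have h3 : ∑ k, M.ρ (e k) m = m := by
    rw [← LinearMap.sum_apply, ← map_sum, h1, map_one, Module.End.one_apply]
  conv_lhs => rw [← h3]
  rw [map_sum, map_sum, Finset.sum_congr rfl fun k _ => h2 k]
  simp

/-- The elements `e i` are supported on the kernel of `π`. By `ρ_block_tmul`, the element `e i` acts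
on `ℂ[W] ⊗ ℂ_ψ G` through the second factor, whereas a basis element `g` also moves the first one by
`π(g)`; comparing coefficients gives `π(g) = 1` for all `g` occurring in `e i`. -/
theorem block_mem_degPart [Finite W] (hS : IsDirectSum S) (he : IsBlockDecomposition S e) (i : ι) :
    e i ∈ degPart π ψ (1 : W) := by
  classical
  have := Fintype.ofFinite G
  refine mem_degPart_of_coeff fun g hg => ?_
  let X := leftRegularRep W
  let R := regular π ψ
  let x : X := leftRegularBasis W 1
  let c : (X ⊙ₗ R).V →ₗ[ℂ] X :=
    TensorProduct.rid ℂ X ∘ₗ TensorProduct.map LinearMap.id (coeff g)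
  have hc : ∀ (y : X) (a : TwistedGroupAlgebra ψ),
      c (tmul X R y (toRegular π ψ a)) = coeff g a • y := fun y a => rfl
  have h4 : ∀ a : TwistedGroupAlgebra ψ,
      c ((X ⊙ₗ R).ρ a (tmul X R x (toRegular π ψ 1))) = coeff g a • X.ρ (π g) x := fun a => by
    refine TwistedGroupAlgebra.induction (p := fun a =>
      c ((X ⊙ₗ R).ρ a (tmul X R x (toRegular π ψ 1))) = coeff g a • X.ρ (π g) x) a
      (by simp only [map_zero, LinearMap.zero_apply, zero_smul]) (fun a b ha hb => by
        rw [map_add, LinearMap.add_apply, map_add, ha, hb, map_add, add_smul]) fun d h => ?_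
    rw [map_smul, LinearMap.smul_apply, map_smul, map_smul, smul_eq_mul, mul_smul, ρ_of_tmul,
      ρ_toRegular, hc, mul_one, coeff_of]
    split_ifs with hh
    · rw [hh]
    · simp only [zero_smul]
  have h5 := h4 (e i)
  rw [ρ_block_tmul hS he, ρ_toRegular, mul_one, hc] at h5
  have h6 : X.ρ (π g) x = x := (smul_right_injective X hg h5).symm
  rw [leftRegularRep_ρ_basis, mul_one] at h6
  exact (leftRegularBasis W).injective h6

/-- The decomposition of the regular representation according to the `S i` is given by projections
that commute with left multiplication, hence by right multiplication with the images `e i` of `1`.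
-/
theorem exists_isBlockDecomposition (hS : IsDirectSum S) :
    ∃ e : ι → TwistedGroupAlgebra ψ, IsBlockDecomposition S e := by
  classical
  let R : TwistedRep π ψ := regular π ψ
  let q : TwistedGroupAlgebra ψ ≃ₗ[ℂ] R.V := toRegular π ψ
  obtain ⟨N, hN, b, ⟨hb⟩, ⟨θ⟩⟩ := hS.exists_decomposition R
  let p : ι → (R ⟶ R) := fun i => θ.inv ≫ b.π i ≫ b.ι i ≫ θ.hom
  let P : ι → TwistedGroupAlgebra ψ →ₗ[ℂ] TwistedGroupAlgebra ψ := fun i =>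
    q.symm.toLinearMap ∘ₗ (p i).toLin ∘ₗ q.toLinearMap
  have hp : ∀ i a, P i a = a * P i 1 := fun i a => by
    have h := hom_comm_apply (p i) a (q 1)
    have h1 : R.ρ a (q 1) = q a := by rw [ρ_toRegular, mul_one]
    rw [h1] at h
    exact h
  have hpp : ∀ i j a, P i (P j a) = if i = j then P i a else 0 := by
    intro i j a
    have h : p j ≫ p i = if i = j then p i else 0 := by
      simp only [p, Category.assoc, Iso.hom_inv_id_assoc]
      split_ifs with hij
      · subst hij
        rw [Limits.bicone_ι_π_self_assoc b]
      · rw [Limits.bicone_ι_π_ne_assoc b (Ne.symm hij)]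
        simp
    have h2 : P i (P j a) = q.symm (Hom.toLin (p j ≫ p i) (q a)) := rfl
    rw [h2, h]
    split_ifs <;> rfl
  have hsum : ∑ i, p i = 𝟙 R := by
    have : ∑ i, p i = θ.inv ≫ (∑ i, b.π i ≫ b.ι i) ≫ θ.hom := by
      simp [p, Preadditive.comp_sum, Preadditive.sum_comp]
    rw [this, Limits.IsBilimit.total hb]
    simp
  let toLinAdd : (R ⟶ R) →+ (R.V →ₗ[ℂ] R.V) :=
    { toFun := Hom.toLin, map_zero' := rfl, map_add' := fun _ _ => rfl }
  have hsum' : ∀ a, ∑ i, P i a = a := fun a => by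
    have h := LinearMap.congr_fun (congrArg toLinAdd hsum) (q a)
    rw [map_sum, LinearMap.sum_apply] at h
    exact h
  let e : ι → TwistedGroupAlgebra ψ := fun i => P i 1
  let K : ι → Submodule (TwistedGroupAlgebra ψ) (TwistedGroupAlgebra ψ) := fun i =>
    LinearMap.ker (LinearMap.toSpanSingleton (TwistedGroupAlgebra ψ) (TwistedGroupAlgebra ψ) (e i))
  let L : ι → Submodule (TwistedGroupAlgebra ψ) (TwistedGroupAlgebra ψ) := fun i =>
    LinearMap.range
      (LinearMap.toSpanSingleton (TwistedGroupAlgebra ψ) (TwistedGroupAlgebra ψ) (e i))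
  have hL : ∀ i a, a ∈ L i → P i a = a := by
    rintro i _ ⟨a, rfl⟩
    change P i (a * e i) = a * e i
    rw [← hp, hpp, if_pos rfl]
  have hLK : ∀ i j, i ≠ j → L j ≤ K i := by
    rintro i j hij _ ⟨a, rfl⟩
    change (a * e j) * e i = 0
    rw [← hp, ← hp, hpp, if_neg hij]
  have heL : ∀ i a, P i a ∈ L i := fun i a => ⟨a, (hp i a).symm⟩
  refine ⟨e, L, fun i => ?_, ?_, fun i => ?_, fun i => heL i _, hsum' _⟩
  · rw [Submodule.disjoint_def]
    intro a ha ha'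
    have h : (⨆ j, ⨆ (_ : j ≠ i), L j) ≤ K i := iSup₂_le fun j hj => hLK i j hj.symm
    have h2 : a * e i = 0 := h ha'
    rw [← hL i a ha, hp]
    exact h2
  · refine eq_top_iff.2 fun a _ => ?_
    rw [← hsum' a]
    exact Submodule.sum_mem _ fun i _ => Submodule.mem_iSup_of_mem i (heL i a)
  · refine prop_of_forall_hom_eq_zero hS fun j hj M hM f => ?_
    let u : ofModule π (L i) ⟶ R := ofLinear π (L i).subtype
    have h := hS.hom_eq_zero j i hj _ _ hM (hN i) (f ≫ u ≫ θ.inv ≫ b.π i)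
    have h2 : (f ≫ u) ≫ p i = 0 := by
      have := congrArg (· ≫ b.ι i ≫ θ.hom) h
      simpa only [p, Category.assoc, Limits.zero_comp] using this
    ext m
    have h3 := LinearMap.congr_fun (congrArg Hom.toLin h2) m
    have h4 : P i (f.toLin m : L i).1 = 0 := h3
    rw [hL i _ (f.toLin m : L i).2] at h4
    exact Subtype.ext h4

end Block

end ModuleSubcategory

/-! ### The grading on the preimage of the regular representation -/

namespace TwistedRep

open MonoidalCategory MonoidalLeftAction TensorProduct TwistedGroupAlgebra

theorem leftRegularRep_induction {W : Type} [Group W] [Finite W] {p : leftRegularRep W → Prop}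
    (x : leftRegularRep W) (h0 : p 0) (hadd : ∀ x y, p x → p y → p (x + y))
    (hs : ∀ (c : ℂ) w, p (c • leftRegularBasis W w)) : p x := by
  have := Fintype.ofFinite W
  rw [← (leftRegularBasis W).sum_repr x]
  exact Finset.sum_induction _ p hadd h0 fun w _ => hs _ w

section Regular

variable {G W : Type} [Group G] [Group W] [Finite G] {π : G →* W} {ψ : TwoCocycle G}

/-- Right multiplication by `a`, as an endomorphism of the regular representation. -/
noncomputable def regularRightMul (π : G →* W) (a : TwistedGroupAlgebra ψ) :
    regular π ψ ⟶ regular π ψ :=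
  ofLinear π (LinearMap.toSpanSingleton (TwistedGroupAlgebra ψ) (TwistedGroupAlgebra ψ) a)

theorem regularRightMul_apply (a b : TwistedGroupAlgebra ψ) :
    (regularRightMul π a).toLin (toRegular π ψ b) = toRegular π ψ (b * a) := rfl

variable [Finite W]

/-- The action on the regular representation of the algebra of functions on `W`: the indicator
function of `w` acts as the projection to the part of degree `w`. -/
noncomputable def degreeAction (π : G →* W) (ψ : TwoCocycle G) :
    leftRegularRep W ⊙ₗ regular π ψ ⟶ regular π ψ :=
  tensorHom ((leftRegularBasis W).constr ℂ fun w =>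
      (toRegular π ψ).toLinearMap ∘ₗ degProj π ψ w ∘ₗ (toRegular π ψ).symm.toLinearMap)
      fun g x m => by
    obtain ⟨m, rfl⟩ := (toRegular π ψ).surjective m
    induction x using leftRegularRep_induction with
    | h0 => simp only [map_zero, LinearMap.zero_apply]
    | hadd x y hx hy => simp only [map_add, LinearMap.add_apply, hx, hy]
    | hs c w =>
      simp only [map_smul, LinearMap.smul_apply, leftRegularRep_ρ_basis,
        Module.Basis.constr_basis, ρ_toRegular, LinearMap.comp_apply, LinearEquiv.coe_coe,
        LinearEquiv.symm_apply_apply, of_mul_degProj]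

theorem degreeAction_tmul (w : W) (b : TwistedGroupAlgebra ψ) :
    (degreeAction π ψ).toLin
      (tmul (leftRegularRep W) _ (leftRegularBasis W w) (toRegular π ψ b)) =
      toRegular π ψ (degProj π ψ w b) := by
  rw [degreeAction, tensorHom_tmul, Module.Basis.constr_basis]
  simp

end Regular

section RegularExt

variable {G W : Type} [Group G] [Group W] [Finite G] [Finite W] {π : G →* W} {ψ : TwoCocycle G}

theorem leftRegularRep_tensor_hom_ext {N : TwistedRep π ψ}
    {f f' : leftRegularRep W ⊙ₗ regular π ψ ⟶ N}
    (h : ∀ w b, f.toLin (tmul (leftRegularRep W) _ (leftRegularBasis W w) (toRegular π ψ b)) =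
      f'.toLin (tmul (leftRegularRep W) _ (leftRegularBasis W w) (toRegular π ψ b))) :
    f = f' := by
  refine tensor_hom_ext fun x m => ?_
  obtain ⟨b, rfl⟩ := (toRegular π ψ).surjective m
  induction x using leftRegularRep_induction with
  | h0 => simp only [map_zero, LinearMap.zero_apply]
  | hadd x y hx hy => simp only [map_add, LinearMap.add_apply, hx, hy]
  | hs c w => simp only [map_smul, LinearMap.smul_apply, h]

end RegularExt

section Trivial

variable {W : Type} [Group W] (V : Type) [AddCommGroup V] [Module ℂ V] [FiniteDimensional ℂ V]

/-- The trivial representation of `W` on a vector space. -/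
noncomputable def trivialRep (W : Type) [Group W] (V : Type) [AddCommGroup V] [Module ℂ V]
    [FiniteDimensional ℂ V] : FDRep ℂ W := FDRep.of (1 : Representation ℂ W V)

/-- The underlying space of the trivial representation on `V` is `V`. -/
noncomputable def toTrivial (W : Type) [Group W] (V : Type) [AddCommGroup V] [Module ℂ V]
    [FiniteDimensional ℂ V] : V ≃ₗ[ℂ] trivialRep W V := LinearEquiv.refl ℂ V

end Trivial

section Lift

variable {G W : Type} [Group G] [Group W] {π : G →* W} {ψ : TwoCocycle G}
  {T : ModuleSubcategory (FDRep ℂ W) (TwistedRep π ψ)} {H : Subgroup W} {ζ : TwoCocycle H}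
  (F : T.Cat ⥤ TwistedRep H.subtype ζ) [F.Full] [F.LeftLinear (FDRep ℂ W)]
  {Q : T.Cat} {B : TwistedRep H.subtype ζ} (θ : F.obj Q ≅ B)

/-- The bilinear map `X × Q → N` given by a morphism `X ⊗ B ⟶ F N`, for `F Q ≅ B`. -/
noncomputable def bilinLift {X : FDRep ℂ W} {N : T.Cat} (k : X ⊙ₗ B ⟶ F.obj N) :
    X →ₗ[ℂ] Q.obj.V →ₗ[ℂ] N.obj.V :=
  (tmul X Q.obj).compr₂ (Hom.toLin (actionLift F θ k).hom)

variable {X Y : FDRep ℂ W} {N N' : T.Cat}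

theorem bilinLift_equivariant (k : X ⊙ₗ B ⟶ F.obj N) (g : G) (x : X) (y : Q.obj.V) :
    bilinLift F θ k (X.ρ (π g) x) (Q.obj.ρ (of ψ g) y) =
      N.obj.ρ (of ψ g) (bilinLift F θ k x y) := by
  have := hom_comm_apply (actionLift F θ k).hom (of ψ g) (tmul X Q.obj x y)
  exact (congrArg (Hom.toLin (actionLift F θ k).hom) (ρ_of_tmul g x y).symm).trans this

theorem bilinLift_injective {k k' : X ⊙ₗ B ⟶ F.obj N}
    (h : ∀ x y, bilinLift F θ k x y = bilinLift F θ k' x y) : k = k' :=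
  actionLift_injective F θ (ObjectProperty.hom_ext _ (tensor_hom_ext h))

variable [F.Faithful]

theorem exists_bilinLift_eq (f : X →ₗ[ℂ] Q.obj.V →ₗ[ℂ] N.obj.V)
    (hf : ∀ g x m, f (X.ρ (π g) x) (Q.obj.ρ (of ψ g) m) = N.obj.ρ (of ψ g) (f x m)) :
    ∃ k : X ⊙ₗ B ⟶ F.obj N, bilinLift F θ k = f := by
  let m : X ⊙ₗ Q ⟶ N := ObjectProperty.homMk (tensorHom f hf)
  obtain ⟨k, hk⟩ := exists_actionLift_eq F θ m
  refine ⟨k, ?_⟩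
  rw [bilinLift, hk]
  rfl

theorem bilinLift_comp (k : X ⊙ₗ B ⟶ F.obj N) (m : N ⟶ N') (x : X) (y : Q.obj.V) :
    bilinLift F θ (k ≫ F.map m) x y = Hom.toLin m.hom (bilinLift F θ k x y) := by
  rw [bilinLift, actionLift_comp]
  rfl

theorem bilinLift_whisker (f : Y ⟶ X) (k : X ⊙ₗ B ⟶ F.obj N) (x : Y) (y : Q.obj.V) :
    bilinLift F θ (f ⊵ₗ B ≫ k) x y = bilinLift F θ k (fdLin f x) y := by
  rw [bilinLift, actionLift_whisker]
  rfl

theorem bilinLift_precomp (r : Q ⟶ Q) (k : X ⊙ₗ B ⟶ F.obj N) (x : X) (y : Q.obj.V) :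
    bilinLift F θ (X ⊴ₗ (θ.inv ≫ F.map r ≫ θ.hom) ≫ k) x y =
      bilinLift F θ k x (Hom.toLin r.hom y) := by
  rw [bilinLift, actionLift_precomp]
  rfl

theorem bilinLift_assoc (k' : Y ⊙ₗ B ⟶ B) (k : X ⊙ₗ B ⟶ F.obj N) (x : X) (x' : Y)
    (y : Q.obj.V) :
    bilinLift F θ ((αₗ X Y B).hom ≫ X ⊴ₗ k' ≫ k) (fdTmul X Y x x') y =
      bilinLift F θ k x (bilinLift F θ (k' ≫ θ.inv) x' y) := by
  rw [bilinLift, actionLift_assoc]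
  rfl

theorem bilinLift_unit (c : ℂ) (y : Q.obj.V) :
    bilinLift F θ ((λₗ[FDRep ℂ W] B).hom ≫ θ.inv) (fdScalar c) y = c • y := by
  rw [bilinLift, actionLift_unit]
  rfl

end Lift

section Grading

variable {G W : Type} [Group G] [Group W] [Finite W] {π : G →* W} {ψ : TwoCocycle G}
  {T : ModuleSubcategory (FDRep ℂ W) (TwistedRep π ψ)} {H : Subgroup W} {ζ : TwoCocycle H}
  (F : T.Cat ⥤ TwistedRep H.subtype ζ) [F.Full] {Q : T.Cat}
  (θ : F.obj Q ≅ regular H.subtype ζ)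

/-- The endomorphism of `Q` corresponding to right multiplication by `a` on `ℂ_ζ H`. -/
noncomputable def rightOp (a : TwistedGroupAlgebra ζ) : Q ⟶ Q :=
  F.preimage (θ.hom ≫ regularRightMul H.subtype a ≫ θ.inv)

theorem map_rightOp (a : TwistedGroupAlgebra ζ) :
    θ.inv ≫ F.map (rightOp F θ a) ≫ θ.hom = regularRightMul H.subtype a := by
  simp [rightOp]

variable [F.LeftLinear (FDRep ℂ W)]

/-- The projections of a `W`-grading on `Q`, where `F Q` is the regular representation `ℂ_ζ H`. They
correspond to the grading of `ℂ_ζ H` by the elements of `H ⊆ W`. -/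
noncomputable def gradeOp (w : W) : Q.obj.V →ₗ[ℂ] Q.obj.V :=
  bilinLift F θ (degreeAction H.subtype ζ ≫ θ.inv) (leftRegularBasis W w)

theorem ρ_gradeOp (g : G) (w : W) (y : Q.obj.V) :
    Q.obj.ρ (of ψ g) (gradeOp F θ w y) = gradeOp F θ (π g * w) (Q.obj.ρ (of ψ g) y) := by
  rw [gradeOp, gradeOp, ← bilinLift_equivariant, leftRegularRep_ρ_basis]

theorem nontrivial_of_iso_regular (θ : F.obj Q ≅ regular H.subtype ζ) : Nontrivial Q.obj.V := by
  by_contra hQ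
  rw [not_nontrivial_iff_subsingleton] at hQ
  let f := (λₗ[FDRep ℂ W] (regular H.subtype ζ)).hom ≫ θ.inv
  have h : (0 : 𝟙_ (FDRep ℂ W) ⟶ 𝟙_ (FDRep ℂ W)) ⊵ₗ _ ≫ f = f :=
    bilinLift_injective F θ fun x y => Subsingleton.elim _ _
  rw [← Category.assoc, cancel_mono] at h
  have h2 := LinearMap.congr_fun (congrArg Hom.toLin h)
    (tmul (𝟙_ (FDRep ℂ W)) _ (fdScalar 1) (toRegular H.subtype ζ 1))
  have h3 := h2.trans (actionUnitIso_tmul 1 _)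
  rw [one_smul] at h3
  have h4 : (toRegular H.subtype ζ) 1 = (0 : ℂ) • (toRegular H.subtype ζ) 1 := h3.symm
  rw [zero_smul, LinearEquiv.map_eq_zero_iff] at h4
  have h5 := congrArg (coeff (1 : H)) h4
  rw [← of_one, coeff_of, if_pos rfl, map_zero] at h5
  exact one_ne_zero h5

variable [F.Faithful]

/-- The projections `gradeOp` sum to the identity, because the sum of the basis vectors of `ℂ[W]` is
invariant and acts on `ℂ_ζ H` as the identity. -/
theorem sum_gradeOp [Fintype W] (y : Q.obj.V) : ∑ w, gradeOp F θ w y = y := by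
  have hinv : ∀ u : W, (leftRegularRep W).ρ u (∑ w, leftRegularBasis W w) =
      ∑ w, leftRegularBasis W w := fun u => by
    rw [map_sum, Finset.sum_congr rfl fun w _ => leftRegularRep_ρ_basis u w]
    exact Fintype.sum_equiv (Equiv.mulLeft u) _ _ fun w => rfl
  let η : 𝟙_ (FDRep ℂ W) ⟶ leftRegularRep W :=
    fdHom (X := 𝟙_ (FDRep ℂ W)) (LinearMap.toSpanSingleton ℂ _ (∑ w, leftRegularBasis W w))
      fun w (c : ℂ) => by
        change c • _ = (leftRegularRep W).ρ w (c • _)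
        rw [map_smul, hinv]
  have hη : ∀ c : ℂ, fdLin η (fdScalar c) = c • ∑ w, leftRegularBasis W w := fun c => rfl
  have h : η ⊵ₗ regular H.subtype ζ ≫ degreeAction H.subtype ζ =
      (λₗ[FDRep ℂ W] (regular H.subtype ζ)).hom := by
    refine tensor_hom_ext fun (c : ℂ) m => ?_
    obtain ⟨b, rfl⟩ := (toRegular H.subtype ζ).surjective m
    refine Eq.trans ?_ (actionUnitIso_tmul c _).symm
    rw [comp_toLin, LinearMap.comp_apply, actionHomLeft_tmul]
    change (degreeAction H.subtype ζ).toLin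
      (tmul _ _ (c • ∑ w, leftRegularBasis W w) (toRegular H.subtype ζ b)) = _
    simp only [map_smul, map_sum, LinearMap.smul_apply, LinearMap.sum_apply, degreeAction_tmul]
    rw [← map_sum, sum_degProj]
  have h2 := bilinLift_whisker F θ η (degreeAction H.subtype ζ ≫ θ.inv) (fdScalar 1) y
  rw [← Category.assoc, h, bilinLift_unit, one_smul, hη, one_smul, map_sum,
    LinearMap.sum_apply] at h2
  exact h2.symm

open Classical in
/-- The projections `gradeOp` are orthogonal idempotents: pointwise multiplication of functions on
`W` is a morphism `ℂ[W] ⊗ ℂ[W] ⟶ ℂ[W]`, for which `degreeAction` is an associative action. -/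
theorem gradeOp_gradeOp (v w : W) (y : Q.obj.V) :
    gradeOp F θ v (gradeOp F θ w y) = if v = w then gradeOp F θ w y else 0 := by
  let m : leftRegularRep W →ₗ[ℂ] leftRegularRep W →ₗ[ℂ] leftRegularRep W :=
    (leftRegularBasis W).constr ℂ fun v => (leftRegularBasis W).constr ℂ fun w =>
      if v = w then leftRegularBasis W w else 0
  have hm : ∀ v w, m (leftRegularBasis W v) (leftRegularBasis W w) =
      if v = w then leftRegularBasis W w else 0 := fun v w => by
    simp only [m, Module.Basis.constr_basis]
  have hm2 : ∀ u x y, m ((leftRegularRep W).ρ u x) ((leftRegularRep W).ρ u y) =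
      (leftRegularRep W).ρ u (m x y) := fun u x y => by
    induction x using leftRegularRep_induction with
    | h0 => simp only [map_zero, LinearMap.zero_apply]
    | hadd x y hx hy => simp only [map_add, LinearMap.add_apply, hx, hy]
    | hs c v =>
      induction y using leftRegularRep_induction with
      | h0 => simp only [map_zero]
      | hadd x y hx hy => simp only [map_add, hx, hy]
      | hs d w =>
        simp only [map_smul, LinearMap.smul_apply, leftRegularRep_ρ_basis, hm, mul_right_inj]
        split_ifs
        · rw [leftRegularRep_ρ_basis]
        · rw [map_zero]
  let μ : leftRegularRep W ⊗ leftRegularRep W ⟶ leftRegularRep W :=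
    fdHom (TensorProduct.lift m) fun u t => by
      induction t using fdTmul_induction with
      | h0 => simp only [map_zero]
      | hadd x y hx hy => simp only [map_add, hx, hy]
      | ht x y => exact hm2 u x y
  have hμ : ∀ x y, fdLin μ (fdTmul _ _ x y) = m x y := fun _ _ => rfl
  have h : μ ⊵ₗ regular H.subtype ζ ≫ degreeAction H.subtype ζ =
      (αₗ _ _ _).hom ≫ _ ⊴ₗ degreeAction H.subtype ζ ≫ degreeAction H.subtype ζ := by
    refine tensor_hom_ext fun t b => ?_
    obtain ⟨b, rfl⟩ := (toRegular H.subtype ζ).surjective b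
    induction t using fdTmul_induction with
    | h0 => simp only [map_zero, LinearMap.zero_apply]
    | hadd x y hx hy => simp only [map_add, LinearMap.add_apply, hx, hy]
    | ht x y =>
      rw [comp_toLin, LinearMap.comp_apply, actionHomLeft_tmul, comp_toLin, LinearMap.comp_apply,
        actionAssocIso_tmul, comp_toLin, LinearMap.comp_apply, actionHomRight_tmul, hμ]
      induction x using leftRegularRep_induction with
      | h0 => simp only [map_zero, LinearMap.zero_apply]
      | hadd x y hx hy => simp only [map_add, LinearMap.add_apply, hx, hy]
      | hs c v =>
        induction y using leftRegularRep_induction with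
        | h0 => simp only [map_zero, LinearMap.zero_apply]
        | hadd x y hx hy => simp only [map_add, LinearMap.add_apply, hx, hy]
        | hs d w =>
          simp only [map_smul, LinearMap.smul_apply, degreeAction_tmul, hm,
            degProj_apply_of_mem v (degProj_mem w b)]
          by_cases hvw : v = w
          · rw [if_pos hvw, if_pos hvw.symm, degreeAction_tmul]
          · rw [if_neg hvw, if_neg (Ne.symm hvw)]
            simp only [map_zero, LinearMap.zero_apply]
  have h1 := bilinLift_assoc F θ (degreeAction H.subtype ζ) (degreeAction H.subtype ζ ≫ θ.inv)
    (leftRegularBasis W v) (leftRegularBasis W w) y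
  have h2 := bilinLift_whisker F θ μ (degreeAction H.subtype ζ ≫ θ.inv)
    (fdTmul _ _ (leftRegularBasis W v) (leftRegularBasis W w)) y
  have h3 := congrArg (· ≫ θ.inv) h
  simp only [Category.assoc] at h3
  rw [h3, h1, hμ, hm] at h2
  rw [gradeOp, gradeOp, h2]
  split_ifs
  · rfl
  · rw [map_zero, LinearMap.zero_apply]

/-- Right multiplication by `h` has degree `h`. -/
theorem rightOp_gradeOp (h : H) (w : W) (y : Q.obj.V) :
    Hom.toLin (rightOp F θ (of ζ h)).hom (gradeOp F θ w y) =
      gradeOp F θ (w * h) (Hom.toLin (rightOp F θ (of ζ h)).hom y) := by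
  classical
  let t₀ : leftRegularRep W →ₗ[ℂ] leftRegularRep W :=
    (leftRegularBasis W).constr ℂ fun w => leftRegularBasis W (w * h)
  have ht₀ : ∀ w, t₀ (leftRegularBasis W w) = leftRegularBasis W (w * h) := fun w => by
    simp only [t₀, Module.Basis.constr_basis]
  let t : leftRegularRep W ⟶ leftRegularRep W :=
    fdHom t₀ fun u x => by
      induction x using leftRegularRep_induction with
      | h0 => simp only [map_zero]
      | hadd x y hx hy => simp only [map_add, hx, hy]
      | hs c w => simp only [map_smul, leftRegularRep_ρ_basis, ht₀, mul_assoc]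
  have ht : ∀ w, fdLin t (leftRegularBasis W w) = leftRegularBasis W (w * h) := ht₀
  have h1 : degreeAction H.subtype ζ ≫ regularRightMul H.subtype (of ζ h) =
      t ⊵ₗ _ ≫ _ ⊴ₗ regularRightMul H.subtype (of ζ h) ≫ degreeAction H.subtype ζ := by
    refine leftRegularRep_tensor_hom_ext fun w b => ?_
    rw [comp_toLin, LinearMap.comp_apply, degreeAction_tmul, regularRightMul_apply,
      comp_toLin, LinearMap.comp_apply, actionHomLeft_tmul, comp_toLin, LinearMap.comp_apply,
      actionHomRight_tmul, ht, regularRightMul_apply, degreeAction_tmul]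
    rw [degProj_mul_of]
    rfl
  have h2 := bilinLift_comp F θ (degreeAction H.subtype ζ ≫ θ.inv) (rightOp F θ (of ζ h))
    (leftRegularBasis W w) y
  have h3 : θ.inv ≫ F.map (rightOp F θ (of ζ h)) = regularRightMul H.subtype (of ζ h) ≫ θ.inv := by
    rw [← map_rightOp F θ]
    simp
  rw [Category.assoc, h3, ← Category.assoc, h1, Category.assoc, bilinLift_whisker, Category.assoc,
    ← map_rightOp F θ, bilinLift_precomp, ht] at h2
  exact h2.symm

/-- An endomorphism of `Q` preserving the grading is a scalar: it corresponds to right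
multiplication by an element of degree `1` of `ℂ_ζ H`. -/
theorem exists_smul_of_gradeOp_comm (p : Q ⟶ Q)
    (hp : ∀ w y, Hom.toLin p.hom (gradeOp F θ w y) = gradeOp F θ w (Hom.toLin p.hom y)) :
    ∃ c : ℂ, ∀ y, Hom.toLin p.hom y = c • y := by
  let p' : regular H.subtype ζ ⟶ regular H.subtype ζ := θ.inv ≫ F.map p ≫ θ.hom
  have h1 : _ ⊴ₗ p' ≫ degreeAction H.subtype ζ = degreeAction H.subtype ζ ≫ p' := by
    rw [← cancel_mono θ.inv]
    refine bilinLift_injective F θ fun x y => ?_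
    have h2 : ((degreeAction H.subtype ζ ≫ p') ≫ θ.inv) =
      (degreeAction H.subtype ζ ≫ θ.inv) ≫ F.map p := by simp [p']
    rw [h2, bilinLift_comp, Category.assoc, bilinLift_precomp]
    induction x using leftRegularRep_induction with
    | h0 => simp only [map_zero, LinearMap.zero_apply]
    | hadd x y hx hy => simp only [map_add, LinearMap.add_apply, hx, hy]
    | hs c w =>
      simp only [map_smul, LinearMap.smul_apply]
      rw [← gradeOp, hp]
  obtain ⟨b, hb⟩ := (toRegular H.subtype ζ).surjective (p'.toLin (toRegular H.subtype ζ 1))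
  have h2 : b ∈ degPart H.subtype ζ 1 := by
    have h3 := LinearMap.congr_fun (congrArg Hom.toLin h1)
      (tmul _ _ (leftRegularBasis W 1) (toRegular H.subtype ζ 1))
    rw [comp_toLin, LinearMap.comp_apply, actionHomRight_tmul, ← hb, degreeAction_tmul,
      comp_toLin, LinearMap.comp_apply, degreeAction_tmul, ← of_one,
      degProj_apply_of_mem 1 (of_mem_degPart (map_one _)), if_pos rfl, of_one, ← hb] at h3
    rw [← (toRegular H.subtype ζ).injective h3]
    exact degProj_mem _ _
  obtain ⟨c, rfl⟩ : ∃ c : ℂ, b = c • 1 := by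
    have h3 : {g : H | H.subtype g = 1} = {1} := by
      ext g
      simp
    rw [degPart, h3, Set.image_singleton, of_one] at h2
    obtain ⟨c, hc⟩ := Submodule.mem_span_singleton.1 h2
    exact ⟨c, hc.symm⟩
  refine ⟨c, fun y => ?_⟩
  let γ : 𝟙_ (FDRep ℂ W) ⟶ 𝟙_ (FDRep ℂ W) := c • 𝟙 _
  have hγ : ∀ d : ℂ, fdLin γ (fdScalar d) = fdScalar (c * d) := fun d => rfl
  have h3 : γ ⊵ₗ _ ≫ (λₗ[FDRep ℂ W] (regular H.subtype ζ)).hom =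
      (λₗ[FDRep ℂ W] (regular H.subtype ζ)).hom ≫ p' := by
    refine tensor_hom_ext fun (d : ℂ) m => ?_
    obtain ⟨a, rfl⟩ := (toRegular H.subtype ζ).surjective m
    have ha : toRegular H.subtype ζ a =
        (regular H.subtype ζ).ρ a (toRegular H.subtype ζ 1) := by
      rw [ρ_toRegular, mul_one]
    rw [comp_toLin, LinearMap.comp_apply, comp_toLin, LinearMap.comp_apply]
    refine (actionUnitIso_tmul (c * d) _).trans ?_
    refine Eq.trans ?_ (congrArg p'.toLin (actionUnitIso_tmul d _).symm)
    rw [map_smul, ha, hom_comm_apply, ← hb, map_smul, map_smul, smul_smul, mul_comm]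
    rfl
  have h4 := bilinLift_whisker F θ γ ((λₗ[FDRep ℂ W] (regular H.subtype ζ)).hom ≫ θ.inv)
    (fdScalar 1) y
  have h5 := bilinLift_comp F θ ((λₗ[FDRep ℂ W] (regular H.subtype ζ)).hom ≫ θ.inv) p
    (fdScalar 1) y
  have h6 : ((λₗ[FDRep ℂ W] (regular H.subtype ζ)).hom ≫ θ.inv) ≫ F.map p =
      (γ ⊵ₗ _ ≫ (λₗ[FDRep ℂ W] (regular H.subtype ζ)).hom) ≫ θ.inv := by
    rw [h3]
    simp [p']
  rw [bilinLift_unit, one_smul, h6, Category.assoc, h4, hγ, mul_one, bilinLift_unit] at h5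
  exact h5.symm

end Grading

end TwistedRep

/-! ### The graded corner of a module equivalence -/

/-- Elements `τ h`, for `h ∈ H`, that span the corner `τ(1) ℂ_ψ G τ(1)` defined by an idempotent
`τ(1)` of `ℂ_ψ G`, multiply according to the cocycle `ζ`, and are homogeneous for the `W`-grading
of `ℂ_ψ G`: the element `τ h` has degree `h ∈ W`. So the corner is a copy of `ℂ_ζ H`. -/
structure IsGradedCorner {G W : Type} [Group G] [Group W] (π : G →* W) {ψ : TwoCocycle G}
    {H : Subgroup W} (ζ : TwoCocycle H) (τ : H → TwistedGroupAlgebra ψ) : Prop where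
  mem_degPart : ∀ h : H, τ h ∈ TwistedGroupAlgebra.degPart π ψ (h : W)
  mul : ∀ h k, τ h * τ k = (ζ h k : ℂ) • τ (h * k)
  ne_zero : τ 1 ≠ 0
  corner_le_span : ∀ a, τ 1 * a * τ 1 ∈ Submodule.span ℂ (Set.range τ)

namespace TwistedRep

open MonoidalCategory MonoidalLeftAction TensorProduct TwistedGroupAlgebra

variable {G W : Type} [Group G] [Finite G] [Group W] [Finite W] {π : G →* W} {ψ : TwoCocycle G}
  {T : ModuleSubcategory (FDRep ℂ W) (TwistedRep π ψ)} {H : Subgroup W} {ζ : TwoCocycle H}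
  (F : T.Cat ⥤ TwistedRep H.subtype ζ) [F.Full] [F.Faithful] [F.LeftLinear (FDRep ℂ W)]
  {Q : T.Cat} (θ : F.obj Q ≅ regular H.subtype ζ)

/-- The representation `Q` is generated by a vector `q` of degree `1`, and `Q` is embedded in
`ℂ_ψ G` by a homogeneous section `s` of `a ↦ a q`. The section is the graded average of a
generalised inverse; the composite `Q → ℂ_ψ G → Q` is an endomorphism that preserves the grading,
hence a scalar. -/
theorem exists_graded_section (hπ : Function.Surjective π) :
    ∃ (q : Q.obj.V) (s : Q.obj.V →ₗ[ℂ] TwistedGroupAlgebra ψ),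
      q ≠ 0 ∧ gradeOp F θ 1 q = q ∧ (∀ a y, s (Q.obj.ρ a y) = a * s y) ∧
      (∀ w y, s (gradeOp F θ w y) = degProj π ψ w (s y)) ∧ ∀ y, Q.obj.ρ (s y) q = y := by
  classical
  have := Fintype.ofFinite G
  have := Fintype.ofFinite W
  -- A nonzero homogeneous vector can be moved to degree `1`, as `π` is surjective.
  obtain ⟨q, hq0, hq⟩ : ∃ q : Q.obj.V, q ≠ 0 ∧ gradeOp F θ 1 q = q := by
    have := nontrivial_of_iso_regular F θ
    obtain ⟨y, hy⟩ := exists_ne (0 : Q.obj.V)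
    obtain ⟨w, hw⟩ : ∃ w, gradeOp F θ w y ≠ 0 := by
      by_contra! h
      exact hy (by rw [← sum_gradeOp F θ y]; simp [h])
    obtain ⟨g, hg⟩ := hπ w⁻¹
    refine ⟨Q.obj.ρ (of ψ g) (gradeOp F θ w y), fun h0 => hw ?_, ?_⟩
    · have := congrArg (Q.obj.ρ ((ofUnit ψ g)⁻¹ : (TwistedGroupAlgebra ψ)ˣ)) h0
      rwa [← Module.End.mul_apply, ← map_mul, inv_ofUnit_mul_of, map_one, Module.End.one_apply,
        map_zero] at this
    · rw [ρ_gradeOp, hg, inv_mul_cancel, gradeOp_gradeOp, if_pos rfl]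
  have hqw : ∀ w, gradeOp F θ w q = if w = 1 then q else 0 := fun w => by
    conv_lhs => rw [← hq]
    rw [gradeOp_gradeOp, hq]
  let f : TwistedGroupAlgebra ψ →ₗ[ℂ] Q.obj.V := LinearMap.applyₗ q ∘ₗ Q.obj.ρ.toLinearMap
  have hf : ∀ a, f a = Q.obj.ρ a q := fun a => rfl
  have hfmul : ∀ a b, f (a * b) = Q.obj.ρ a (f b) := fun a b => by
    rw [hf, hf, map_mul, Module.End.mul_apply]
  have hfdeg : ∀ w a, f (degProj π ψ w a) = gradeOp F θ w (f a) := fun w a => by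
    induction a using TwistedGroupAlgebra.induction with
    | h0 => simp only [map_zero]
    | hadd a b ha hb => simp only [map_add, ha, hb]
    | hs c g =>
      have h1 : gradeOp F θ w (f (of ψ g)) = Q.obj.ρ (of ψ g) (gradeOp F θ ((π g)⁻¹ * w) q) := by
        rw [ρ_gradeOp, mul_inv_cancel_left, hf]
      rw [map_smul, map_smul, map_smul, map_smul, h1, hqw, degProj_of, inv_mul_eq_one]
      split_ifs <;> simp [hf]
  obtain ⟨s₀, hs₀⟩ : ∃ s₀ : Q.obj.V →ₗ[ℂ] TwistedGroupAlgebra ψ, ∀ a, f (s₀ (f a)) = f a := by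
    obtain ⟨s₁, hs₁⟩ := LinearMap.exists_rightInverse_of_surjective f.rangeRestrict
      (LinearMap.range_rangeRestrict f)
    obtain ⟨s₀, hs₀⟩ := LinearMap.exists_extend s₁
    refine ⟨s₀, fun a => ?_⟩
    have h1 : s₀ (f a) = s₁ (f.rangeRestrict a) := LinearMap.congr_fun hs₀ (f.rangeRestrict a)
    rw [h1]
    exact congrArg Subtype.val (LinearMap.congr_fun hs₁ (f.rangeRestrict a))
  let s₁ : Q.obj.V →ₗ[ℂ] TwistedGroupAlgebra ψ :=
    ∑ w, degProj π ψ w ∘ₗ s₀ ∘ₗ gradeOp F θ w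
  have hs₁deg : ∀ w y, s₁ (gradeOp F θ w y) = degProj π ψ w (s₁ y) := fun w y => by
    simp only [s₁, LinearMap.sum_apply, LinearMap.comp_apply, map_sum, gradeOp_gradeOp,
      degProj_apply_of_mem w (degProj_mem _ _)]
    simp [apply_ite]
  have hs₁ : ∀ a, f (s₁ (f a)) = f a := fun a => by
    simp only [s₁, LinearMap.sum_apply, LinearMap.comp_apply, map_sum, hfdeg]
    rw [← sum_gradeOp F θ (f a)]
    refine Finset.sum_congr rfl fun w _ => ?_
    rw [sum_gradeOp, ← hfdeg w a, hs₀, hfdeg, gradeOp_gradeOp, if_pos rfl]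
  let ρR := Algebra.lsmul ℂ ℂ (A := TwistedGroupAlgebra ψ) (TwistedGroupAlgebra ψ)
  have hρR : ∀ a b, ρR a b = a * b := fun a b => rfl
  let s : Q.obj.V →ₗ[ℂ] TwistedGroupAlgebra ψ := average Q.obj.ρ ρR s₁
  have hs_apply : ∀ y, s y = (Fintype.card G : ℂ)⁻¹ • ∑ g : G,
      ((ofUnit ψ g)⁻¹ : (TwistedGroupAlgebra ψ)ˣ) * s₁ (Q.obj.ρ (of ψ g) y) := fun y => by
    simp only [s, average, LinearMap.smul_apply, LinearMap.sum_apply, LinearMap.comp_apply, hρR]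
  have hsmul : ∀ a y, s (Q.obj.ρ a y) = a * s y := fun a y => average_comm _ _ _ _ _
  have hsdeg : ∀ w y, s (gradeOp F θ w y) = degProj π ψ w (s y) := fun w y => by
    rw [hs_apply, hs_apply, map_smul, map_sum]
    congr 1
    refine Finset.sum_congr rfl fun g _ => ?_
    rw [ρ_gradeOp, hs₁deg, val_inv_ofUnit, smul_mul_assoc, smul_mul_assoc, of_mul_degProj,
      map_smul, map_inv, inv_mul_cancel_left]
  have hfs : ∀ a, f (s (f a)) = f a := fun a => by
    have h1 : ∀ g, f (((ofUnit ψ g)⁻¹ : (TwistedGroupAlgebra ψ)ˣ) * s₁ (Q.obj.ρ (of ψ g) (f a))) =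
        f a := fun g => by
      rw [hfmul, ← hfmul (of ψ g), hs₁, ← hfmul, ← mul_assoc, inv_ofUnit_mul_of, one_mul]
    rw [hs_apply, map_smul, map_sum, Finset.sum_congr rfl fun g _ => h1 g, Finset.sum_const,
      Finset.card_univ, ← Nat.cast_smul_eq_nsmul ℂ, smul_smul, inv_mul_cancel₀ (by simp), one_smul]
  let p : Q ⟶ Q := ObjectProperty.homMk (homOfGroup (f ∘ₗ s) fun g => LinearMap.ext fun y => by
    simp only [LinearMap.comp_apply, hsmul, hfmul])
  have hp : ∀ y, Hom.toLin p.hom y = f (s y) := fun y => rfl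
  obtain ⟨c, hc⟩ := exists_smul_of_gradeOp_comm F θ p fun w y => by
    rw [hp, hp, hsdeg, hfdeg]
  have hc1 : c = 1 := by
    have h1 := hc q
    have h2 : f 1 = q := by rw [hf, map_one, Module.End.one_apply]
    rw [hp, ← h2, hfs, h2] at h1
    exact (smul_left_injective ℂ hq0 ((one_smul ℂ q).trans h1)).symm
  exact ⟨q, s, hq0, hq, hsmul, hsdeg, fun y => by rw [← hf, ← hp, hc, hc1, one_smul]⟩

/-- A module equivalence `F` is given by a graded corner: `F M` is the image of the idempotent
`τ(1)` in `M`, where `h ∈ H` acts as `τ h`. Here `τ h = s(q ⋅ h)`, for the generator `q` of `Q` and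
the section `s` of `exists_graded_section`, so that `τ(1) ℂ_ψ G τ(1)` is the opposite of the algebra
of endomorphisms of `Q`. The map `F M → M` comes from the natural map `F M ⊗ Q → M`, where `W` acts
trivially on the first factor. -/
theorem exists_gradedCorner (hπ : Function.Surjective π) (θ : F.obj Q ≅ regular H.subtype ζ) :
    ∃ τ : H → TwistedGroupAlgebra ψ, IsGradedCorner π ζ τ ∧
      (∀ a, (∀ M, T.prop M → M.ρ a = 1) → a * τ 1 = τ 1) ∧
      ∀ M : T.Cat, ∃ j : (F.obj M).V →ₗ[ℂ] M.obj.V, Function.Injective j ∧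
        LinearMap.range j = LinearMap.range (M.obj.ρ (τ 1)) ∧
        ∀ h n, j ((F.obj M).ρ (of ζ h) n) = M.obj.ρ (τ h) (j n) := by
  classical
  obtain ⟨q, s, hq0, hq, hsmul, hsdeg, hsq⟩ := exists_graded_section F θ hπ
  let r : H → Q.obj.V →ₗ[ℂ] Q.obj.V := fun h => Hom.toLin (rightOp F θ (of ζ h)).hom
  have hrρ : ∀ h a y, r h (Q.obj.ρ a y) = Q.obj.ρ a (r h y) := fun h a y =>
    hom_comm_apply (rightOp F θ (of ζ h)).hom a y
  let τ : H → TwistedGroupAlgebra ψ := fun h => s (r h q)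
  have hτq : ∀ h, Q.obj.ρ (τ h) q = r h q := fun h => hsq _
  -- The bilinear map `F M × Q → M` corresponding to the action `F M × ℂ_ζ H → F M`.
  let X : T.Cat → FDRep ℂ W := fun M => trivialRep W (F.obj M).V
  let k : ∀ M : T.Cat, X M ⊙ₗ regular H.subtype ζ ⟶ F.obj M := fun M =>
    tensorHom (LinearMap.flip ((F.obj M).ρ.toLinearMap ∘ₗ (toRegular H.subtype ζ).symm.toLinearMap)
      ∘ₗ (toTrivial W _).symm.toLinearMap) fun g x m => by
        obtain ⟨n, rfl⟩ := (toTrivial W _).surjective x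
        obtain ⟨b, rfl⟩ := (toRegular H.subtype ζ).surjective m
        change (F.obj M).ρ (of ζ g * b) n = (F.obj M).ρ (of ζ g) ((F.obj M).ρ b n)
        rw [map_mul, Module.End.mul_apply]
  let J : ∀ M : T.Cat, (F.obj M).V →ₗ[ℂ] Q.obj.V →ₗ[ℂ] M.obj.V := fun M =>
    bilinLift F θ (k M) ∘ₗ (toTrivial W _).toLinearMap
  have hJρ : ∀ M n a y, J M n (Q.obj.ρ a y) = M.obj.ρ a (J M n y) := fun M n a y => by
    induction a using TwistedGroupAlgebra.induction with
    | h0 => simp only [map_zero, LinearMap.zero_apply]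
    | hadd a b ha hb => simp only [map_add, LinearMap.add_apply, ha, hb]
    | hs c g =>
      simp only [map_smul, LinearMap.smul_apply]
      congr 1
      exact bilinLift_equivariant F θ (k M) g (toTrivial W _ n) y
  have hJr : ∀ M n h y, J M n (r h y) = J M ((F.obj M).ρ (of ζ h) n) y := fun M n h y => by
    let φ : X M ⟶ X M := fdHom ((toTrivial W _).toLinearMap ∘ₗ (F.obj M).ρ (of ζ h) ∘ₗ
      (toTrivial W _).symm.toLinearMap) fun w x => rfl
    have h1 : X M ⊴ₗ regularRightMul H.subtype (of ζ h) ≫ k M = φ ⊵ₗ _ ≫ k M := by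
      refine tensor_hom_ext fun x m => ?_
      obtain ⟨n, rfl⟩ := (toTrivial W _).surjective x
      obtain ⟨b, rfl⟩ := (toRegular H.subtype ζ).surjective m
      change (F.obj M).ρ (b * of ζ h) n = (F.obj M).ρ b ((F.obj M).ρ (of ζ h) n)
      rw [map_mul, Module.End.mul_apply]
    have h2 := bilinLift_precomp F θ (rightOp F θ (of ζ h)) (k M) (toTrivial W _ n) y
    rw [map_rightOp, h1, bilinLift_whisker] at h2
    exact h2.symm
  -- A vector of `F M`, as a morphism from the trivial representation.
  let φ : ∀ M : T.Cat, (F.obj M).V → (𝟙_ (FDRep ℂ W) ⟶ X M) := fun M n =>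
    fdHom (X := 𝟙_ (FDRep ℂ W)) (LinearMap.toSpanSingleton ℂ _ (toTrivial W _ n)) fun w c => rfl
  have hφk : ∀ M n (c : ℂ) b, Hom.toLin (φ M n ⊵ₗ regular H.subtype ζ ≫ k M)
      (tmul (𝟙_ (FDRep ℂ W)) _ (fdScalar c) (toRegular H.subtype ζ b)) = (F.obj M).ρ b (c • n) :=
    fun M n c b => rfl
  have hφ : ∀ M n (c : ℂ) y, bilinLift F θ (φ M n ⊵ₗ regular H.subtype ζ ≫ k M) (fdScalar c) y =
      c • J M n y := fun M n c y => by
    rw [bilinLift_whisker, ← LinearMap.smul_apply, ← map_smul]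
    rfl
  have hunit : ∀ {N : TwistedRep H.subtype ζ} {f f' : 𝟙_ (FDRep ℂ W) ⊙ₗ regular H.subtype ζ ⟶ N},
      (∀ c : ℂ, ∀ b, f.toLin (tmul (𝟙_ (FDRep ℂ W)) _ (fdScalar c) (toRegular H.subtype ζ b)) =
        f'.toLin (tmul (𝟙_ (FDRep ℂ W)) _ (fdScalar c) (toRegular H.subtype ζ b))) → f = f' :=
    fun {N f f'} h => tensor_hom_ext fun c m => by
      obtain ⟨b, rfl⟩ := (toRegular H.subtype ζ).surjective m
      exact h c b
  have hJ_inj : ∀ M n, (∀ y, J M n y = 0) → n = 0 := fun M n hn => by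
    have h1 : φ M n ⊵ₗ regular H.subtype ζ ≫ k M = φ M 0 ⊵ₗ regular H.subtype ζ ≫ k M := by
      refine bilinLift_injective F θ fun (c : ℂ) y => ?_
      refine (hφ M n c y).trans (Eq.trans ?_ (hφ M 0 c y).symm)
      rw [hn, map_zero, LinearMap.zero_apply]
    have h2 := hφk M n 1 1
    rw [h1, hφk, one_smul, one_smul, map_one] at h2
    exact h2.symm
  have hJ_surj : ∀ (M : T.Cat) (f : Q.obj.V →ₗ[ℂ] M.obj.V),
      (∀ g y, f (Q.obj.ρ (of ψ g) y) = M.obj.ρ (of ψ g) (f y)) → ∃ n, ∀ y, J M n y = f y := by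
    intro M f hf
    obtain ⟨k', hk'⟩ := exists_bilinLift_eq F θ (X := 𝟙_ (FDRep ℂ W)) (N := M)
      (LinearMap.toSpanSingleton ℂ _ f) fun g (c : ℂ) y => by
        change c • f _ = M.obj.ρ (of ψ g) (c • f y)
        rw [hf, map_smul]
    let n := k'.toLin (tmul (𝟙_ (FDRep ℂ W)) _ (fdScalar 1) (toRegular H.subtype ζ 1))
    have h1 : φ M n ⊵ₗ regular H.subtype ζ ≫ k M = k' := by
      refine hunit fun c b => ?_
      rw [hφk]
      induction b using TwistedGroupAlgebra.induction with
      | h0 => simp only [map_zero, LinearMap.zero_apply]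
      | hadd a b ha hb => simp only [map_add, LinearMap.add_apply, ha, hb]
      | hs d h =>
        have h2 := ρ_of_tmul (X := 𝟙_ (FDRep ℂ W)) (M := regular H.subtype ζ) h (fdScalar c)
          (toRegular H.subtype ζ 1)
        rw [ρ_toRegular, mul_one] at h2
        have h3 : (fdScalar c : (𝟙_ (FDRep ℂ W) : FDRep ℂ W)) = c • fdScalar 1 :=
          (mul_one c).symm
        have h4 : k'.toLin (tmul (𝟙_ (FDRep ℂ W)) _ (fdScalar c) (toRegular H.subtype ζ (of ζ h))) =
            (F.obj M).ρ (of ζ h) (c • n) := by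
          refine (congrArg k'.toLin h2.symm).trans ?_
          rw [hom_comm_apply, h3, map_smul, LinearMap.smul_apply, map_smul]
        simp only [map_smul, LinearMap.smul_apply]
        rw [h4, map_smul, smul_comm]
    refine ⟨n, fun y => ?_⟩
    have h2 := hφ M n 1 y
    rw [h1, hk', one_smul] at h2
    exact h2.symm.trans (one_smul ℂ (f y))
  -- The generator of `F Q ≅ ℂ_ζ H` acts on `Q` as the identity.
  let n₁ : (F.obj Q).V := θ.inv.toLin (toRegular H.subtype ζ 1)
  have hn₁ : ∀ b, (F.obj Q).ρ b n₁ = θ.inv.toLin (toRegular H.subtype ζ b) := fun b => by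
    rw [← hom_comm_apply, ρ_toRegular, mul_one]
  have hJn₁ : ∀ y, J Q n₁ y = y := fun y => by
    have h1 : φ Q n₁ ⊵ₗ regular H.subtype ζ ≫ k Q =
        (λₗ[FDRep ℂ W] (regular H.subtype ζ)).hom ≫ θ.inv := by
      refine hunit fun c b => ?_
      rw [hφk, map_smul, hn₁, ← map_smul]
      rfl
    have h2 := hφ Q n₁ 1 y
    rw [h1, bilinLift_unit, one_smul, one_smul] at h2
    exact h2.symm
  have hr : ∀ h y, r h y = J Q ((F.obj Q).ρ (of ζ h) n₁) y := fun h y => by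
    rw [← hJr, hJn₁]
  have hr1 : r 1 q = q := by
    rw [hr, of_one, map_one, Module.End.one_apply, hJn₁]
  have hrr : ∀ h h' y, r h' (r h y) = (ζ h h' : ℂ) • r (h * h') y := fun h h' y => by
    rw [hr h', hJr, ← Module.End.mul_apply, ← map_mul, of_mul_of, hr, map_smul,
      LinearMap.smul_apply, map_smul, LinearMap.smul_apply]
  have hτ1q : Q.obj.ρ (τ 1) q = q := by rw [hτq, hr1]
  have hτmul : ∀ h h', τ h * τ h' = (ζ h h' : ℂ) • τ (h * h') := fun h h' => by
    change τ h * s (r h' q) = _ • s (r (h * h') q)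
    rw [← hsmul, ← hrρ, hτq, hrr, map_smul]
  have hsq1 : ∀ a, s (Q.obj.ρ a q) = a * τ 1 := fun a => by
    rw [hsmul]
    change _ = a * s (r 1 q)
    rw [hr1]
  have hj_range : ∀ M, LinearMap.range ((J M).flip q) = LinearMap.range (M.obj.ρ (τ 1)) := by
    intro M
    ext m
    constructor
    · rintro ⟨n, rfl⟩
      refine ⟨J M n q, ?_⟩
      rw [← hJρ, hτ1q]
      rfl
    · rintro ⟨m, rfl⟩
      obtain ⟨n, hn⟩ := hJ_surj M (LinearMap.applyₗ m ∘ₗ M.obj.ρ.toLinearMap ∘ₗ s) fun g y => by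
        simp only [LinearMap.comp_apply, hsmul, AlgHom.toLinearMap_apply, map_mul,
          LinearMap.applyₗ_apply_apply, Module.End.mul_apply]
      refine ⟨n, (hn q).trans ?_⟩
      simp only [LinearMap.comp_apply, AlgHom.toLinearMap_apply, LinearMap.applyₗ_apply_apply]
      have : s q = τ 1 := by
        change s q = s (r 1 q)
        rw [hr1]
      rw [this]
  have hj_comm : ∀ M n h, J M ((F.obj M).ρ (of ζ h) n) q = M.obj.ρ (τ h) (J M n q) :=
    fun M n h => by rw [← hJr, ← hτq, hJρ]
  refine ⟨τ, ⟨fun h => ?_, hτmul, fun h0 => ?_, fun a => ?_⟩, fun a ha => ?_,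
    fun M => ⟨(J M).flip q, ?_,
    hj_range M, fun h n => hj_comm M n h⟩⟩
  · change s (r h q) ∈ _
    have := rightOp_gradeOp F θ h 1 q
    rw [hq, one_mul] at this
    change r h q = gradeOp F θ h (r h q) at this
    rw [this, hsdeg]
    exact degProj_mem _ _
  · refine hq0 ?_
    rw [← hτ1q, h0, map_zero, LinearMap.zero_apply]
  · -- `τ(1) a q` lies in `τ(1) Q`, which is the image of `F Q ≅ ℂ_ζ H`.
    have h1 : Q.obj.ρ (τ 1 * a) q ∈ LinearMap.range ((J Q).flip q) := by
      rw [hj_range, map_mul]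
      exact ⟨_, rfl⟩
    obtain ⟨n, hn⟩ := h1
    obtain ⟨b, hb⟩ := (toRegular H.subtype ζ).surjective (θ.hom.toLin n)
    have hn' : n = (F.obj Q).ρ b n₁ := by
      rw [hn₁, hb, ← LinearMap.comp_apply, ← comp_toLin, Iso.hom_inv_id]
      rfl
    have h2 : τ 1 * a * τ 1 = s (J Q ((F.obj Q).ρ b n₁) q) := by
      rw [← hn', ← hsq1, ← hn]
      rfl
    rw [h2]
    clear hb hn' h2
    induction b using TwistedGroupAlgebra.induction with
    | h0 => simp only [map_zero, LinearMap.zero_apply, zero_mem]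
    | hadd a b ha hb =>
      simp only [map_add, LinearMap.add_apply]
      exact add_mem ha hb
    | hs c h =>
      simp only [map_smul, LinearMap.smul_apply]
      rw [← hr]
      exact Submodule.smul_mem _ _ (Submodule.subset_span ⟨h, rfl⟩)
  · change a * s (r 1 q) = s (r 1 q)
    rw [← hsmul, ha Q.obj Q.property, Module.End.one_apply]
  · intro n n' h
    rw [← sub_eq_zero]
    refine hJ_inj M _ fun y => ?_
    have h0 : J M (n - n') q = 0 := by
      rw [map_sub, LinearMap.sub_apply, sub_eq_zero]
      exact h
    rw [← hsq y, hJρ, h0, map_zero]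

end TwistedRep

namespace IsGradedCorner

open TwistedGroupAlgebra

variable {G W : Type} [Group G] [Group W] {π : G →* W} {ψ : TwoCocycle G} {H : Subgroup W}
  {ζ : TwoCocycle H} {τ : H → TwistedGroupAlgebra ψ}

theorem one_mul (hτ : IsGradedCorner π ζ τ) (h : H) : τ 1 * τ h = τ h := by
  rw [hτ.mul, ζ.one_left, _root_.one_mul, Units.val_one, one_smul]

theorem mul_one (hτ : IsGradedCorner π ζ τ) (h : H) : τ h * τ 1 = τ h := by
  rw [hτ.mul, ζ.one_right, _root_.mul_one, Units.val_one, one_smul]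

theorem ne_zero' (hτ : IsGradedCorner π ζ τ) (h : H) : τ h ≠ 0 := fun h0 => by
  have h1 := hτ.mul h h⁻¹
  rw [h0, zero_mul, mul_inv_cancel] at h1
  exact hτ.ne_zero ((smul_eq_zero.1 h1.symm).resolve_left (by simp))

/-- The isomorphism of `ℂ_ζ H` with the corner, as a linear map to `ℂ_ψ G`. -/
noncomputable def embed (_hτ : IsGradedCorner π ζ τ) :
    TwistedGroupAlgebra ζ →ₗ[ℂ] TwistedGroupAlgebra ψ := linLift τ

theorem embed_of (hτ : IsGradedCorner π ζ τ) (h : H) : hτ.embed (of ζ h) = τ h := linLift_of _ _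

theorem embed_mul (hτ : IsGradedCorner π ζ τ) (a b : TwistedGroupAlgebra ζ) :
    hτ.embed (a * b) = hτ.embed a * hτ.embed b := by
  induction a using TwistedGroupAlgebra.induction with
  | h0 => simp only [map_zero, zero_mul]
  | hadd a a' ha ha' => simp only [map_add, add_mul, ha, ha']
  | hs c g =>
    induction b using TwistedGroupAlgebra.induction with
    | h0 => simp only [map_zero, mul_zero]
    | hadd a a' ha ha' => simp only [map_add, mul_add, ha, ha']
    | hs d h =>
      simp only [smul_mul_assoc, mul_smul_comm, map_smul, of_mul_of, hτ.embed_of, hτ.mul]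

theorem range_embed (hτ : IsGradedCorner π ζ τ) :
    LinearMap.range hτ.embed = Submodule.span ℂ (Set.range τ) := by
  apply le_antisymm
  · rintro _ ⟨a, rfl⟩
    induction a using TwistedGroupAlgebra.induction with
    | h0 => simp only [map_zero, zero_mem]
    | hadd a b ha hb => rw [map_add]; exact add_mem ha hb
    | hs c h =>
      rw [map_smul, hτ.embed_of]
      exact Submodule.smul_mem _ _ (Submodule.subset_span ⟨h, rfl⟩)
  · rw [Submodule.span_le]
    rintro _ ⟨h, rfl⟩
    exact ⟨of ζ h, hτ.embed_of h⟩

theorem degProj_embed (hτ : IsGradedCorner π ζ τ) (h : H) (a : TwistedGroupAlgebra ζ) :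
    degProj π ψ (h : W) (hτ.embed a) = coeff h a • τ h := by
  classical
  induction a using TwistedGroupAlgebra.induction with
  | h0 => simp only [map_zero, zero_smul]
  | hadd a b ha hb => simp only [map_add, add_smul, ha, hb]
  | hs c k =>
    rw [map_smul, map_smul, hτ.embed_of, degProj_apply_of_mem _ (hτ.mem_degPart k), map_smul,
      coeff_of, smul_eq_mul, mul_smul]
    by_cases hk : k = h
    · rw [if_pos (congrArg Subtype.val hk), if_pos hk, one_smul, hk]
    · rw [if_neg (fun h' => hk (Subtype.ext h')), if_neg hk, zero_smul]

theorem degProj_embed_of_notMem (hτ : IsGradedCorner π ζ τ) {w : W} (hw : w ∉ H)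
    (a : TwistedGroupAlgebra ζ) :
    degProj π ψ w (hτ.embed a) = 0 := by
  classical
  induction a using TwistedGroupAlgebra.induction with
  | h0 => simp only [map_zero]
  | hadd a b ha hb => rw [map_add, map_add, ha, hb, add_zero]
  | hs c k =>
    rw [map_smul, map_smul, hτ.embed_of, degProj_apply_of_mem _ (hτ.mem_degPart k),
      if_neg (fun h : (k : W) = w => hw (h ▸ k.2)), smul_zero]

theorem embed_injective (hτ : IsGradedCorner π ζ τ) : Function.Injective hτ.embed := by
  rw [injective_iff_map_eq_zero]
  intro a ha
  refine ext_coeff fun h => ?_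
  have h1 := hτ.degProj_embed h a
  rw [ha, map_zero] at h1
  rw [map_zero]
  exact (smul_eq_zero.1 h1.symm).resolve_right (hτ.ne_zero' h)

theorem exists_embed_eq (hτ : IsGradedCorner π ζ τ) (a : TwistedGroupAlgebra ψ) :
    ∃ b, hτ.embed b = τ 1 * a * τ 1 := by
  have h := hτ.corner_le_span a
  rwa [← hτ.range_embed] at h

/-- A homogeneous element commuting with `τ(1)` acts on the corner as a multiple of `τ h`. -/
theorem exists_mul_eq_smul (hτ : IsGradedCorner π ζ τ) {a : TwistedGroupAlgebra ψ} {h : H}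
    (ha : a ∈ degPart π ψ (h : W))
    (hc : Commute a (τ 1)) : ∃ β : ℂ, a * τ 1 = β • τ h := by
  obtain ⟨b, hb⟩ := hτ.exists_embed_eq a
  rw [← hc.eq, mul_assoc, hτ.mul_one] at hb
  have h1 : a * τ 1 ∈ degPart π ψ (h : W) := by
    simpa using mul_mem_degPart ha (hτ.mem_degPart 1)
  have h2 := hτ.degProj_embed h b
  rw [hb, degProj_apply_of_mem _ h1, if_pos rfl] at h2
  exact ⟨_, h2⟩

theorem mul_eq_zero_of_notMem (hτ : IsGradedCorner π ζ τ) {a : TwistedGroupAlgebra ψ} {w : W}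
    (ha : a ∈ degPart π ψ w)
    (hc : Commute a (τ 1)) (hw : w ∉ H) : a * τ 1 = 0 := by
  obtain ⟨b, hb⟩ := hτ.exists_embed_eq a
  rw [← hc.eq, mul_assoc, hτ.mul_one] at hb
  have h1 : a * τ 1 ∈ degPart π ψ w := by
    simpa using mul_mem_degPart ha (hτ.mem_degPart 1)
  have h2 := hτ.degProj_embed_of_notMem hw b
  rwa [hb, degProj_apply_of_mem _ h1, if_pos rfl] at h2

end IsGradedCorner

/-! ### Class sums and corners -/

namespace TwistedGroupAlgebra

variable {G W : Type} [Group G] [Fintype G] [Group W] {π : G →* W} {ψ : TwoCocycle G}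

open Classical in
/-- The part of degree `w` of `∑ f(g) g`. -/
noncomputable def fiberSum (π : G →* W) (ψ : TwoCocycle G) (f : G → ℂ) (w : W) :
    TwistedGroupAlgebra ψ :=
  ∑ g, if π g = w then f g • of ψ g else 0

theorem fiberSum_mem_degPart (f : G → ℂ) (w : W) : fiberSum π ψ f w ∈ degPart π ψ w :=
  Submodule.sum_mem _ fun g _ => by
    split_ifs with h
    · exact Submodule.smul_mem _ _ (of_mem_degPart h)
    · exact zero_mem _

/-- A homogeneous element of degree `v` permutes the homogeneous parts of `∑ f(g) g` by conjugation
with `v`, for a class function `f` supported on regular elements. -/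
theorem mul_fiberSum (hψ : ψ.IsClassFunction) {f : G → ℂ} (hf : ∀ g k, f (k * g * k⁻¹) = f g)
    (hreg : ∀ g, f g ≠ 0 → ψ.IsRegular g) {a : TwistedGroupAlgebra ψ} {v : W}
    (ha : a ∈ degPart π ψ v) (w : W) :
    a * fiberSum π ψ f w = fiberSum π ψ f (v * w * v⁻¹) * a := by
  classical
  refine Submodule.span_induction (p := fun a _ => a * fiberSum π ψ f w =
    fiberSum π ψ f (v * w * v⁻¹) * a) ?_ (by simp) (fun x y _ _ hx hy => by
      rw [add_mul, mul_add, hx, hy]) (fun c x _ hx => by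
      rw [smul_mul_assoc, mul_smul_comm, hx]) ha
  rintro _ ⟨k, rfl, rfl⟩
  rw [fiberSum, fiberSum, Finset.mul_sum, Finset.sum_mul]
  refine Fintype.sum_equiv (MulAut.conj k).toEquiv _ _ fun g => ?_
  have h1 : (MulAut.conj k).toEquiv g = k * g * k⁻¹ := rfl
  have h2 : π (k * g * k⁻¹) = π k * w * (π k)⁻¹ ↔ π g = w := by simp
  rw [h1, hf]
  by_cases hg : π g = w
  · rw [if_pos hg, if_pos (h2.2 hg), mul_smul_comm, smul_mul_assoc]
    by_cases h0 : f g = 0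
    · rw [h0, zero_smul, zero_smul]
    · rw [of_mul_of_conj_of_isRegular hψ (hreg g h0)]
  · rw [if_neg hg, if_neg (fun h => hg (h2.1 h)), mul_zero, zero_mul]

open Classical in
theorem sum_fiberSum_isConj [Fintype W] (f : G → ℂ) (r : W) :
    (∑ w, if IsConj r w then fiberSum π ψ f w else 0) =
      ∑ g, if IsConj r (π g) then f g • of ψ g else 0 := by
  have h1 : ∀ w, (if IsConj r w then fiberSum π ψ f w else 0) =
      ∑ g, if π g = w then (if IsConj r (π g) then f g • of ψ g else 0) else 0 := fun w => by
    by_cases h : IsConj r w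
    · rw [if_pos h, fiberSum]
      refine Finset.sum_congr rfl fun g _ => ?_
      by_cases hg : π g = w
      · rw [if_pos hg, if_pos hg, hg, if_pos h]
      · rw [if_neg hg, if_neg hg]
    · rw [if_neg h]
      refine (Finset.sum_eq_zero fun g _ => ?_).symm
      by_cases hg : π g = w
      · rw [if_pos hg, hg, if_neg h]
      · rw [if_neg hg]
  simp only [h1]
  rw [Finset.sum_comm]
  exact Finset.sum_congr rfl fun g _ => by rw [Finset.sum_ite_eq, if_pos (Finset.mem_univ _)]

end TwistedGroupAlgebra

open TwistedRep TwistedGroupAlgebra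

section Transfer

variable {G W : Type} [Group G] [Group W] {π : G →* W} {ψ : TwoCocycle G}
  {H : Subgroup W} {ζ : TwoCocycle H} {τ : H → TwistedGroupAlgebra ψ}

/-- A central element of degree `1` of `e ℂ_ψ G` is a multiple of `e`, when `e` lies in the
two-sided ideal generated by the idempotent `τ(1)`. -/
theorem IsGradedCorner.exists_smul_of_central (hτ : IsGradedCorner π ζ τ)
    {e z : TwistedGroupAlgebra ψ}
    (hfull : e ∈ Submodule.span ℂ {x | ∃ a b, x = a * τ 1 * b}) (hz : ∀ a, Commute z a)
    (hz1 : z ∈ degPart π ψ 1) : ∃ c : ℂ, z * e = c • e := by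
  obtain ⟨c, hc⟩ := hτ.exists_mul_eq_smul (h := 1) hz1 (hz _)
  refine ⟨c, ?_⟩
  refine Submodule.span_induction (p := fun e _ => z * e = c • e) ?_ (by simp)
    (fun x y _ _ hx hy => by rw [mul_add, smul_add, hx, hy])
    (fun d x _ hx => by rw [mul_smul_comm, hx, smul_comm]) hfull
  rintro _ ⟨a, b, rfl⟩
  rw [← mul_assoc, ← mul_assoc, (hz a).eq, mul_assoc a, hc, mul_smul_comm, smul_mul_assoc]

theorem conjSum_mem_degPart [Fintype G] {a : TwistedGroupAlgebra ψ} (ha : a ∈ degPart π ψ 1) :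
    conjSum a ∈ degPart π ψ 1 :=
  Submodule.sum_mem _ fun g _ => by
    have h1 := mul_mem_degPart (of_mem_degPart (ψ := ψ) (rfl : π g = π g)) ha
    rw [val_inv_ofUnit, mul_smul_comm]
    have h2 := mul_mem_degPart h1 (of_mem_degPart (ψ := ψ) (rfl : π g⁻¹ = π g⁻¹))
    rw [mul_one, ← map_mul, mul_inv_cancel, map_one] at h2
    exact Submodule.smul_mem _ _ h2

/-- For a class function `f` on `G` supported on regular elements, multiplication of `∑ f(g) g` by
`τ(1)` gives `∑ β(h) τ(h)`, where `β` is a class function on `H` supported on regular elements. The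
part of degree `h` of `∑ f(g) g` commutes with `τ(1)`, so it contributes a multiple of `τ h`, and
its compatibility with conjugation by the `τ k` gives the properties of `β`. -/
theorem IsGradedCorner.exists_transfer [Fintype G] [Finite H] (hτ : IsGradedCorner π ζ τ)
    (hψ : ψ.IsClassFunction)
    (hζ : ζ.IsClassFunction) {f : G → ℂ}
    (hf : ∀ g k, f (k * g * k⁻¹) = f g) (hreg : ∀ g, f g ≠ 0 → ψ.IsRegular g) :
    ∃ β : H → ℂ, (∀ h : H, fiberSum π ψ f h * τ 1 = β h • τ h) ∧
      (∀ w ∉ H, fiberSum π ψ f w * τ 1 = 0) ∧ (∀ h, β h ≠ 0 → ζ.IsRegular h) ∧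
      ∀ h k, β (k * h * k⁻¹) = β h := by
  have hcomm : ∀ w, Commute (fiberSum π ψ f w) (τ 1) := fun w => by
    have h1 := mul_fiberSum hψ hf hreg (hτ.mem_degPart 1) w
    simp only [Subgroup.coe_one, _root_.one_mul, inv_one, _root_.mul_one] at h1
    exact h1.symm
  choose β hβ using fun h : H => hτ.exists_mul_eq_smul (fiberSum_mem_degPart (ψ := ψ) f (h : W))
    (hcomm h)
  have hkey : ∀ h k, β h * ζ k h = β (k * h * k⁻¹) * ζ (k * h * k⁻¹) k := fun h k => by
    have h1 := mul_fiberSum hψ hf hreg (hτ.mem_degPart k) h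
    have h2 : τ k * (fiberSum π ψ f h * τ 1) =
        fiberSum π ψ f (k * h * k⁻¹ : H) * τ 1 * τ k := by
      rw [← mul_assoc, h1, mul_assoc (fiberSum _ _ _ _), hτ.mul_one,
        mul_assoc (fiberSum _ _ _ _), hτ.one_mul]
      rfl
    rw [hβ, hβ, mul_smul_comm, smul_mul_assoc, hτ.mul, hτ.mul, smul_smul, smul_smul,
      inv_mul_cancel_right] at h2
    exact smul_left_injective ℂ (hτ.ne_zero' _) h2
  have hregβ : ∀ h, β h ≠ 0 → ζ.IsRegular h := fun h h0 k hk => by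
    have h1 := hkey h k
    rw [← hk.eq, mul_inv_cancel_right] at h1
    exact Units.ext (mul_left_cancel₀ h0 h1).symm
  refine ⟨β, hβ, fun w hw => hτ.mul_eq_zero_of_notMem (fiberSum_mem_degPart f w) (hcomm w) hw,
    hregβ, fun h k => ?_⟩
  have h1 := hkey h k
  by_cases h0 : β h = 0
  · rw [h0, zero_mul] at h1
    rw [h0]
    exact (mul_eq_zero.1 h1.symm).resolve_right (by simp)
  · have h2 := of_mul_of_conj_of_isRegular hζ (hregβ h h0) k
    rw [of_mul_of, of_mul_of, inv_mul_cancel_right] at h2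
    have h3 : (ζ k h : ℂ) = ζ (k * h * k⁻¹) k := by
      have h4 := congrArg (coeff (k * h)) h2
      simpa [coeff_of] using h4
    rw [h3] at h1
    exact (mul_right_cancel₀ (by simp) h1).symm

variable {T : ModuleSubcategory (FDRep ℂ W) (TwistedRep π ψ)} {e : TwistedGroupAlgebra ψ}
  {F : T.Cat ⥤ TwistedRep H.subtype ζ}

/-- If `F` is given by a graded corner, then the block idempotent lies in the two-sided ideal
generated by `τ(1)`. Otherwise `τ(1)` would annihilate a nonzero representation in the block. -/
theorem mem_span_corner [Finite G] [F.Faithful] (hT : ∀ M, T.prop M ↔ M.ρ e = 1) (hidem : e * e = e)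
    (hcomm : ∀ a, Commute e a)
    (hF : ∀ M : T.Cat, ∃ j : (F.obj M).V →ₗ[ℂ] M.obj.V, Function.Injective j ∧
        LinearMap.range j = LinearMap.range (M.obj.ρ (τ 1)) ∧
        ∀ h n, j ((F.obj M).ρ (of ζ h) n) = M.obj.ρ (τ h) (j n)) :
    e ∈ Submodule.span ℂ {x | ∃ a b, x = a * τ 1 * b} := by
  let I := Submodule.span ℂ {x | ∃ a b, x = a * τ 1 * b}
  have hI : ∀ a x, x ∈ I → a * x ∈ I := fun a x hx => by
    refine Submodule.span_induction (p := fun x _ => a * x ∈ I) ?_ (by simp)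
      (fun x y _ _ hx hy => by rw [mul_add]; exact add_mem hx hy)
      (fun d x _ hx => by rw [mul_smul_comm]; exact Submodule.smul_mem _ _ hx) hx
    rintro _ ⟨b, b', rfl⟩
    exact Submodule.subset_span ⟨a * b, b', by simp only [mul_assoc]⟩
  let K : Submodule (TwistedGroupAlgebra ψ) (TwistedGroupAlgebra ψ) :=
    { carrier := {x | e * x ∈ I}
      add_mem' := fun {x y} hx hy => by
        have : e * (x + y) ∈ I := by rw [mul_add]; exact add_mem hx hy
        exact this
      zero_mem' := by
        have : e * 0 ∈ I := by rw [mul_zero]; exact zero_mem _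
        exact this
      smul_mem' := fun a x hx => by
        have : e * (a * x) ∈ I := by rw [← mul_assoc, (hcomm a).eq, mul_assoc]; exact hI _ _ hx
        exact this }
  have hK : ∀ x, x ∈ K ↔ e * x ∈ I := fun x => Iff.rfl
  have : FiniteDimensional ℂ (TwistedGroupAlgebra ψ ⧸ K) :=
    Module.Finite.of_surjective (K.mkQ.restrictScalars ℂ) K.mkQ_surjective
  let M₀ : TwistedRep π ψ := ofModule π (TwistedGroupAlgebra ψ ⧸ K)
  have hM₀ : ∀ a x, M₀.ρ a (K.mkQ x) = K.mkQ (a * x) := fun a x => rfl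
  have hM : T.prop M₀ := by
    rw [hT]
    ext m
    obtain ⟨x, rfl⟩ := K.mkQ_surjective m
    refine (hM₀ e x).trans ((Submodule.Quotient.eq K).2 ?_)
    rw [hK, mul_sub, ← mul_assoc, hidem, sub_self]
    exact zero_mem _
  let M : T.Cat := ⟨M₀, hM⟩
  obtain ⟨j, hj, hjr, -⟩ := hF M
  have h0 : M₀.ρ (τ 1) = 0 := by
    ext m
    obtain ⟨x, rfl⟩ := K.mkQ_surjective m
    refine (hM₀ (τ 1) x).trans ((Submodule.Quotient.mk_eq_zero K).2 ?_)
    rw [hK, ← mul_assoc]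
    exact Submodule.subset_span ⟨e, x, rfl⟩
  have hsub : Subsingleton (F.obj M).V := by
    refine ⟨fun n n' => hj ?_⟩
    have h1 : ∀ n, j n = 0 := fun n => by
      have h2 : j n ∈ LinearMap.range (M.obj.ρ (τ 1)) := hjr ▸ LinearMap.mem_range_self j n
      have h3 : M.obj.ρ (τ 1) = 0 := h0
      rw [h3, LinearMap.range_zero] at h2
      exact h2
    rw [h1, h1]
  have hid : 𝟙 M = ObjectProperty.homMk 0 := by
    refine F.map_injective (hom_ext (LinearMap.ext fun n => Subsingleton.elim _ _))
  have h1 := LinearMap.congr_fun (congrArg (fun k : M ⟶ M => Hom.toLin k.hom) hid) (K.mkQ 1)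
  have h2 : K.mkQ 1 = 0 := h1
  have h3 : (1 : TwistedGroupAlgebra ψ) ∈ K := (Submodule.Quotient.mk_eq_zero K).1 h2
  rwa [hK, mul_one] at h3

/-- If `N` is the image of `τ(1)` in `M`, with `h` acting as `τ h`, then the trace of `τ h` on `M`
is `χ_N(h)`, because `τ h = τ(1) τ h τ(1)` maps `M` to this image. -/
theorem trace_corner (hτ : IsGradedCorner π ζ τ) {M : TwistedRep π ψ} {N : TwistedRep H.subtype ζ}
    {j : N.V →ₗ[ℂ] M.V} (hj : Function.Injective j)
    (hjr : LinearMap.range j = LinearMap.range (M.ρ (τ 1)))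
    (hjc : ∀ h n, j (N.ρ (of ζ h) n) = M.ρ (τ h) (j n)) (h : H) :
    LinearMap.trace ℂ M.V (M.ρ (τ h)) = N.character h := by
  obtain ⟨l, hl⟩ : ∃ l : M.V →ₗ[ℂ] N.V, ∀ m, j (l m) = M.ρ (τ 1) m := by
    let E := LinearEquiv.ofInjective j hj
    refine ⟨E.symm.toLinearMap ∘ₗ LinearMap.codRestrict (LinearMap.range j) (M.ρ (τ 1))
      fun m => hjr ▸ LinearMap.mem_range_self _ m, fun m => ?_⟩
    exact congrArg Subtype.val (E.apply_symm_apply _)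
  have h1 : M.ρ (τ h) = j ∘ₗ (N.ρ (of ζ h) ∘ₗ l) := by
    ext m
    rw [LinearMap.comp_apply, LinearMap.comp_apply, hjc, hl, ← Module.End.mul_apply, ← map_mul,
      hτ.mul_one]
  have h2 : N.ρ (of ζ h) = (N.ρ (of ζ h) ∘ₗ l) ∘ₗ j := by
    ext n
    refine hj ?_
    rw [LinearMap.comp_apply, LinearMap.comp_apply, hjc, hjc, hl, ← Module.End.mul_apply,
      ← map_mul, hτ.mul_one]
  rw [h1, LinearMap.trace_comp_comm', ← h2]
  rfl

end Transfer

/-! ### The trace identity -/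

section TraceIdentity

variable {G W : Type} [Group G] [Fintype G] [Group W] [Fintype W] {π : G →* W} {ψ : TwoCocycle G}
  {H : Subgroup W} {ζ : TwoCocycle H} {τ : H → TwistedGroupAlgebra ψ}
  {T : ModuleSubcategory (FDRep ℂ W) (TwistedRep π ψ)} {e : TwistedGroupAlgebra ψ}
  {F : T.Cat ⥤ TwistedRep H.subtype ζ}

/-- The functor `F`, defined on a block with the idempotent `e`, is given by the graded corner `τ`:
`F M` is the image of the idempotent `τ(1)` in `M`, where `h ∈ H` acts as `τ h`. Moreover `e` lies
in the two-sided ideal generated by `τ(1)`, and the values of `F` are not all zero. -/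
structure IsBlockCorner (F : T.Cat ⥤ TwistedRep H.subtype ζ) (e : TwistedGroupAlgebra ψ)
    (τ : H → TwistedGroupAlgebra ψ) : Prop extends IsGradedCorner π ζ τ where
  ρ_eq_one : ∀ M, T.prop M → M.ρ e = 1
  mul_eq : e * τ 1 = τ 1
  mem_span : e ∈ Submodule.span ℂ {x | ∃ a b, x = a * τ 1 * b}
  exists_map : ∀ M : T.Cat, ∃ j : (F.obj M).V →ₗ[ℂ] M.obj.V, Function.Injective j ∧
    LinearMap.range j = LinearMap.range (M.obj.ρ (τ 1)) ∧
    ∀ h n, j ((F.obj M).ρ (of ζ h) n) = M.obj.ρ (τ h) (j n)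
  exists_character_one_ne_zero : ∃ M, (F.obj M).character 1 ≠ 0

open Classical in
/-- The part of `∑ f(g) g` above a conjugacy class of `W` is central. -/
theorem commute_sum_fiberSum (hψ : ψ.IsClassFunction) {f : G → ℂ}
    (hf : ∀ g k, f (k * g * k⁻¹) = f g) (hreg : ∀ g, f g ≠ 0 → ψ.IsRegular g) (r : W)
    (a : TwistedGroupAlgebra ψ) :
    Commute (∑ w, if IsConj r w then fiberSum π ψ f w else 0) a := by
  refine commute_of_forall_of (fun k => Commute.symm ?_) a
  rw [commute_iff_eq, Finset.mul_sum, Finset.sum_mul]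
  refine Fintype.sum_equiv (MulAut.conj (π k)).toEquiv _ _ fun w => ?_
  have h1 : (MulAut.conj (π k)).toEquiv w = π k * w * (π k)⁻¹ := rfl
  have h2 : IsConj w (π k * w * (π k)⁻¹) := isConj_iff.2 ⟨π k, rfl⟩
  rw [h1]
  by_cases h : IsConj r w
  · rw [if_pos h, if_pos (h.trans h2), mul_fiberSum hψ hf hreg (of_mem_degPart rfl)]
  · rw [if_neg h, if_neg fun h' => h (h'.trans h2.symm), mul_zero, zero_mul]

open Classical in
/-- For class functions `f` and `β` such that `∑ f(g) g` acts on the corner as `∑ β(h) τ(h)`, the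
sum of `f χ_M` over the elements of `G` above a conjugacy class of `W` is proportional to the sum of
`β χ_{F(M)}` over the elements of `H` in this class. To see this, let `z` be the part of `∑ f(g) g`
above the class, a central element, and take the trace on `M` of `z` times the sum of all conjugates
of `τ(1)`: this sum acts on `M` by a scalar that does not depend on `M`, and each conjugate
contributes the trace of `z τ(1)`. -/
theorem exists_trace_identity [Fintype H] (hτ : IsBlockCorner F e τ) (hψ : ψ.IsClassFunction) :
    ∃ c : ℂ, c ≠ 0 ∧ (∀ M : T.Cat, M.obj.character 1 = c * (F.obj M).character 1) ∧
    ∀ (f : G → ℂ) (β : H → ℂ), (∀ g k, f (k * g * k⁻¹) = f g) →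
      (∀ g, f g ≠ 0 → ψ.IsRegular g) → (∀ h : H, fiberSum π ψ f h * τ 1 = β h • τ h) →
      (∀ w ∉ H, fiberSum π ψ f w * τ 1 = 0) → ∀ (M : T.Cat) (r : W),
        ∑ g, (if IsConj r (π g) then f g * M.obj.character g else 0) =
          c * ∑ h : H, if IsConj r (h : W) then β h * (F.obj M).character h else 0 := by
  have hchar : ∀ (M : T.Cat) (h : H),
      LinearMap.trace ℂ _ (M.obj.ρ (τ h)) = (F.obj M).character h := fun M h => by
    obtain ⟨j, hj, hjr, hjc⟩ := hτ.exists_map M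
    exact trace_corner hτ.toIsGradedCorner hj hjr hjc h
  have hG : (Fintype.card G : ℂ) ≠ 0 := Nat.cast_ne_zero.2 Fintype.card_ne_zero
  obtain ⟨c, hc⟩ := hτ.toIsGradedCorner.exists_smul_of_central hτ.mem_span (commute_conjSum (τ 1))
    (conjSum_mem_degPart (hτ.mem_degPart 1))
  have hρ : ∀ M : T.Cat, M.obj.ρ (conjSum (τ 1)) = c • 1 := fun M => by
    rw [← mul_one (M.obj.ρ _), ← hτ.ρ_eq_one M.obj M.property, ← map_mul, hc, map_smul]
  have hmain : ∀ (z : TwistedGroupAlgebra ψ), (∀ a, Commute z a) → ∀ M : T.Cat,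
      c * LinearMap.trace ℂ _ (M.obj.ρ z) =
        Fintype.card G * LinearMap.trace ℂ _ (M.obj.ρ (z * τ 1)) := fun z hz M => by
    rw [← trace_mul_conjSum M.obj.ρ hz, map_mul, hρ, mul_smul_comm, mul_one, map_smul, smul_eq_mul]
  have hmain1 : ∀ M : T.Cat, c * M.obj.character 1 = Fintype.card G * (F.obj M).character 1 := by
    intro M
    have h1 := hmain 1 (fun a => Commute.one_left a) M
    rwa [one_mul, hchar] at h1
  obtain ⟨M₀, hM₀⟩ := hτ.exists_character_one_ne_zero
  have hc0 : c ≠ 0 := by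
    rintro rfl
    have h1 := hmain1 M₀
    rw [zero_mul] at h1
    exact mul_ne_zero hG hM₀ h1.symm
  refine ⟨c⁻¹ * Fintype.card G, mul_ne_zero (inv_ne_zero hc0) hG, fun M => by
    rw [mul_assoc, eq_inv_mul_iff_mul_eq₀ hc0, hmain1], fun f β hf hreg hβ hβ0 M r => ?_⟩
  have h1 := hmain _ (commute_sum_fiberSum (π := π) hψ hf hreg r) M
  have h2 : (∑ w, if IsConj r w then fiberSum π ψ f w else 0) * τ 1 =
      ∑ h : H, if IsConj r (h : W) then β h • τ h else 0 := by
    rw [Finset.sum_mul]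
    refine (Fintype.sum_of_injective (Subtype.val : H → W) Subtype.val_injective _ _ ?_ ?_).symm
    · intro w hw
      rw [ite_mul, hβ0 w fun h => hw ⟨⟨w, h⟩, rfl⟩, zero_mul, ite_self]
    · intro h
      rw [ite_mul, hβ, zero_mul]
  rw [h2, sum_fiberSum_isConj, map_sum, map_sum, map_sum, map_sum] at h1
  rw [mul_assoc, eq_inv_mul_iff_mul_eq₀ hc0]
  refine Eq.trans ?_ (h1.trans ?_)
  · congr 1
    refine Finset.sum_congr rfl fun g _ => ?_
    split_ifs
    · rw [map_smul, map_smul, smul_eq_mul]; rfl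
    · rw [map_zero, map_zero]
  · congr 1
    refine Finset.sum_congr rfl fun h _ => ?_
    split_ifs
    · rw [map_smul, map_smul, smul_eq_mul, hchar]
    · rw [map_zero, map_zero]

end TraceIdentity

/-! ### Morita equivalence of an algebra with a full corner -/

section Morita

variable {k A B : Type} [CommRing k] [Ring A] [Algebra k A] [Ring B] [Algebra k B]

/-- For a non-unital homomorphism `i : B → A`, the part `i(1) N` of an `A`-module `N`, on which `B`
acts through `i`. -/
def cornerPart (i : B →ₙₐ[k] A) (N : Type) [AddCommGroup N] [Module A N] : AddSubgroup N where
  carrier := {n | i 1 • n = n}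
  add_mem' {m n} hm hn := by
    change i 1 • (m + n) = m + n
    rw [smul_add, hm, hn]
  zero_mem' := smul_zero _
  neg_mem' {n} hn := by
    change i 1 • (-n) = -n
    rw [smul_neg, hn]

namespace cornerPart

variable (i : B →ₙₐ[k] A) {N N' : Type} [AddCommGroup N] [Module A N] [AddCommGroup N']
  [Module A N']

theorem map_one_mul (b : B) : i 1 * i b = i b := by rw [← map_mul, one_mul]

theorem map_mul_one (b : B) : i b * i 1 = i b := by rw [← map_mul, mul_one]

instance : Module B (cornerPart i N) where
  smul b n := ⟨i b • n.1, by
    change i 1 • i b • n.1 = i b • n.1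
    rw [smul_smul, map_one_mul]⟩
  one_smul n := Subtype.ext n.2
  mul_smul a b n := Subtype.ext (by
    change i (a * b) • n.1 = i a • i b • n.1
    rw [map_mul, mul_smul])
  smul_zero b := Subtype.ext (smul_zero (i b))
  smul_add b m n := Subtype.ext (smul_add (i b) m.1 n.1)
  add_smul a b n := Subtype.ext (by
    change i (a + b) • n.1 = i a • n.1 + i b • n.1
    rw [map_add, add_smul])
  zero_smul n := Subtype.ext (by
    change i 0 • n.1 = 0
    rw [map_zero, zero_smul])

variable {i}

theorem coe_smul (b : B) (n : cornerPart i N) : ((b • n : cornerPart i N) : N) = i b • (n : N) :=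
  rfl

theorem one_smul_coe (n : cornerPart i N) : i 1 • (n : N) = n := n.2

/-- The map `n ↦ i(1) a n` from `N` to its corner part. -/
def proj (i : B →ₙₐ[k] A) (a : A) : N →+ cornerPart i N where
  toFun n := ⟨i 1 • a • n, by
    change i 1 • i 1 • a • n = i 1 • a • n
    rw [smul_smul, map_one_mul]⟩
  map_zero' := Subtype.ext (by simp)
  map_add' m n := Subtype.ext (by simp)

theorem coe_proj (a : A) (n : N) : (proj i a n : N) = i 1 • a • n := rfl

/-- The restriction of a homomorphism to the corner parts. -/
def map (f : N →ₗ[A] N') : cornerPart i N →ₗ[B] cornerPart i N' where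
  toFun n := ⟨f n, by
    change i 1 • f n = f n
    rw [← map_smul, one_smul_coe]⟩
  map_add' m n := Subtype.ext (map_add f m.1 n.1)
  map_smul' b n := Subtype.ext (map_smul f (i b) n.1)

end cornerPart

open cornerPart

open scoped ModuleCat.Algebra

/-- The functor `N ↦ i(1) N`. -/
def cornerFunctor (i : B →ₙₐ[k] A) : ModuleCat.{0} A ⥤ ModuleCat.{0} B where
  obj N := ModuleCat.of B (cornerPart i N)
  map f := ModuleCat.ofHom (cornerPart.map f.hom)

instance (i : B →ₙₐ[k] A) : (cornerFunctor i).Additive where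
  map_add := rfl

instance (i : B →ₙₐ[k] A) : (cornerFunctor i).Linear k where
  map_smul {N N'} f r := by
    refine ModuleCat.hom_ext (LinearMap.ext fun (n : cornerPart i N) => Subtype.ext ?_)
    change algebraMap k A r • f.hom (n : N) = i (algebraMap k B r) • f.hom (n : N)
    have hn : f.hom (n : N) = i 1 • f.hom (n : N) := by rw [← map_smul, one_smul_coe]
    rw [Algebra.algebraMap_eq_smul_one r, Algebra.algebraMap_eq_smul_one r, map_smul]
    conv_lhs => rw [hn]
    rw [smul_smul, smul_mul_assoc, one_mul]

variable {i : B →ₙₐ[k] A} {D : A → B}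

theorem cornerFunctor_faithful {m : ℕ} {p q : Fin m → A} (hpq : ∑ j, p j * i 1 * q j = 1) :
    (cornerFunctor i).Faithful where
  map_injective {N N'} f f' h := by
    refine ModuleCat.hom_ext (LinearMap.ext fun n => ?_)
    have h1 : ∀ a : A, f.hom (i 1 • a • n) = f'.hom (i 1 • a • n) := fun a =>
      congrArg Subtype.val (LinearMap.congr_fun (congrArg ModuleCat.Hom.hom h) (proj i a n))
    have h2 : n = ∑ j, p j • i 1 • q j • n := by
      conv_lhs => rw [← one_smul A n, ← hpq, Finset.sum_smul]
      simp only [mul_smul]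
    rw [h2, map_sum, map_sum]
    exact Finset.sum_congr rfl fun j _ => (f.hom.map_smul _ _).trans
      ((congrArg _ (h1 _)).trans (f'.hom.map_smul _ _).symm)

/-- The functor `N ↦ i(1) N` is full: a `B`-linear map `γ` of corner parts is extended by the
formula `n ↦ ∑ p_j γ(i(1) q_j n)`, where `∑ p_j i(1) q_j = 1`. -/
theorem cornerFunctor_full (hiD : ∀ a, i (D a) = i 1 * a * i 1) {m : ℕ} {p q : Fin m → A}
    (hpq : ∑ j, p j * i 1 * q j = 1) : (cornerFunctor i).Full where
  map_surjective {N N'} g := by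
    let γ : cornerPart i N →ₗ[B] cornerPart i N' := g.hom
    have h1 : ∀ (a : A) (n : cornerPart i N),
        (γ (proj i a n) : N') = i 1 • a • (γ n : N') := fun a n => by
      have h : proj i a (n : N) = D a • n := Subtype.ext (by
        rw [coe_proj, coe_smul, hiD, mul_smul, mul_smul, one_smul_coe])
      rw [h, map_smul, coe_smul, hiD, mul_smul, mul_smul, one_smul_coe]
    have h2 : ∀ n : N, n = ∑ j, p j • (proj i (q j) n : N) := fun n => by
      conv_lhs => rw [← one_smul A n, ← hpq, Finset.sum_smul]
      simp only [mul_smul, coe_proj]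
    have h3 : ∀ (a : A) (n : N), (γ (proj i a n) : N') =
        ∑ l, i 1 • a • p l • (γ (proj i (q l) n) : N') := fun a n => by
      have h : proj i a n = ∑ l, proj i (a * p l) (proj i (q l) n : N) := by
        conv_lhs => rw [h2 n, map_sum]
        exact Finset.sum_congr rfl fun l _ => Subtype.ext (by simp only [coe_proj, mul_smul])
      rw [h, map_sum, AddSubgroup.val_finsetSum]
      exact Finset.sum_congr rfl fun l _ => by rw [h1, mul_smul]
    let f : N →ₗ[A] N' :=
      { toFun := fun n => ∑ j, p j • (γ (proj i (q j) n) : N')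
        map_add' := fun n n' => by
          simp only [map_add, AddSubgroup.coe_add, smul_add, Finset.sum_add_distrib]
        map_smul' := fun a n => by
          have h4 : ∀ j, (γ (proj i (q j) (a • n)) : N') = ∑ l, i 1 • q j • a • p l •
              (γ (proj i (q l) n) : N') := fun j => by
            have h : proj i (q j) (a • n) = proj i (q j * a) n :=
              Subtype.ext (by rw [coe_proj, coe_proj, mul_smul])
            rw [h, h3]
            simp only [mul_smul]
          simp only [h4, Finset.smul_sum, RingHom.id_apply]
          rw [Finset.sum_comm]
          refine Finset.sum_congr rfl fun l _ => ?_
          conv_rhs => rw [← one_smul A (a • p l • _), ← hpq, Finset.sum_smul]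
          simp only [mul_smul] }
    refine ⟨ModuleCat.ofHom f, ModuleCat.hom_ext
      (LinearMap.ext fun (n : cornerPart i N) => Subtype.ext ?_)⟩
    change ∑ j, p j • (γ (proj i (q j) (n : N)) : N') = (γ n : N')
    conv_rhs => rw [← one_smul A (γ n : N'), ← hpq, Finset.sum_smul]
    exact Finset.sum_congr rfl fun j _ => by rw [h1, mul_smul, mul_smul]

/-- The `A`-module of additive maps `A → N` that are linear over `B`; it is the module coinduced
from the `B`-module `N`. -/
def coinducedPart (i : B →ₙₐ[k] A) (N : Type) [AddCommGroup N] [Module B N] :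
    AddSubgroup (A →+ N) where
  carrier := {f | ∀ b x, f (i b * x) = b • f x}
  add_mem' {f g} hf hg b x := by
    rw [AddMonoidHom.add_apply, AddMonoidHom.add_apply, hf, hg, smul_add]
  zero_mem' b x := (smul_zero b).symm
  neg_mem' {f} hf b x := by rw [AddMonoidHom.neg_apply, AddMonoidHom.neg_apply, hf, smul_neg]

instance (i : B →ₙₐ[k] A) (N : Type) [AddCommGroup N] [Module B N] :
    Module A (coinducedPart i N) where
  smul a f := ⟨f.1.comp (AddMonoidHom.mulRight a), fun b x => by
    change f.1 (i b * x * a) = b • f.1 (x * a)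
    rw [mul_assoc, f.2]⟩
  one_smul f := Subtype.ext (AddMonoidHom.ext fun x => congrArg f.1 (mul_one x))
  mul_smul a b f := Subtype.ext (AddMonoidHom.ext fun x => congrArg f.1 (mul_assoc x a b).symm)
  smul_zero a := rfl
  smul_add a f g := rfl
  add_smul a b f := Subtype.ext (AddMonoidHom.ext fun x =>
    (congrArg f.1 (mul_add x a b)).trans (map_add f.1 _ _))
  zero_smul f := Subtype.ext (AddMonoidHom.ext fun x =>
    (congrArg f.1 (mul_zero x)).trans (map_zero f.1))

/-- The functor `N ↦ i(1) N` is essentially surjective: a `B`-module is the corner part of the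
module coinduced from it. -/
theorem cornerFunctor_essSurj (hDadd : ∀ a b, D (a + b) = D a + D b) (hDi : ∀ b, D (i b) = b)
    (hiD : ∀ a, i (D a) = i 1 * a * i 1) : (cornerFunctor i).EssSurj where
  mem_essImage N := by
    have hinj : Function.Injective i := Function.LeftInverse.injective hDi
    have hD1 : D 1 = 1 := hinj (by rw [hiD, mul_one, map_one_mul])
    have hDl : ∀ b x, D (i b * x) = b * D x := fun b x => hinj (by
      rw [hiD, map_mul, hiD, ← mul_assoc, map_one_mul, ← mul_assoc, ← mul_assoc, map_mul_one])
    have hDr : ∀ x, D (x * i 1) = D x := fun x => hinj (by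
      rw [hiD, hiD, mul_assoc, mul_assoc, map_one_mul, mul_assoc])
    -- `D` is an inverse to evaluation at `1`, since `f(x) = f(i(1) x i(1)) = D(x) f(1)`.
    let E : cornerPart i (coinducedPart i N) ≃ₗ[B] N :=
      { toFun := fun f => f.1.1 1
        map_add' := fun f g => rfl
        map_smul' := fun b f => by
          change f.1.1 (1 * i b) = b • f.1.1 1
          rw [one_mul, ← f.1.2, mul_one]
        invFun := fun n => ⟨⟨AddMonoidHom.mk' (fun x => D x • n) fun x y => by
            rw [hDadd, add_smul], fun b x => by
              change D (i b * x) • n = b • D x • n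
              rw [hDl, mul_smul]⟩,
          Subtype.ext (AddMonoidHom.ext fun x => by
            change D (x * i 1) • n = D x • n
            rw [hDr])⟩
        left_inv := fun f => Subtype.ext (Subtype.ext (AddMonoidHom.ext fun x => by
          change D x • f.1.1 1 = f.1.1 x
          have h1 : ∀ x, f.1.1 (x * i 1) = f.1.1 x := fun x =>
            DFunLike.congr_fun (congrArg Subtype.val f.2) x
          rw [← f.1.2, hiD, mul_one, h1, f.1.2, one_smul]))
        right_inv := fun n => by
          change D 1 • n = n
          rw [hD1, one_smul] }
    exact ⟨ModuleCat.of A (coinducedPart i N), ⟨E.toModuleIso⟩⟩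

/-- If `B` is identified with the corner `i(1) A i(1)` of `A`, and the idempotent `i(1)` generates
`A` as a two-sided ideal, then `A` and `B` are Morita equivalent. -/
theorem isMoritaEquivalent_of_corner (hDadd : ∀ a b, D (a + b) = D a + D b)
    (hDi : ∀ b, D (i b) = b) (hiD : ∀ a, i (D a) = i 1 * a * i 1)
    (hfull : (1 : A) ∈ Submodule.span k {x | ∃ a b, x = a * i 1 * b}) :
    IsMoritaEquivalent k A B := by
  obtain ⟨m, p, q, hpq⟩ : ∃ (m : ℕ) (p q : Fin m → A), ∑ j, p j * i 1 * q j = 1 := by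
    obtain ⟨m, c, g, hg⟩ := Submodule.mem_span_set'.1 hfull
    choose p q h using fun j => (g j).2
    refine ⟨m, fun j => c j • p j, q, ?_⟩
    rw [← hg]
    exact Finset.sum_congr rfl fun j _ => by rw [h, smul_mul_assoc, smul_mul_assoc]
  have := cornerFunctor_faithful hpq
  have := cornerFunctor_full hiD hpq
  have := cornerFunctor_essSurj hDadd hDi hiD
  have : (cornerFunctor i).IsEquivalence := {}
  exact ⟨⟨(cornerFunctor i).asEquivalence, inferInstanceAs ((cornerFunctor i).Linear k)⟩⟩

end Morita

/-! ### Crossed products and quotients by relations -/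

namespace CrossedProduct

variable {G : Type} [Group G] {B : Type} [Ring B] [Algebra ℂ B]
  {act : G →* (B ≃ₐ[ℂ] B)} {ψ : TwoCocycle G}

/-- The inclusion of `B` in the crossed product. -/
noncomputable def base (act : G →* (B ≃ₐ[ℂ] B)) (ψ : TwoCocycle G) : B →ₐ[ℂ] CrossedProduct act ψ :=
  AlgHom.ofLinearMap
    { toFun := single act ψ 1
      map_add' := single_add 1
      map_smul' := fun c x => (smul_single c 1 x).symm } rfl fun x y => by
    simp [single_mul_single, ψ.normalized]

/-- The inclusion of the twisted group algebra in the crossed product. -/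
noncomputable def group (act : G →* (B ≃ₐ[ℂ] B)) (ψ : TwoCocycle G) :
    TwistedGroupAlgebra ψ →ₐ[ℂ] CrossedProduct act ψ :=
  TwistedGroupAlgebra.lift (fun g => single _ _ g 1) rfl
    fun g h => by simp [single_mul_single, smul_single]

theorem base_apply (x : B) : base act ψ x = single act ψ 1 x := rfl

theorem group_of (g : G) : group act ψ (of ψ g) = single act ψ g 1 :=
  TwistedGroupAlgebra.lift_of _ _ _ g

theorem base_mul_group_of (g : G) (x : B) :
    base act ψ x * group act ψ (of ψ g) = single act ψ g x := by
  rw [base_apply, group_of, single_mul_single, ψ.one_left]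
  simp

theorem group_of_mul_base (g : G) (x : B) :
    group act ψ (of ψ g) * base act ψ x = base act ψ (act g x) * group act ψ (of ψ g) := by
  rw [base_mul_group_of, base_apply, group_of, single_mul_single, ψ.one_right]
  simp

theorem induction_base_mul_group {p : CrossedProduct act ψ → Prop} (a : CrossedProduct act ψ)
    (h0 : p 0) (hadd : ∀ a b, p a → p b → p (a + b))
    (hs : ∀ x g, p (base act ψ x * group act ψ (of ψ g))) : p a :=
  CrossedProduct.induction a h0 hadd fun g x => base_mul_group_of (act := act) (ψ := ψ) g x ▸ hs x g

/-- The linear map `x y ↦ a(x) p(y)` for `x ∈ B` and `y` in the twisted group algebra. -/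
noncomputable def linLift {A : Type} [Ring A] [Algebra ℂ A] (act : G →* (B ≃ₐ[ℂ] B)) (a : B →ₐ[ℂ] A)
    (p : TwistedGroupAlgebra ψ →ₗ[ℂ] A) : CrossedProduct act ψ →ₗ[ℂ] A :=
  Finsupp.lsum ℂ fun g => LinearMap.mulRight ℂ (p (of ψ g)) ∘ₗ a.toLinearMap

theorem linLift_base_mul_group {A : Type} [Ring A] [Algebra ℂ A] (a : B →ₐ[ℂ] A)
    (p : TwistedGroupAlgebra ψ →ₗ[ℂ] A) (x : B) (y : TwistedGroupAlgebra ψ) :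
    linLift act a p (base act ψ x * group act ψ y) = a x * p y := by
  induction y using TwistedGroupAlgebra.induction with
  | h0 => simp only [map_zero, mul_zero]
  | hadd y z hy hz => simp only [map_add, mul_add, hy, hz]
  | hs c g =>
    simp only [map_smul, mul_smul_comm, base_mul_group_of]
    congr 1
    exact Finsupp.sum_single_index (by simp)

end CrossedProduct

/-- A linear map on an algebra that identifies the two sides of all relations, multiplied by
arbitrary elements from both sides, descends to the quotient. -/
theorem exists_linearMap_ringQuot {R A V : Type} [CommRing R] [Ring A] [Algebra R A]
    [AddCommGroup V] [Module R V] {r : A → A → Prop} (f : A →ₗ[R] V)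
    (hf : ∀ a b, r a b → ∀ x y, f (x * a * y) = f (x * b * y)) :
    ∃ f' : RingQuot r →ₗ[R] V, ∀ x, f' (RingQuot.mkAlgHom R r x) = f x := by
  let s : RingCon A :=
    { r := fun a b => ∀ x y, f (x * a * y) = f (x * b * y)
      iseqv := ⟨fun _ _ _ => rfl, fun h x y => (h x y).symm, fun h h' x y => (h x y).trans (h' x y)⟩
      mul' := fun {a b c d} h h' x y => by
        have h1 := h x (c * y)
        have h2 := h' (x * b) y
        simp only [mul_assoc] at h1 h2 ⊢
        exact h1.trans h2
      add' := fun {a b c d} h h' x y => by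
        simp only [mul_add, add_mul, map_add, h x y, h' x y] }
  have hs : ∀ a b, s a b ↔ ∀ x y, f (x * a * y) = f (x * b * y) := fun a b => Iff.rfl
  let q : RingQuot r →+* s.Quotient := RingQuot.lift ⟨s.mk', fun a b h => s.eq.2 (hf a b h)⟩
  have hq : ∀ x, q (RingQuot.mkAlgHom R r x) = s.mk' x := fun x => by
    refine Eq.trans (congrArg q ?_) (RingQuot.lift_mkRingHom_apply s.mk'
      (fun a b h => s.eq.2 (hf a b h)) x)
    exact RingHom.congr_fun (RingQuot.mkAlgHom_coe R r) x
  have hker : LinearMap.ker (RingQuot.mkAlgHom R r).toLinearMap ≤ LinearMap.ker f := fun x hx => by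
    have h1 : RingQuot.mkAlgHom R r x = 0 := hx
    have h2 : s.mk' x = s.mk' 0 := by rw [← hq, h1, map_zero, map_zero]
    have h3 := (hs _ _).1 (s.eq.1 h2) 1 1
    simpa using h3
  let E := LinearMap.quotKerEquivOfSurjective (RingQuot.mkAlgHom R r).toLinearMap
    (RingQuot.mkAlgHom_surjective R r)
  refine ⟨Submodule.liftQ _ f hker ∘ₗ E.symm.toLinearMap, fun x => ?_⟩
  have h1 : E.symm (RingQuot.mkAlgHom R r x) = Submodule.Quotient.mk x :=
    E.symm_apply_eq.2 rfl
  exact (congrArg (Submodule.liftQ _ f hker) h1).trans (Submodule.liftQ_apply _ _ _)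

/-! ### The forms of reflections -/

section Form

variable {U : Type} [AddCommGroup U] [Module ℂ U] {ω : LinearMap.BilinForm ℂ U}

theorem idSub_conj_apply (s v : U ≃ₗ[ℂ] U) (z : U) :
    idSub (v * s * v⁻¹) (v z) = v (idSub s z) := by
  have h : (v * s * v⁻¹) (v z) = v (s z) := by
    rw [LinearEquiv.mul_apply, LinearEquiv.mul_apply]
    exact congrArg (fun t => v (s t)) (v.symm_apply_apply z)
  simp only [idSub, LinearMap.sub_apply, LinearMap.id_apply, LinearEquiv.coe_coe, map_sub]
  rw [h]

theorem finrank_range_idSub_conj (s v : U ≃ₗ[ℂ] U) :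
    Module.finrank ℂ (LinearMap.range (idSub (v * s * v⁻¹))) =
      Module.finrank ℂ (LinearMap.range (idSub s)) := by
  have h : idSub (v * s * v⁻¹) ∘ₗ (v : U →ₗ[ℂ] U) = (v : U →ₗ[ℂ] U) ∘ₗ idSub s :=
    LinearMap.ext fun z => idSub_conj_apply s v z
  have h1 := congrArg LinearMap.range h
  rw [LinearMap.range_comp_of_range_eq_top _ v.range, LinearMap.range_comp] at h1
  rw [h1]
  exact LinearEquiv.finrank_map_eq v _

theorem reflForm_conj {s v : U ≃ₗ[ℂ] U} (hv : ∀ x y, ω (v x) (v y) = ω x y) (hs : IsOfFinOrder s)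
    (x y : U) : reflForm ω (v * s * v⁻¹) (v x) (v y) = reflForm ω s x y := by
  have hs' : IsOfFinOrder (v * s * v⁻¹) := by
    obtain ⟨n, hn, h⟩ := isOfFinOrder_iff_pow_eq_one.1 hs
    exact isOfFinOrder_iff_pow_eq_one.2 ⟨n, hn, by rw [conj_pow, h, mul_one, mul_inv_cancel]⟩
  have h1 := isCompl_idSub s hs
  have h2 := isCompl_idSub _ hs'
  have h3 := idSub_conj_apply s v
  have h5 : ∀ z, Submodule.projection _ _ h2 (v z) = v (Submodule.projection _ _ h1 z) :=
    fun z => by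
    have h4 : v (Submodule.projection _ _ h1 z) ∈ LinearMap.range (idSub (v * s * v⁻¹)) := by
      obtain ⟨t, ht⟩ := Submodule.projection_apply_mem h1 z
      exact ⟨v t, by rw [h3, ht]⟩
    have h5 : v (Submodule.projection _ _ h1.symm z) ∈ LinearMap.ker (idSub (v * s * v⁻¹)) := by
      rw [LinearMap.mem_ker, h3, LinearMap.mem_ker.1 (Submodule.projection_apply_mem h1.symm z),
        map_zero]
    conv_lhs => rw [← Submodule.projection_add_projection_eq_self h1 z, map_add, map_add]
    rw [Submodule.projection_apply_of_mem_left h2 h4,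
      (Submodule.projection_apply_eq_zero_iff h2).2 h5, add_zero]
  rw [reflForm, reflForm, dif_pos h1, dif_pos h2, h5, h5, hv]

end Form

/-! ### Corners of twisted symplectic reflection algebras -/

section Morita

variable {U : Type} [AddCommGroup U] [Module ℂ U] {ω : LinearMap.BilinForm ℂ U}
  {G W : Type} [Group G] [Group W] {π : G →* W} {ψ : TwoCocycle G}

/-- The inclusion of the tensor algebra in the twisted symplectic reflection algebra. -/
noncomputable def SRA.ofTensor (φ : G →* Sp ω) (ψ : TwoCocycle G) (c : G → ℂ) :
    TensorAlgebra ℂ U →ₐ[ℂ] SRA φ ψ c := (SRA.mk φ ψ c).comp (CrossedProduct.base _ _)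

theorem SRA.mk_surjective (φ : G →* Sp ω) (ψ : TwoCocycle G) (c : G → ℂ) :
    Function.Surjective (SRA.mk φ ψ c) := RingQuot.mkAlgHom_surjective ℂ (SRARel φ ψ c)

theorem tensorAction_ι (φ : G →* Sp ω) (g : G) (x : U) :
    tensorAction φ g (TensorAlgebra.ι ℂ x) = TensorAlgebra.ι ℂ ((φ g : U ≃ₗ[ℂ] U) x) :=
  TensorAlgebra.lift_ι_apply (R := ℂ) _ x

theorem group_mul_base_of_mem_degPart (φ : W →* Sp ω) {a : TwistedGroupAlgebra ψ} {w : W}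
    (ha : a ∈ degPart π ψ w) (t : TensorAlgebra ℂ U) :
    CrossedProduct.group (tensorAction (φ.comp π)) ψ a * CrossedProduct.base _ _ t =
      CrossedProduct.base _ _ (tensorAction φ w t) * CrossedProduct.group _ _ a := by
  refine Submodule.span_induction (p := fun a _ =>
    CrossedProduct.group (tensorAction (φ.comp π)) ψ a * CrossedProduct.base _ _ t =
      CrossedProduct.base _ _ (tensorAction φ w t) * CrossedProduct.group _ _ a) ?_
    (by simp only [map_zero, zero_mul, mul_zero])
    (fun x y _ _ hx hy => by simp only [map_add, add_mul, mul_add, hx, hy])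
    (fun c x _ hx => by simp only [map_smul, smul_mul_assoc, mul_smul_comm, hx]) ha
  rintro _ ⟨k, rfl, rfl⟩
  exact CrossedProduct.group_of_mul_base k t

/-- An element of the twisted group algebra that is central there and has degree `1` for the grading
by the image of `G` in `Sp(U)` is central in the twisted symplectic reflection algebra. -/
theorem SRA.commute_ofGroupAlgebra (φ : W →* Sp ω) (c : G → ℂ) {e : TwistedGroupAlgebra ψ}
    (he : e ∈ degPart π ψ 1) (hcomm : ∀ a, Commute e a) (a : SRA (φ.comp π) ψ c) :
    Commute (SRA.ofGroupAlgebra (φ.comp π) ψ c e) a := by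
  obtain ⟨x, rfl⟩ := SRA.mk_surjective _ _ _ a
  have h : Commute (CrossedProduct.group (tensorAction (φ.comp π)) ψ e) x := by
    refine CrossedProduct.induction_base_mul_group
      (p := fun x => Commute (CrossedProduct.group (tensorAction (φ.comp π)) ψ e) x) x
      (Commute.zero_right _) (fun _ _ ha hb => ha.add_right hb) fun t g => ?_
    refine Commute.mul_right ?_ ((hcomm _).map _)
    have h1 := group_mul_base_of_mem_degPart φ he t
    rwa [map_one, AlgEquiv.one_apply] at h1
  exact h.map (SRA.mk (φ.comp π) ψ c)

theorem sum_finsum_regularReflections [Fintype G] (φ : G →* Sp ω) {c f : G → ℂ}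
    (hf : ∀ g ∈ regularReflections φ ψ, f g = c g) (hf0 : ∀ g ∉ regularReflections φ ψ, f g = 0)
    (x y : U) :
    (∑ᶠ s ∈ regularReflections φ ψ,
        (c s * reflForm ω (φ s) x y) • CrossedProduct.single (tensorAction φ) ψ s 1) =
      CrossedProduct.group _ ψ (∑ g, (f g * reflForm ω (φ g) x y) • of ψ g) := by
  classical
  rw [finsum_eq_sum_of_fintype, map_sum]
  refine Finset.sum_congr rfl fun g _ => ?_
  rw [map_smul, CrossedProduct.group_of, finsum_eq_if]
  split_ifs with h
  · rw [hf g h]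
  · rw [hf0 g h, zero_mul, zero_smul]

/-- The element `∑ f(g) ω_g(x, y) g`, sorted according to the images of the `g` in `W`. -/
noncomputable def reflSum [Fintype G] [Fintype W] (φ : W →* Sp ω) (π : G →* W) (ψ : TwoCocycle G)
    (f : G → ℂ) (x y : U) : TwistedGroupAlgebra ψ :=
  ∑ w, reflForm ω (φ w) x y • fiberSum π ψ f w

variable {H : Subgroup W} {ζ : TwoCocycle H} {τ : H → TwistedGroupAlgebra ψ}

theorem IsGradedCorner.exists_cornerProj (hτ : IsGradedCorner π ζ τ) :
    ∃ P : TwistedGroupAlgebra ψ →ₗ[ℂ] TwistedGroupAlgebra ζ,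
      ∀ x, hτ.embed (P x) = τ 1 * x * τ 1 := by
  let E := LinearEquiv.ofInjective hτ.embed hτ.embed_injective
  let p : TwistedGroupAlgebra ψ →ₗ[ℂ] TwistedGroupAlgebra ψ :=
    LinearMap.mulRight ℂ (τ 1) ∘ₗ LinearMap.mulLeft ℂ (τ 1)
  refine ⟨E.symm.toLinearMap ∘ₗ LinearMap.codRestrict (LinearMap.range hτ.embed) p
    fun x => hτ.exists_embed_eq x, fun x => ?_⟩
  exact congrArg Subtype.val (E.apply_symm_apply _)

variable [Fintype G] [Fintype W]

theorem reflSum_eq (φ : W →* Sp ω) (f : G → ℂ) (x y : U) :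
    reflSum φ π ψ f x y = ∑ g, (f g * reflForm ω ((φ.comp π) g) x y) • of ψ g := by
  classical
  have h1 : ∀ w, reflForm ω (φ w) x y • fiberSum π ψ f w =
      ∑ g, if π g = w then (f g * reflForm ω ((φ.comp π) g) x y) • of ψ g else 0 := fun w => by
    rw [fiberSum, Finset.smul_sum]
    refine Finset.sum_congr rfl fun g _ => ?_
    split_ifs with h
    · rw [smul_smul, mul_comm, MonoidHom.comp_apply, h]
    · rw [smul_zero]
  simp only [reflSum, h1]
  rw [Finset.sum_comm]
  exact Finset.sum_congr rfl fun g _ => by rw [Finset.sum_ite_eq, if_pos (Finset.mem_univ _)]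

theorem mul_reflSum (φ : W →* Sp ω) (hψ : ψ.IsClassFunction) {f : G → ℂ}
    (hf : ∀ g k, f (k * g * k⁻¹) = f g) (hreg : ∀ g, f g ≠ 0 → ψ.IsRegular g)
    {a : TwistedGroupAlgebra ψ} {v : W} (ha : a ∈ degPart π ψ v) (x y : U) :
    a * reflSum φ π ψ f x y =
      reflSum φ π ψ f ((φ v : U ≃ₗ[ℂ] U) x) ((φ v : U ≃ₗ[ℂ] U) y) * a := by
  rw [reflSum, reflSum, Finset.mul_sum, Finset.sum_mul]
  refine Fintype.sum_equiv (MulAut.conj v).toEquiv _ _ fun w => ?_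
  have h1 : (MulAut.conj v).toEquiv w = v * w * v⁻¹ := rfl
  have h2 : ((φ (v * w * v⁻¹) : Sp ω) : U ≃ₗ[ℂ] U) =
    (φ v : U ≃ₗ[ℂ] U) * φ w * (φ v : U ≃ₗ[ℂ] U)⁻¹ := by
    rw [map_mul, map_mul, map_inv]
    rfl
  have h3 : IsOfFinOrder (φ w : U ≃ₗ[ℂ] U) :=
    ((Sp ω).subtype.comp φ).isOfFinOrder (isOfFinOrder_of_finite w)
  rw [h1, h2, reflForm_conj (φ v).2 h3, mul_smul_comm, smul_mul_assoc, mul_fiberSum hψ hf hreg ha]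

/-- Multiplication by `τ(1)` turns the right-hand side of a relation over `G` into that over `H`. -/
theorem reflSum_mul_corner (hτ : IsGradedCorner π ζ τ) (φ : W →* Sp ω) {f : G → ℂ} {β : H → ℂ}
    (hβ : ∀ h : H, fiberSum π ψ f h * τ 1 = β h • τ h)
    (hβ0 : ∀ w ∉ H, fiberSum π ψ f w * τ 1 = 0) [Fintype H] (x y : U) :
    reflSum φ π ψ f x y * τ 1 =
      hτ.embed (∑ h, (β h * reflForm ω ((φ.comp H.subtype) h) x y) • of ζ h) := by
  rw [reflSum, Finset.sum_mul, map_sum]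
  refine (Fintype.sum_of_injective (Subtype.val : H → W) Subtype.val_injective _ _ ?_ ?_).symm
  · intro w hw
    rw [smul_mul_assoc, hβ0 w fun h => hw ⟨⟨w, h⟩, rfl⟩, smul_zero]
  · intro h
    rw [map_smul, hτ.embed_of, smul_mul_assoc, hβ, smul_smul, mul_comm]
    rfl

namespace SRA

omit [Fintype G] [Fintype W] in
theorem ofGroupAlgebra_mul_ofTensor (φ : W →* Sp ω) (c : G → ℂ) {a : TwistedGroupAlgebra ψ} {w : W}
    (ha : a ∈ degPart π ψ w) (t : TensorAlgebra ℂ U) :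
    ofGroupAlgebra (φ.comp π) ψ c a * ofTensor (φ.comp π) ψ c t =
      ofTensor (φ.comp π) ψ c (tensorAction φ w t) * ofGroupAlgebra (φ.comp π) ψ c a := by
  have h := congrArg (mk (φ.comp π) ψ c) (group_mul_base_of_mem_degPart φ ha t)
  rwa [map_mul, map_mul] at h

omit [Fintype G] in
theorem ofGroupAlgebra_of_mul_ofTensor (φ : G →* Sp ω) (c : G → ℂ) (g : G)
    (t : TensorAlgebra ℂ U) :
    ofGroupAlgebra φ ψ c (of ψ g) * ofTensor φ ψ c t =
      ofTensor φ ψ c (tensorAction φ g t) * ofGroupAlgebra φ ψ c (of ψ g) := by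
  have h := congrArg (mk φ ψ c) (CrossedProduct.group_of_mul_base (ψ := ψ) g t)
  rwa [map_mul, map_mul] at h

omit [Fintype G] in
theorem induction {φ : G →* Sp ω} {c : G → ℂ} {p : SRA φ ψ c → Prop} (a : SRA φ ψ c)
    (h0 : p 0) (hadd : ∀ a b, p a → p b → p (a + b))
    (hs : ∀ t g, p (ofTensor φ ψ c t * ofGroupAlgebra φ ψ c (of ψ g))) : p a := by
  obtain ⟨x, rfl⟩ := mk_surjective φ ψ c a
  refine CrossedProduct.induction_base_mul_group (p := fun x => p (mk φ ψ c x)) x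
    (by rwa [map_zero]) (fun a b ha hb => by rw [map_add]; exact hadd _ _ ha hb) fun t g => ?_
  rw [map_mul]
  exact hs t g

/-- The defining relations, with the sum over reflections written over the whole group. -/
theorem ofTensor_commutator (φ : G →* Sp ω) {c f : G → ℂ}
    (hf : ∀ g ∈ regularReflections φ ψ, f g = c g) (hf0 : ∀ g ∉ regularReflections φ ψ, f g = 0)
    (x y : U) :
    ofTensor φ ψ c (TensorAlgebra.ι ℂ y * TensorAlgebra.ι ℂ x
        - TensorAlgebra.ι ℂ x * TensorAlgebra.ι ℂ y) =
      ω x y • 1 + ofGroupAlgebra φ ψ c (∑ g, (f g * reflForm ω (φ g) x y) • of ψ g) := by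
  have h := RingQuot.mkAlgHom_rel ℂ (SRARel.comm (φ := φ) (ψ := ψ) (c := c) x y)
  rw [sum_finsum_regularReflections φ hf hf0, map_add, map_smul, map_one] at h
  exact h

/-- The isomorphism of `ℂ_ζ H` with the corner of `ℂ_ψ G` extends to a multiplicative map of the
twisted symplectic reflection algebras. -/
theorem exists_embedding (hτ : IsGradedCorner π ζ τ) (φ : W →* Sp ω) {c f : G → ℂ}
    (hf : ∀ g ∈ regularReflections (φ.comp π) ψ, f g = c g)
    (hf0 : ∀ g ∉ regularReflections (φ.comp π) ψ, f g = 0) {c' β : H → ℂ}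
    (hc' : ∀ h ∈ regularReflections (φ.comp H.subtype) ζ, β h = c' h)
    (hc0 : ∀ h ∉ regularReflections (φ.comp H.subtype) ζ, β h = 0)
    (hβ : ∀ h : H, fiberSum π ψ f h * τ 1 = β h • τ h)
    (hβ0 : ∀ w ∉ H, fiberSum π ψ f w * τ 1 = 0) :
    ∃ i : SRA (φ.comp H.subtype) ζ c' →ₗ[ℂ] SRA (φ.comp π) ψ c, (∀ a b, i (a * b) = i a * i b) ∧
      ∀ t b, i (ofTensor _ ζ c' t * ofGroupAlgebra _ ζ c' b) =
        ofTensor _ ψ c t * ofGroupAlgebra _ ψ c (hτ.embed b) := by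
  have := Fintype.ofFinite H
  let i₀ : SmashAlgebra (φ.comp H.subtype) ζ →ₗ[ℂ] SRA (φ.comp π) ψ c :=
    CrossedProduct.linLift _ (ofTensor (φ.comp π) ψ c)
      ((ofGroupAlgebra (φ.comp π) ψ c).toLinearMap ∘ₗ hτ.embed)
  have hi₀ : ∀ t b, i₀ (CrossedProduct.base _ _ t * CrossedProduct.group _ _ b) =
      ofTensor _ ψ c t * ofGroupAlgebra _ ψ c (hτ.embed b) :=
    fun t b => CrossedProduct.linLift_base_mul_group _ _ t b
  have hmul : ∀ a b, i₀ (a * b) = i₀ a * i₀ b := fun a b => by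
    refine CrossedProduct.induction_base_mul_group (p := fun a => i₀ (a * b) = i₀ a * i₀ b) a
      (by simp only [map_zero, zero_mul])
      (fun a a' ha ha' => by simp only [map_add, add_mul, ha, ha']) fun t h => ?_
    refine CrossedProduct.induction_base_mul_group (p := fun b => i₀ (_ * b) = i₀ _ * i₀ b) b
      (by simp only [map_zero, mul_zero])
      (fun a a' ha ha' => by simp only [map_add, mul_add, ha, ha']) fun s k => ?_
    have h1 : ∀ x y z w : SmashAlgebra (φ.comp H.subtype) ζ, x * y * (z * w) = x * (y * z) * w :=
      fun x y z w => by simp only [mul_assoc]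
    have h2 : ∀ x y z w : SRA (φ.comp π) ψ c, x * y * (z * w) = x * (y * z) * w :=
      fun x y z w => by simp only [mul_assoc]
    rw [hi₀, hi₀, h1, h2, CrossedProduct.group_of_mul_base,
      ofGroupAlgebra_mul_ofTensor φ c (a := hτ.embed (of ζ h)) (w := h)
        (by rw [hτ.embed_of]; exact hτ.mem_degPart h), ← mul_assoc, ← mul_assoc,
      ← map_mul, mul_assoc, mul_assoc, ← map_mul, ← map_mul, ← map_mul, hi₀, hτ.embed_mul]
    rfl
  have hrel : ∀ a b, SRARel (φ.comp H.subtype) ζ c' a b → i₀ a = i₀ b := by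
    rintro _ _ ⟨x, y⟩
    have h1 : ∀ b, i₀ (CrossedProduct.group _ _ b) = ofGroupAlgebra _ ψ c (hτ.embed b) :=
      fun b => by
      rw [← one_mul (CrossedProduct.group _ _ b), ← map_one (CrossedProduct.base _ _), hi₀, map_one,
        one_mul]
    have h2 : ∀ t, i₀ (CrossedProduct.base _ _ t) =
        ofTensor _ ψ c t * ofGroupAlgebra _ ψ c (τ 1) := fun t => by
      rw [← mul_one (CrossedProduct.base _ _ t), ← map_one (CrossedProduct.group _ _), hi₀,
        ← of_one, hτ.embed_of]
    rw [sum_finsum_regularReflections _ hc' hc0, ← CrossedProduct.base_apply, h2,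
      ofTensor_commutator (φ.comp π) hf hf0, ← reflSum_eq, add_mul, ← map_mul,
      reflSum_mul_corner hτ φ hβ hβ0, map_add, h1, map_smul,
      ← map_one (CrossedProduct.group _ _), h1, ← of_one, hτ.embed_of, smul_mul_assoc, one_mul]
  obtain ⟨i, hi⟩ : ∃ i : SRA (φ.comp H.subtype) ζ c' →ₗ[ℂ] SRA (φ.comp π) ψ c,
      ∀ x, i (mk _ ζ c' x) = i₀ x :=
    exists_linearMap_ringQuot i₀ (r := SRARel (φ.comp H.subtype) ζ c')
      fun a b hab x y => by rw [hmul, hmul, hmul, hmul, hrel a b hab]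
  refine ⟨i, fun a b => ?_, fun t b => ?_⟩
  · obtain ⟨a, rfl⟩ := mk_surjective _ _ _ a
    obtain ⟨b, rfl⟩ := mk_surjective _ _ _ b
    refine (congrArg i (map_mul (mk _ ζ c') a b).symm).trans ?_
    rw [hi, hi, hi, hmul]
  · refine (congrArg i (map_mul (mk _ ζ c') _ _).symm).trans ?_
    exact (hi _).trans (hi₀ t b)

/-- The projection `x ↦ τ(1) x τ(1)` of `ℂ_ψ G` to its corner extends to a linear map of the twisted
symplectic reflection algebras. -/
theorem exists_retraction (hτ : IsGradedCorner π ζ τ) (hψ : ψ.IsClassFunction) (φ : W →* Sp ω)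
    {c f : G → ℂ} (hf : ∀ g ∈ regularReflections (φ.comp π) ψ, f g = c g)
    (hf0 : ∀ g ∉ regularReflections (φ.comp π) ψ, f g = 0)
    (hconj : ∀ g k, f (k * g * k⁻¹) = f g) {c' β : H → ℂ}
    (hc' : ∀ h ∈ regularReflections (φ.comp H.subtype) ζ, β h = c' h)
    (hc0 : ∀ h ∉ regularReflections (φ.comp H.subtype) ζ, β h = 0)
    (hβ : ∀ h : H, fiberSum π ψ f h * τ 1 = β h • τ h)
    (hβ0 : ∀ w ∉ H, fiberSum π ψ f w * τ 1 = 0)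
    {P : TwistedGroupAlgebra ψ →ₗ[ℂ] TwistedGroupAlgebra ζ}
    (hP : ∀ x, hτ.embed (P x) = τ 1 * x * τ 1) :
    ∃ D : SRA (φ.comp π) ψ c →ₗ[ℂ] SRA (φ.comp H.subtype) ζ c',
      ∀ t x, D (ofTensor _ ψ c t * ofGroupAlgebra _ ψ c x) =
        ofTensor _ ζ c' t * ofGroupAlgebra _ ζ c' (P x) := by
  have := Fintype.ofFinite H
  have hreg : ∀ g, f g ≠ 0 → ψ.IsRegular g := fun g hg => by
    by_contra h
    exact hg (hf0 g fun h' => h h'.2)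
  let D₀ : SmashAlgebra (φ.comp π) ψ →ₗ[ℂ] SRA (φ.comp H.subtype) ζ c' :=
    CrossedProduct.linLift _ (ofTensor (φ.comp H.subtype) ζ c')
      ((ofGroupAlgebra (φ.comp H.subtype) ζ c').toLinearMap ∘ₗ P)
  have hD₀ : ∀ t x, D₀ (CrossedProduct.base _ _ t * CrossedProduct.group _ _ x) =
      ofTensor _ ζ c' t * ofGroupAlgebra _ ζ c' (P x) :=
    fun t x => CrossedProduct.linLift_base_mul_group _ _ t x
  have hcomm : ∀ w, Commute (fiberSum π ψ f w) (τ 1) := fun w => by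
    have h1 := mul_fiberSum hψ hconj hreg (hτ.mem_degPart 1) w
    simp only [Subgroup.coe_one, one_mul, inv_one, mul_one] at h1
    exact h1.symm
  have hP0 : ∀ w ∉ H, ∀ x, P (fiberSum π ψ f w * x) = 0 := fun w hw x => hτ.embed_injective (by
    rw [hP, ← mul_assoc, ← (hcomm w).eq, hβ0 w hw, zero_mul, zero_mul, map_zero])
  have hPβ : ∀ (h : H) x, P (fiberSum π ψ f h * x) = β h • (of ζ h * P x) := fun h x =>
    hτ.embed_injective (by
      rw [hP, ← mul_assoc, ← (hcomm h).eq, map_smul, hτ.embed_mul, hP, hτ.embed_of, hβ,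
        smul_mul_assoc,
        smul_mul_assoc, ← mul_assoc (τ h), ← mul_assoc (τ h), hτ.mul_one])
  -- `D₀` is compatible with multiplication by the right-hand sides of the relations.
  have hD₁ : ∀ t s x y a, D₀ (CrossedProduct.base _ _ t * CrossedProduct.group _ _
      (reflSum φ π ψ f x y) * CrossedProduct.base _ _ s * CrossedProduct.group _ _ a) =
      ofTensor _ ζ c' t * ofGroupAlgebra _ ζ c'
        (∑ h, (β h * reflForm ω ((φ.comp H.subtype) h) x y) • of ζ h) * ofTensor _ ζ c' s *
          ofGroupAlgebra _ ζ c' (P a) := fun t s x y a => by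
    have h1 : ∀ w, D₀ (CrossedProduct.base _ _ t * CrossedProduct.group _ _
        (fiberSum π ψ f w) * CrossedProduct.base _ _ s * CrossedProduct.group _ _ a) =
        ofTensor _ ζ c' (t * tensorAction φ w s) *
          ofGroupAlgebra _ ζ c' (P (fiberSum π ψ f w * a)) := fun w => by
      rw [mul_assoc (CrossedProduct.base _ _ t),
        group_mul_base_of_mem_degPart φ (fiberSum_mem_degPart f w), ← mul_assoc, ← map_mul,
        mul_assoc, ← map_mul, hD₀]
    simp only [reflSum, map_sum, map_smul, Finset.mul_sum, Finset.sum_mul, smul_mul_assoc,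
      mul_smul_comm, h1]
    refine (Fintype.sum_of_injective (Subtype.val : H → W) Subtype.val_injective _ _ ?_ ?_).symm
    · intro w hw
      rw [hP0 w fun h => hw ⟨⟨w, h⟩, rfl⟩, map_zero, mul_zero, smul_zero]
    · intro h
      rw [hPβ, map_smul, mul_smul_comm, smul_smul, map_mul, map_mul, mul_comm (β h),
        mul_assoc (ofTensor _ ζ c' t), ofGroupAlgebra_of_mul_ofTensor]
      simp only [mul_assoc]
      rfl
  have hrel : ∀ a b, SRARel (φ.comp π) ψ c a b → ∀ x y, D₀ (x * a * y) = D₀ (x * b * y) := by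
    rintro _ _ ⟨x, y⟩ a b
    refine CrossedProduct.induction_base_mul_group (p := fun a => D₀ (a * _ * b) = D₀ (a * _ * b)) a
      (by simp only [map_zero, zero_mul])
      (fun a a' ha ha' => by simp only [map_add, add_mul, ha, ha']) fun t g => ?_
    refine CrossedProduct.induction_base_mul_group (p := fun b => D₀ (_ * b) = D₀ (_ * b)) b
      (by simp only [map_zero, mul_zero])
      (fun a a' ha ha' => by simp only [map_add, mul_add, ha, ha']) fun s k => ?_
    have hg : ∀ p, CrossedProduct.group (tensorAction (φ.comp π)) ψ (of ψ g) *
        CrossedProduct.base _ _ p = CrossedProduct.base _ _ (tensorAction φ (π g) p) *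
          CrossedProduct.group _ _ (of ψ g) :=
      fun p => group_mul_base_of_mem_degPart φ (of_mem_degPart rfl) p
    have hr := congrArg (CrossedProduct.group (tensorAction (φ.comp π)) ψ)
      (mul_reflSum φ hψ hconj hreg (of_mem_degPart (ψ := ψ) (rfl : π g = π g)) x y)
    rw [map_mul, map_mul] at hr
    rw [sum_finsum_regularReflections _ hf hf0, ← CrossedProduct.base_apply, ← reflSum_eq]
    have h1 : ∀ p, CrossedProduct.base (tensorAction (φ.comp π)) ψ t *
        CrossedProduct.group _ _ (of ψ g) * CrossedProduct.base _ _ p *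
        (CrossedProduct.base _ _ s * CrossedProduct.group _ _ (of ψ k)) =
        CrossedProduct.base _ _ (t * tensorAction φ (π g) p * tensorAction φ (π g) s) *
          CrossedProduct.group _ _ (of ψ g * of ψ k) := fun p => by
      rw [mul_assoc (CrossedProduct.base _ _ t), hg, ← mul_assoc, ← mul_assoc,
        mul_assoc (_ * _) (CrossedProduct.group _ _ _), hg, map_mul, map_mul, map_mul]
      simp only [mul_assoc]
    have h2 : CrossedProduct.base (tensorAction (φ.comp π)) ψ t *
        CrossedProduct.group _ _ (of ψ g) * (CrossedProduct.group _ _ (reflSum φ π ψ f x y)) *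
        (CrossedProduct.base _ _ s * CrossedProduct.group _ _ (of ψ k)) =
        CrossedProduct.base _ _ t * CrossedProduct.group _ _ (reflSum φ π ψ f
          ((φ (π g) : U ≃ₗ[ℂ] U) x) ((φ (π g) : U ≃ₗ[ℂ] U) y)) *
          CrossedProduct.base _ _ (tensorAction φ (π g) s) *
          CrossedProduct.group _ _ (of ψ g * of ψ k) := by
      rw [mul_assoc (CrossedProduct.base _ _ t), hr, ← mul_assoc, ← mul_assoc,
        mul_assoc (_ * _) (CrossedProduct.group _ _ _), hg, map_mul]
      simp only [mul_assoc]
    have h3 : tensorAction φ (π g) (TensorAlgebra.ι ℂ y * TensorAlgebra.ι ℂ x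
        - TensorAlgebra.ι ℂ x * TensorAlgebra.ι ℂ y) =
        TensorAlgebra.ι ℂ ((φ (π g) : U ≃ₗ[ℂ] U) y) * TensorAlgebra.ι ℂ ((φ (π g) : U ≃ₗ[ℂ] U) x)
        - TensorAlgebra.ι ℂ ((φ (π g) : U ≃ₗ[ℂ] U) x) *
          TensorAlgebra.ι ℂ ((φ (π g) : U ≃ₗ[ℂ] U) y) := by
      rw [map_sub, map_mul, map_mul, tensorAction_ι, tensorAction_ι]
    have h4 : ω ((φ (π g) : U ≃ₗ[ℂ] U) x) ((φ (π g) : U ≃ₗ[ℂ] U) y) = ω x y := (φ (π g)).2 x y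
    have h5 := h1 1
    rw [map_one, map_one, mul_one, mul_one] at h5
    rw [h1, hD₀, h3, map_mul, map_mul, ofTensor_commutator _ hc' hc0, h4, mul_add, add_mul, mul_add,
      add_mul, add_mul, map_add, h2, hD₁]
    congr 1
    simp only [mul_smul_comm, smul_mul_assoc, mul_one, map_smul, h5, hD₀]
    rw [map_mul (ofTensor _ ζ c')]
  obtain ⟨D, hD⟩ : ∃ D : SRA (φ.comp π) ψ c →ₗ[ℂ] SRA (φ.comp H.subtype) ζ c',
      ∀ x, D (mk _ ψ c x) = D₀ x := exists_linearMap_ringQuot D₀ hrel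
  refine ⟨D, fun t b => ?_⟩
  refine (congrArg D (map_mul (mk _ ψ c) _ _).symm).trans ?_
  exact (hD _).trans (hD₀ t b)

end SRA

/-- The Morita equivalence of twisted symplectic reflection algebras given by a graded corner of the
block `e ℂ_ψ G`. The parameters have to match: `f` and `β` extend them by zero, and the class sums
of `f` act on the corner as prescribed by `β`. -/
theorem isMoritaEquivalent_corner_SRA (hτ : IsGradedCorner π ζ τ) (hψ : ψ.IsClassFunction)
    (φ : W →* Sp ω) {c f : G → ℂ} (hf : ∀ g ∈ regularReflections (φ.comp π) ψ, f g = c g)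
    (hf0 : ∀ g ∉ regularReflections (φ.comp π) ψ, f g = 0)
    (hconj : ∀ g k, f (k * g * k⁻¹) = f g) {c' β : H → ℂ}
    (hc' : ∀ h ∈ regularReflections (φ.comp H.subtype) ζ, β h = c' h)
    (hc0 : ∀ h ∉ regularReflections (φ.comp H.subtype) ζ, β h = 0)
    (hβ : ∀ h : H, fiberSum π ψ f h * τ 1 = β h • τ h)
    (hβ0 : ∀ w ∉ H, fiberSum π ψ f w * τ 1 = 0) {e : TwistedGroupAlgebra ψ} (heτ : e * τ 1 = τ 1)
    (hcomm : ∀ a, Commute e a)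
    (hfull : e ∈ Submodule.span ℂ {x | ∃ a b, x = a * τ 1 * b})
    (he : IsIdempotentElem (SRA.ofGroupAlgebra (φ.comp π) ψ c e)) :
    IsMoritaEquivalent ℂ he.Corner (SRA (φ.comp H.subtype) ζ c') := by
  obtain ⟨P, hP⟩ := hτ.exists_cornerProj
  obtain ⟨i, hmul, hi⟩ := SRA.exists_embedding hτ φ hf hf0 hc' hc0 hβ hβ0
  obtain ⟨D, hD⟩ := SRA.exists_retraction hτ hψ φ hf hf0 hconj hc' hc0 hβ hβ0 hP
  let u := SRA.ofGroupAlgebra (φ.comp π) ψ c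
  have hi1 : i 1 = u (τ 1) := by
    have h1 := hi 1 1
    rwa [map_one, map_one, map_one, one_mul, one_mul, ← of_one, hτ.embed_of] at h1
  have hD' : ∀ b, D (i b) = b := fun b => by
    refine SRA.induction (p := fun b => D (i b) = b) b (by simp only [map_zero])
      (fun a b ha hb => by simp only [map_add, ha, hb]) fun t h => ?_
    rw [hi, hD]
    congr 2
    refine hτ.embed_injective ?_
    rw [hP, hτ.embed_of, hτ.one_mul, hτ.mul_one]
  have hi' : ∀ a, i (D a) = i 1 * a * i 1 := fun a => by
    refine SRA.induction (p := fun a => i (D a) = i 1 * a * i 1) a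
      (by simp only [map_zero, mul_zero, zero_mul])
      (fun a b ha hb => by simp only [map_add, mul_add, add_mul, ha, hb]) fun t g => ?_
    have h1 := SRA.ofGroupAlgebra_mul_ofTensor φ c (hτ.mem_degPart 1) t
    rw [Subgroup.coe_one, map_one, AlgEquiv.one_apply] at h1
    rw [hD, hi, hP, hi1, map_mul, map_mul, ← mul_assoc (u (τ 1)), h1]
    simp only [mul_assoc]
    rfl
  have hτe : τ 1 * e = τ 1 := by rw [← (hcomm _).eq, heτ]
  have hmem : ∀ b, i b ∈ Subsemigroup.corner (u e) := fun b => by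
    rw [Subsemigroup.mem_corner_iff he]
    constructor
    · rw [← one_mul b, hmul, hi1, ← mul_assoc, ← map_mul, heτ]
    · rw [← mul_one b, hmul, hi1, mul_assoc, ← map_mul, hτe]
  let i' : SRA (φ.comp H.subtype) ζ c' →ₙₐ[ℂ] he.Corner :=
    { toFun := fun b => ⟨i b, hmem b⟩
      map_smul' := fun r b => Subtype.ext (map_smul i r b)
      map_zero' := Subtype.ext (map_zero i)
      map_add' := fun a b => Subtype.ext (map_add i a b)
      map_mul' := fun a b => Subtype.ext (hmul a b) }
  refine isMoritaEquivalent_of_corner (i := i') (D := fun a => D a.1) (fun a b => map_add D a.1 b.1)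
    hD' (fun a => Subtype.ext (hi' a.1)) ?_
  let q : TwistedGroupAlgebra ψ → he.Corner := fun a => ⟨u e * u a * u e,
    (Subsemigroup.mem_corner_iff he).2 ⟨by rw [← mul_assoc, ← mul_assoc, he.eq], by
      rw [mul_assoc, he.eq]⟩⟩
  have hq : ∀ a b, a ∈ Submodule.span ℂ {x | ∃ a b, x = a * τ 1 * b} → b = q a →
      b ∈ Submodule.span ℂ {x | ∃ a b, x = a * i' 1 * b} := by
    intro a b ha hb
    subst hb
    induction ha using Submodule.span_induction with
    | mem x hx =>
      obtain ⟨a, b, rfl⟩ := hx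
      refine Submodule.subset_span ⟨q a, q b, Subtype.ext ?_⟩
      change u e * u (a * τ 1 * b) * u e = u e * u a * u e * i 1 * (u e * u b * u e)
      rw [hi1, map_mul, map_mul]
      have h1 : u e * u (τ 1) = u (τ 1) := by rw [← map_mul, heτ]
      have h2 : u (τ 1) * u e = u (τ 1) := by rw [← map_mul, hτe]
      rw [mul_assoc _ (u e) (u (τ 1)), h1, mul_assoc (u e) (u b), ← mul_assoc _ (u e) (u b * u e),
        mul_assoc _ (u (τ 1)) (u e), h2]
      simp only [mul_assoc]
    | zero =>
      have h1 : q 0 = 0 := Subtype.ext (by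
        change u e * u 0 * u e = 0
        rw [map_zero, mul_zero, zero_mul])
      rw [h1]
      exact zero_mem _
    | add x y _ _ hx hy =>
      have h1 : q (x + y) = q x + q y := Subtype.ext (by
        change u e * u (x + y) * u e = u e * u x * u e + u e * u y * u e
        rw [map_add, mul_add, add_mul])
      rw [h1]
      exact add_mem hx hy
    | smul r x _ hx =>
      have h1 : q (r • x) = r • q x := Subtype.ext (by
        change u e * u (r • x) * u e = r • (u e * u x * u e)
        rw [map_smul, mul_smul_comm, smul_mul_assoc])
      rw [h1]
      exact Submodule.smul_mem _ _ hx
  refine hq e 1 hfull (Subtype.ext ?_)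
  change u e = u e * u e * u e
  rw [he.eq, he.eq]

end Morita

/-! ### Sums over conjugacy classes -/

section ConjClassSums

variable {K : Type} [Group K]

theorem ConjClasses.mk_rep (D : ConjClasses K) : ConjClasses.mk D.rep = D :=
  Quotient.out_eq (s := IsConj.setoid K) D

theorem ConjClasses.apply_rep_mk {Φ : K → ℂ} (hΦ : ∀ g k, Φ (k * g * k⁻¹) = Φ g) (g : K) :
    Φ (ConjClasses.mk g).rep = Φ g := by
  obtain ⟨k, hk⟩ := isConj_iff.1 (ConjClasses.mk_eq_mk_iff_isConj.1 (ConjClasses.mk_rep (.mk g)))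
  exact (hΦ _ _).symm.trans (congrArg Φ hk)

open Classical in
theorem card_filter_mk_eq [Fintype K] (D : ConjClasses K) :
    ((Finset.univ.filter fun g => ConjClasses.mk g = D).card : ℂ) = D.carrier.ncard := by
  rw [← Set.ncard_coe_finset]
  congr 2
  ext g
  simp [ConjClasses.mem_carrier_iff_mk_eq]

theorem ncard_carrier_ne_zero [Finite K] (D : ConjClasses K) : (D.carrier.ncard : ℂ) ≠ 0 := by
  rw [Nat.cast_ne_zero]
  exact Set.ncard_ne_zero_of_mem (a := D.rep) (ConjClasses.mem_carrier_iff_mk_eq.2 D.mk_rep)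

open Classical in
theorem sum_eq_sum_conjClasses [Fintype K] [Fintype (ConjClasses K)] {Φ : K → ℂ}
    (hΦ : ∀ g k, Φ (k * g * k⁻¹) = Φ g) :
    ∑ g, Φ g = ∑ D : ConjClasses K, D.carrier.ncard * Φ D.rep := by
  rw [← Finset.sum_fiberwise Finset.univ ConjClasses.mk Φ]
  refine Finset.sum_congr rfl fun D _ => ?_
  rw [← card_filter_mk_eq, ← nsmul_eq_mul, ← Finset.sum_const]
  refine Finset.sum_congr rfl fun g hg => ?_
  rw [← (Finset.mem_filter.1 hg).2, ConjClasses.apply_rep_mk hΦ]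

end ConjClassSums

/-! ### Regular elements and simple representations -/

theorem TwoCocycle.isRegular_iff_commute {G : Type} [Group G] {ψ : TwoCocycle G} {g : G} :
    ψ.IsRegular g ↔ ∀ h, Commute g h → Commute (of ψ g) (of ψ h) := by
  refine forall_congr' fun h => forall_congr' fun hc => ?_
  rw [commute_iff_eq, of_mul_of, of_mul_of, hc.eq]
  constructor
  · intro h1
    rw [h1]
  · intro h1
    have h2 := congrArg (coeff (h * g)) h1
    rw [map_smul, map_smul, coeff_of, if_pos rfl, smul_eq_mul, smul_eq_mul, mul_one, mul_one] at h2
    exact Units.ext h2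

theorem TwoCocycle.IsRegular.conj {G : Type} [Group G] {ψ : TwoCocycle G} {g : G}
    (hg : ψ.IsRegular g) (k : G) : ψ.IsRegular (k * g * k⁻¹) := by
  rw [TwoCocycle.isRegular_iff_commute] at hg ⊢
  intro h hc
  have hc' : Commute g (k⁻¹ * h * k) := by
    rw [commute_iff_eq]
    have h1 := hc.eq
    calc g * (k⁻¹ * h * k) = k⁻¹ * (k * g * k⁻¹ * h) * k := by group
      _ = k⁻¹ * (h * (k * g * k⁻¹)) * k := by rw [h1]
      _ = k⁻¹ * h * k * g := by group
  let u := ofUnit ψ k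
  have h1 : Commute (of ψ k * of ψ g * (u⁻¹ : (TwistedGroupAlgebra ψ)ˣ))
      (of ψ k * of ψ (k⁻¹ * h * k) * (u⁻¹ : (TwistedGroupAlgebra ψ)ˣ)) := by
    have h2 : ∀ x y : TwistedGroupAlgebra ψ, of ψ k * x * (u⁻¹ : (TwistedGroupAlgebra ψ)ˣ) *
        (of ψ k * y * (u⁻¹ : (TwistedGroupAlgebra ψ)ˣ)) =
        of ψ k * (x * y) * (u⁻¹ : (TwistedGroupAlgebra ψ)ˣ) := fun x y => by
      rw [← mul_assoc, ← mul_assoc, mul_assoc (of ψ k * x), inv_ofUnit_mul_of, mul_one,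
        mul_assoc _ x]
    rw [commute_iff_eq, h2, h2, (hg _ hc').eq]
  rw [conj_of, conj_of] at h1
  have h3 : k * (k⁻¹ * h * k) * k⁻¹ = h := by group
  rw [h3] at h1
  rw [Commute.smul_left_iff₀ (by simp), Commute.smul_right_iff₀ (by simp)] at h1
  exact h1

theorem TwoCocycle.isRegular_conj_iff {G : Type} [Group G] {ψ : TwoCocycle G} (g k : G) :
    ψ.IsRegular (k * g * k⁻¹) ↔ ψ.IsRegular g :=
  ⟨fun h => by simpa [mul_assoc] using h.conj k⁻¹, fun h => h.conj k⟩

theorem TwoCocycle.isRegular_one {G : Type} [Group G] (ψ : TwoCocycle G) : ψ.IsRegular 1 :=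
  fun h _ => by rw [ψ.one_left, ψ.one_right]

section Simple

variable {G W : Type} [Group G] [Group W] {π : G →* W} {ψ : TwoCocycle G}

namespace TwistedRep

theorem character_eq_of_iso {M N : TwistedRep π ψ} (θ : M ≅ N) (g : G) :
    M.character g = N.character g := by
  let E : M.V ≃ₗ[ℂ] N.V := LinearEquiv.ofLinearMap θ.hom.toLin θ.inv.toLin
    (by rw [← comp_toLin, θ.inv_hom_id, id_toLin]) (by rw [← comp_toLin, θ.hom_inv_id, id_toLin])
  have h1 : N.ρ (of ψ g) = E.conj (M.ρ (of ψ g)) := by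
    refine LinearMap.ext fun n => ?_
    rw [LinearEquiv.conj_apply_apply]
    change _ = θ.hom.toLin (M.ρ (of ψ g) (E.symm n))
    rw [hom_comm_apply]
    exact congrArg _ (E.apply_symm_apply n).symm
  rw [character, character, h1, LinearMap.trace_conj']

theorem character_conj (hψ : ψ.IsClassFunction) (M : TwistedRep π ψ) (g k : G) :
    M.character (k * g * k⁻¹) = M.character g := hψ M.V M.ρ g k

theorem injective_of_mono {M N : TwistedRep π ψ} (f : M ⟶ N) [Mono f] :
    Function.Injective f.toLin := by
  let K : TwistedRep π ψ :=
    { V := LinearMap.ker f.toLin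
      ρ := AlgHom.ofLinearMap
        { toFun := fun a => (M.ρ a).restrict (p := LinearMap.ker f.toLin)
            (q := LinearMap.ker f.toLin) fun m hm => by
              rw [LinearMap.mem_ker] at hm ⊢
              rw [hom_comm_apply, hm, map_zero]
          map_add' := fun a b => LinearMap.ext fun m => Subtype.ext (by
            change M.ρ (a + b) m = M.ρ a m + M.ρ b m
            rw [map_add, LinearMap.add_apply])
          map_smul' := fun c a => LinearMap.ext fun m => Subtype.ext (by
            change M.ρ (c • a) m = c • M.ρ a m
            rw [map_smul, LinearMap.smul_apply]) }
        (LinearMap.ext fun m => Subtype.ext (by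
            change M.ρ 1 m = m
            rw [map_one, Module.End.one_apply]))
        fun a b => LinearMap.ext fun m => Subtype.ext (by
            change M.ρ (a * b) m = M.ρ a (M.ρ b m)
            rw [map_mul, Module.End.mul_apply]) }
  let j : K ⟶ M := ⟨(LinearMap.ker f.toLin).subtype, fun a => rfl⟩
  have h0 : j = 0 := by
    rw [← cancel_mono f, Limits.zero_comp]
    ext1
    exact LinearMap.ext fun m => m.2
  rw [← LinearMap.ker_eq_bot, eq_bot_iff]
  intro m hm
  exact LinearMap.congr_fun (congrArg Hom.toLin h0) (⟨m, hm⟩ : LinearMap.ker f.toLin)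

theorem simple_ofModule [Finite G] (N : Submodule (TwistedGroupAlgebra ψ) (TwistedGroupAlgebra ψ))
    [IsSimpleModule (TwistedGroupAlgebra ψ) N] : Simple (ofModule π N : TwistedRep π ψ) := by
  have hN : Nontrivial N := IsSimpleModule.nontrivial (TwistedGroupAlgebra ψ) N
  refine ⟨fun {Y} f _ => ⟨?_, fun hf => ?_⟩⟩
  · intro _ h0
    obtain ⟨n, hn⟩ := exists_ne (0 : N)
    have h1 : 𝟙 (ofModule π N : TwistedRep π ψ) = 0 :=
      (IsIso.inv_hom_id f).symm.trans ((congrArg (inv f ≫ ·) h0).trans Limits.comp_zero)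
    exact hn (LinearMap.congr_fun (congrArg Hom.toLin h1) n)
  · let R : Submodule (TwistedGroupAlgebra ψ) N :=
      { LinearMap.range f.toLin with
        smul_mem' := by
          rintro a _ ⟨y, rfl⟩
          exact ⟨Y.ρ a y, hom_comm_apply f a y⟩ }
    have hR : ∀ y, f.toLin y ∈ R := fun y => ⟨y, rfl⟩
    have hR0 : R ≠ ⊥ := fun h => hf (by
      ext1
      refine LinearMap.ext fun y => ?_
      have h1 := hR y
      rw [h] at h1
      exact h1)
    have hsurj : Function.Surjective f.toLin := fun n => by
      have h1 : n ∈ R := by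
        rw [(IsSimpleOrder.eq_bot_or_eq_top R).resolve_left hR0]
        trivial
      exact h1
    let E := LinearEquiv.ofBijective f.toLin ⟨injective_of_mono f, hsurj⟩
    have h1 : f = (isoOfGroup E fun g => f.comm _).hom := by
      ext1
      rfl
    rw [h1]
    infer_instance

end TwistedRep

end Simple

/-! ### Characters and corners of a module equivalence -/

section Equivalence

variable {G W : Type} [Group G] [Group W] [Finite W] {π : G →* W} {ψ : TwoCocycle G}
  {T : ModuleSubcategory (FDRep ℂ W) (TwistedRep π ψ)} {H : Subgroup W} {ζ : TwoCocycle H}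

/-- A class function on `H` that is supported on regular elements and orthogonal to all characters
`χ_{F(M)}`, for `M` simple, vanishes: since `F` is essentially surjective, every irreducible
character of `ℂ_ζ H` occurs, so that the central element `∑ b(h) h` has trace zero on all simple
modules. -/
theorem eq_zero_of_sum_character (F : T.Cat ⥤ TwistedRep H.subtype ζ) [F.IsEquivalence]
    [Fintype H] (hζ : ζ.IsClassFunction) {b : H → ℂ}
    (hb : ∀ h k, b (k * h * k⁻¹) = b h) (hreg : ∀ h, b h ≠ 0 → ζ.IsRegular h)
    (hsum : ∀ M : T.Cat, Simple M → ∑ h, b h * (F.obj M).character h = 0) (h : H) : b h = 0 := by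
  have hz : ∑ h, b h • of ζ h = 0 := by
    refine eq_zero_of_central_of_trace (commute_of_forall_of fun k => Commute.symm ?_)
      fun N hN => ?_
    · rw [commute_iff_eq, Finset.mul_sum, Finset.sum_mul]
      refine Fintype.sum_equiv (MulAut.conj k).toEquiv _ _ fun g => ?_
      have h1 : (MulAut.conj k).toEquiv g = k * g * k⁻¹ := rfl
      rw [h1, hb, mul_smul_comm, smul_mul_assoc]
      by_cases h0 : b g = 0
      · rw [h0, zero_smul, zero_smul]
      · rw [of_mul_of_conj_of_isRegular hζ (hreg g h0)]
    · have := TwistedRep.simple_ofModule (π := H.subtype) N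
      let N' : TwistedRep H.subtype ζ := TwistedRep.ofModule H.subtype N
      have : Simple N' := this
      let θ := F.objObjPreimageIso N'
      have h1 : Simple (F.objPreimage N') := (simple_obj_iff F _).1 (Simple.of_iso θ)
      have h2 := hsum _ h1
      simp only [TwistedRep.character_eq_of_iso θ] at h2
      rw [map_sum, map_sum, ← h2]
      exact Finset.sum_congr rfl fun g _ => by rw [map_smul, map_smul]; rfl
  have h1 := congrArg (coeff h) hz
  classical
  simpa [coeff_of] using h1

/-- An equivalence of a block with `Rep(H, ζ)` is given by a graded corner, obtained from the
preimage of the regular representation. -/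
theorem ModuleSubcategory.exists_block_corner [Finite G] {ι : Type} [Fintype ι]
    {S : ι → ModuleSubcategory (FDRep ℂ W) (TwistedRep π ψ)} (hS : IsDirectSum S)
    {e : ι → TwistedGroupAlgebra ψ} (he : IsBlockDecomposition S e) (hπ : Function.Surjective π)
    {i : ι} (F : (S i).Cat ⥤ TwistedRep H.subtype ζ) [F.IsEquivalence] [F.LeftLinear (FDRep ℂ W)] :
    ∃ τ : H → TwistedGroupAlgebra ψ, IsBlockCorner F (e i) τ := by
  let B := TwistedRep.regular H.subtype ζ
  obtain ⟨τ, hτ, h1, h2⟩ := TwistedRep.exists_gradedCorner F hπ (F.objObjPreimageIso B)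
  refine ⟨τ, hτ, fun M => (prop_iff_ρ_block hS he).1, h1 _ fun M => (prop_iff_ρ_block hS he).1,
    mem_span_corner (fun M => prop_iff_ρ_block hS he) (block_mul_self hS he i)
      (fun a => commute_block hS he i a) h2, h2, F.objPreimage B, ?_⟩
  rw [TwistedRep.character_eq_of_iso (F.objObjPreimageIso B), TwistedRep.character, of_one, map_one]
  have h3 : Module.finrank ℂ (TwistedGroupAlgebra ζ) ≠ 0 := by
    have : Nontrivial (TwistedGroupAlgebra ζ) := ⟨1, 0, fun h => by
      have h4 := congrArg (coeff 1) h
      rw [← of_one, coeff_of, if_pos rfl, map_zero] at h4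
      exact one_ne_zero h4⟩
    exact Module.finrank_pos.ne'
  refine fun h4 => h3 ?_
  rw [LinearMap.trace_one] at h4
  exact_mod_cast h4

end Equivalence

/-! ### The character coefficients -/

section Coefficients

variable {G W : Type} [Group G] [Group W] {π : G →* W} {ψ : TwoCocycle G}
  {T : ModuleSubcategory (FDRep ℂ W) (TwistedRep π ψ)} {H : Subgroup W} {ζ : TwoCocycle H}

theorem isConj_conj_right {K : Type} [Group K] (r h k : K) :
    IsConj r (k * h * k⁻¹) ↔ IsConj r h := by
  have h1 : IsConj h (k * h * k⁻¹) := isConj_iff.2 ⟨k, rfl⟩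
  exact ⟨fun h => h.trans h1.symm, fun h => h.trans h1⟩

theorem ConjClasses.mk_conj {K : Type} [Group K] (h k : K) :
    ConjClasses.mk (k * h * k⁻¹) = ConjClasses.mk h :=
  ConjClasses.mk_eq_mk_iff_isConj.2 (isConj_iff.2 ⟨k, rfl⟩).symm

theorem forall_mem_carrier_isRegular_iff (E : ConjClasses H) :
    (∀ h ∈ E.carrier, ζ.IsRegular h) ↔ ζ.IsRegular E.rep := by
  refine ⟨fun h => h _ (ConjClasses.mem_carrier_iff_mk_eq.2 E.mk_rep), fun h k hk => ?_⟩
  rw [ConjClasses.mem_carrier_iff_mk_eq, ← E.mk_rep, ConjClasses.mk_eq_mk_iff_isConj] at hk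
  obtain ⟨l, hl⟩ := isConj_iff.1 hk.symm
  exact hl ▸ h.conj l

variable [Fintype W]

open Classical in
/-- The sum over conjugacy classes of regular elements in the definition of
`IsCharacterCoefficients`, as a sum over elements. -/
theorem finsum_mul_character [Fintype H] (hζ : ζ.IsClassFunction) (N : TwistedRep H.subtype ζ)
    (a : ConjClasses H → ℂ) (r : W) :
    (∑ᶠ E ∈ {E : ConjClasses H | (∀ h ∈ E.carrier, ζ.IsRegular h) ∧
        E.map H.subtype = ConjClasses.mk r}, a E * N.character E.rep) =
      ∑ h : H, if ζ.IsRegular h ∧ IsConj r (h : W) then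
        a (.mk h) / (ConjClasses.mk h).carrier.ncard * N.character h else 0 := by
  have := Fintype.ofFinite (ConjClasses H)
  rw [sum_eq_sum_conjClasses fun h k => ?_, finsum_eq_sum_of_fintype]
  · refine Finset.sum_congr rfl fun E _ => ?_
    have h1 : E ∈ {E : ConjClasses H | (∀ h ∈ E.carrier, ζ.IsRegular h) ∧
        E.map H.subtype = ConjClasses.mk r} ↔ ζ.IsRegular E.rep ∧ IsConj r (E.rep : W) := by
      rw [Set.mem_ofPred_eq, forall_mem_carrier_isRegular_iff]
      refine and_congr_right fun _ => ?_
      conv_lhs => rw [← E.mk_rep]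
      exact ConjClasses.mk_eq_mk_iff_isConj.trans isConj_comm
    rw [finsum_eq_if, E.mk_rep]
    by_cases h : ζ.IsRegular E.rep ∧ IsConj r (E.rep : W)
    · rw [if_pos h, if_pos (h1.2 h), ← mul_assoc, mul_div_cancel₀ _ (ncard_carrier_ne_zero E)]
    · rw [if_neg h, if_neg fun h' => h (h1.1 h'), mul_zero]
  · simp only [ConjClasses.mk_conj, TwistedRep.character_conj hζ, TwoCocycle.isRegular_conj_iff,
      Subgroup.coe_mul, Subgroup.coe_inv, isConj_conj_right]

/-- The value `α({1}, {1})` is the ratio `dim M / dim F(M)`, which does not depend on `M`. -/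
theorem IsCharacterCoefficients.apply_one {F : T.Cat ⥤ TwistedRep H.subtype ζ} [F.IsEquivalence]
    {α : ConjClasses G → ConjClasses H → ℂ} (hα : IsCharacterCoefficients F α)
    (hζ : ζ.IsClassFunction) {c : ℂ}
    (hc : ∀ M : T.Cat, M.obj.character 1 = c * (F.obj M).character 1) :
    α (.mk 1) (.mk 1) = c := by
  classical
  have := Fintype.ofFinite H
  have h1 : ∀ M : T.Cat, Simple M →
      (α (.mk 1) (.mk 1) - c) * (F.obj M).character 1 = 0 := fun M hM => by
    have h2 := hα 1 M hM
    rw [hc, map_one, finsum_mul_character hζ, Finset.sum_eq_single 1] at h2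
    · have h3 : (ConjClasses.mk (1 : H)).carrier.ncard = 1 := by
        rw [Set.ncard_eq_one]
        refine ⟨1, Set.ext fun k => ?_⟩
        rw [ConjClasses.mem_carrier_iff_mk_eq, ConjClasses.mk_eq_mk_iff_isConj, isConj_comm,
          isConj_one_right, Set.mem_singleton_iff]
      rw [if_pos ⟨ζ.isRegular_one, IsConj.refl _⟩, h3, Nat.cast_one, div_one] at h2
      rw [sub_mul, ← h2, sub_self]
    · intro h _ hne
      refine if_neg fun h' => hne ?_
      have h3 := isConj_one_right.1 h'.2
      exact Subtype.ext h3
    · intro h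
      exact absurd (Finset.mem_univ _) h
  have h2 := eq_zero_of_sum_character F hζ
    (b := fun h => if h = 1 then α (.mk 1) (.mk 1) - c else 0) (fun h k => by simp)
    (fun h h' => by
      have h3 : h = 1 := by
        by_contra h3
        exact h' (if_neg h3)
      rw [h3]
      exact ζ.isRegular_one)
    (fun M hM => by
      simp only [ite_mul, zero_mul, Finset.sum_ite_eq', Finset.mem_univ, if_true]
      exact h1 M hM) 1
  rw [if_pos rfl, sub_eq_zero] at h2
  exact h2

variable [Fintype G]

/-- The numbers `α_C(E) = c β_C(E) |E| / |C|` have the required property, where `β_C` describes the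
action on the corner of the sum of the regular elements of `C`, and `c` is the constant in the trace
identity for this sum. -/
theorem exists_isCharacterCoefficients (hψ : ψ.IsClassFunction) (hζ : ζ.IsClassFunction)
    {F : T.Cat ⥤ TwistedRep H.subtype ζ} {e : TwistedGroupAlgebra ψ}
    {τ : H → TwistedGroupAlgebra ψ} (hτ : IsBlockCorner F e τ) :
    ∃ α : ConjClasses G → ConjClasses H → ℂ, IsCharacterCoefficients F α := by
  classical
  have := Fintype.ofFinite H
  obtain ⟨c, -, -, hc⟩ := exists_trace_identity hτ hψ
  let f : ConjClasses G → G → ℂ := fun D g =>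
    if ConjClasses.mk g = D ∧ ψ.IsRegular g then 1 else 0
  have hf : ∀ D g k, f D (k * g * k⁻¹) = f D g := fun D g k => by
    simp only [f, ConjClasses.mk_conj, TwoCocycle.isRegular_conj_iff]
  have hreg : ∀ D g, f D g ≠ 0 → ψ.IsRegular g := fun D g h => by
    by_contra h1
    exact h (if_neg fun h2 => h1 h2.2)
  choose β hβ hβ0 hβreg hβconj using fun D =>
    hτ.toIsGradedCorner.exists_transfer hψ hζ (hf D) (hreg D)
  refine ⟨fun D E => c * β D E.rep * E.carrier.ncard / D.carrier.ncard, fun g M _ => ?_⟩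
  let D := ConjClasses.mk g
  have h1 := hc (f D) (β D) (hf D) (hreg D) (hβ D) (hβ0 D) M (π g)
  have h2 : ∀ k, (if IsConj (π g) (π k) then f D k * M.obj.character k else 0) =
      if ConjClasses.mk k = D then M.obj.character g else 0 := fun k => by
    by_cases hk : ConjClasses.mk k = D
    · have h3 := (ConjClasses.mk_eq_mk_iff_isConj.1 hk).symm
      have h4 : M.obj.character k = M.obj.character g := by
        obtain ⟨l, rfl⟩ := isConj_iff.1 h3
        exact TwistedRep.character_conj hψ _ _ _
      rw [if_pos (π.map_isConj h3), if_pos hk, ← h4]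
      by_cases hr : ψ.IsRegular k
      · rw [show f D k = 1 from if_pos ⟨hk, hr⟩, one_mul]
      · rw [TwistedRep.character, trace_of_eq_zero _ hr, mul_zero]
    · rw [if_neg hk, show f D k = 0 from if_neg fun h => hk h.1, zero_mul, ite_self]
  simp only [h2] at h1
  rw [← Finset.sum_filter, Finset.sum_const, nsmul_eq_mul, card_filter_mk_eq] at h1
  rw [finsum_mul_character hζ, ← mul_right_inj' (ncard_carrier_ne_zero D), h1, Finset.mul_sum,
    Finset.mul_sum]
  refine Finset.sum_congr rfl fun h _ => ?_
  have h3 := ConjClasses.apply_rep_mk (hβconj D) h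
  by_cases hr : ζ.IsRegular h
  · by_cases hr' : IsConj (π g) (h : W)
    · rw [if_pos hr', if_pos ⟨hr, hr'⟩]
      have h4 := ncard_carrier_ne_zero D
      have h5 := ncard_carrier_ne_zero (ConjClasses.mk h)
      change _ = (D.carrier.ncard : ℂ) * (c * β D (ConjClasses.mk h).rep * _ /
        (D.carrier.ncard : ℂ) / _ * _)
      rw [h3]
      field_simp
    · rw [if_neg hr', if_neg fun h' => hr' h'.2, mul_zero, mul_zero]
  · have h4 : β D h = 0 := by
      by_contra h4
      exact hr (hβreg D h h4)
    rw [h4, zero_mul, ite_self, if_neg fun h' => hr h'.1, mul_zero, mul_zero]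

/-- The action of a class sum on the corner is determined by the numbers `α`. The trace identity and
the defining property of `α` express the same sums of values of `χ_M` through `χ_{F(M)}`, and the
coefficients agree because the irreducible characters of `ℂ_ζ H` separate the conjugacy classes of
regular elements. -/
theorem IsCharacterCoefficients.mul_transfer_eq {F : T.Cat ⥤ TwistedRep H.subtype ζ}
    [F.IsEquivalence] {α : ConjClasses G → ConjClasses H → ℂ} (hα : IsCharacterCoefficients F α)
    (hψ : ψ.IsClassFunction) (hζ : ζ.IsClassFunction) {e : TwistedGroupAlgebra ψ}
    {τ : H → TwistedGroupAlgebra ψ} (hτ : IsBlockCorner F e τ) {f : G → ℂ}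
    (hf : ∀ g k, f (k * g * k⁻¹) = f g) (hreg : ∀ g, f g ≠ 0 → ψ.IsRegular g) {β : H → ℂ}
    (hβ : ∀ h : H, fiberSum π ψ f h * τ 1 = β h • τ h)
    (hβ0 : ∀ w ∉ H, fiberSum π ψ f w * τ 1 = 0) (hβreg : ∀ h, β h ≠ 0 → ζ.IsRegular h)
    (hβconj : ∀ h k, β (k * h * k⁻¹) = β h) {h : H} (hh : ζ.IsRegular h)
    [DecidableEq (ConjClasses W)]
    [Fintype (ConjClasses G)] :
    α (.mk 1) (.mk 1) * (ConjClasses.mk h).carrier.ncard * β h =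
      ∑ D : ConjClasses G, if D.map π = ConjClasses.mk (h : W) then
        α D (.mk h) * f D.rep * D.carrier.ncard else 0 := by
  classical
  have := Fintype.ofFinite H
  obtain ⟨c, -, hc1, hc⟩ := exists_trace_identity hτ hψ
  rw [hα.apply_one hζ hc1]
  have hmk : ∀ (g : G) (k : H), (ConjClasses.mk g).map π = ConjClasses.mk (k : W) ↔
      IsConj (π g) (k : W) := fun g k => ConjClasses.mk_eq_mk_iff_isConj
  let b' : H → ℂ := fun k => (∑ g, if IsConj (π g) (k : W) then
    f g * α (.mk g) (.mk k) else 0) / (ConjClasses.mk k).carrier.ncard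
  let b : H → ℂ := fun k => if ζ.IsRegular k ∧ IsConj (h : W) k then c * β k - b' k else 0
  have hb : b h = 0 := by
    refine eq_zero_of_sum_character F hζ (b := b) (fun k l => ?_) (fun k hk => ?_)
      (fun M hM => ?_) h
    · simp only [b, b', ConjClasses.mk_conj, TwoCocycle.isRegular_conj_iff, hβconj,
        Subgroup.coe_mul, Subgroup.coe_inv, isConj_conj_right]
    · by_contra h1
      exact hk (if_neg fun h2 => h1 h2.1)
    · have h1 := hc f β hf hreg hβ hβ0 M (h : W)
      have h2 : ∀ g, (if IsConj (h : W) (π g) then f g * M.obj.character g else 0) =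
          ∑ k : H, if ζ.IsRegular k ∧ IsConj (h : W) k then (if IsConj (π g) (k : W) then
            f g * α (.mk g) (.mk k) else 0) / (ConjClasses.mk k).carrier.ncard *
              (F.obj M).character k else 0 := fun g => by
        by_cases hg : IsConj (h : W) (π g)
        · rw [if_pos hg, hα g M hM, finsum_mul_character hζ, Finset.mul_sum]
          refine Finset.sum_congr rfl fun k _ => ?_
          have h3 : IsConj (h : W) k ↔ IsConj (π g) (k : W) :=
            ⟨fun h4 => hg.symm.trans h4, fun h4 => hg.trans h4⟩
          by_cases hk : ζ.IsRegular k ∧ IsConj (π g) (k : W)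
          · rw [if_pos hk, if_pos ⟨hk.1, h3.2 hk.2⟩, if_pos hk.2]
            ring
          · rw [if_neg hk, if_neg fun h4 => hk ⟨h4.1, h3.1 h4.2⟩, mul_zero]
        · rw [if_neg hg]
          refine (Finset.sum_eq_zero fun k _ => ?_).symm
          by_cases hk : ζ.IsRegular k ∧ IsConj (h : W) k
          · rw [if_pos hk, if_neg fun h3 => hg (hk.2.trans h3.symm), zero_div, zero_mul]
          · rw [if_neg hk]
      simp only [h2] at h1
      rw [Finset.sum_comm, Finset.mul_sum] at h1
      rw [← sub_eq_zero.2 h1.symm, ← Finset.sum_sub_distrib]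
      refine Finset.sum_congr rfl fun k _ => ?_
      by_cases hk : ζ.IsRegular k
      · by_cases hk' : IsConj (h : W) k
        · simp only [b, b']
          rw [if_pos hk', if_pos ⟨hk, hk'⟩]
          simp only [if_pos (And.intro hk hk'), Finset.sum_div, ← Finset.sum_mul]
          ring
        · simp only [b, hk', and_false, if_false, Finset.sum_const_zero, mul_zero, zero_mul,
          sub_self]
      · have h3 : β k = 0 := by
          by_contra h3
          exact hk (hβreg k h3)
        simp only [b, hk, h3, false_and, if_false, Finset.sum_const_zero, mul_zero, zero_mul,
          sub_self,
          ite_self]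
  have hb1 : c * β h - b' h = 0 := by
    rwa [show b h = c * β h - b' h from if_pos ⟨hh, IsConj.refl _⟩] at hb
  have h1 := ncard_carrier_ne_zero (ConjClasses.mk h)
  rw [sub_eq_zero, eq_div_iff h1] at hb1
  rw [mul_right_comm, hb1, sum_eq_sum_conjClasses fun g k => ?_]
  · refine Finset.sum_congr rfl fun D _ => ?_
    rw [D.mk_rep]
    have h2 := hmk D.rep h
    rw [D.mk_rep] at h2
    by_cases h3 : IsConj (π D.rep) (h : W)
    · rw [if_pos h3, if_pos (h2.2 h3)]
      ring
    · rw [if_neg h3, if_neg fun h4 => h3 (h2.1 h4), mul_zero]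
  · have h2 : IsConj (π (k * g * k⁻¹)) (h : W) ↔ IsConj (π g) (h : W) := by
      rw [map_mul, map_mul, map_inv, isConj_comm, isConj_conj_right, isConj_comm]
    simp only [hf, ConjClasses.mk_conj, h2]

end Coefficients

/-! ### The parameter of the corner algebra -/

section Parameter

variable {U : Type} [AddCommGroup U] [Module ℂ U] {ω : LinearMap.BilinForm ℂ U}
  {G W : Type} [Group G] [Group W] {π : G →* W} {ψ : TwoCocycle G}

theorem conj_mem_regularReflections_iff (φ : G →* Sp ω) (g k : G) :
    k * g * k⁻¹ ∈ regularReflections φ ψ ↔ g ∈ regularReflections φ ψ := by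
  have h1 : ((φ (k * g * k⁻¹) : Sp ω) : U ≃ₗ[ℂ] U) =
      (φ k : U ≃ₗ[ℂ] U) * φ g * (φ k : U ≃ₗ[ℂ] U)⁻¹ := by
    rw [map_mul, map_mul, map_inv]
    rfl
  rw [regularReflections, Set.mem_ofPred_eq, Set.mem_ofPred_eq, h1, finrank_range_idSub_conj,
    TwoCocycle.isRegular_conj_iff]

theorem carrier_subset_regularReflections_iff (φ : G →* Sp ω) (D : ConjClasses G) :
    D.carrier ⊆ regularReflections φ ψ ↔ D.rep ∈ regularReflections φ ψ := by
  refine ⟨fun h => h (ConjClasses.mem_carrier_iff_mk_eq.2 D.mk_rep), fun h g hg => ?_⟩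
  rw [ConjClasses.mem_carrier_iff_mk_eq, ← D.mk_rep, ConjClasses.mk_eq_mk_iff_isConj] at hg
  obtain ⟨k, rfl⟩ := isConj_iff.1 hg.symm
  exact (conj_mem_regularReflections_iff φ _ _).2 h

variable [Fintype G] [Fintype W] {T : ModuleSubcategory (FDRep ℂ W) (TwistedRep π ψ)}
  {H : Subgroup W} {ζ : TwoCocycle H}

/-- The parameter `c'` describes the action on the corner of the class sums that occur in the
relations of the twisted symplectic reflection algebra. -/
theorem IsCharacterCoefficients.eq_inducedParameter {F : T.Cat ⥤ TwistedRep H.subtype ζ}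
    [F.IsEquivalence] {α : ConjClasses G → ConjClasses H → ℂ} (hα : IsCharacterCoefficients F α)
    (hψ : ψ.IsClassFunction) (hζ : ζ.IsClassFunction) {e : TwistedGroupAlgebra ψ}
    {τ : H → TwistedGroupAlgebra ψ} (hτ : IsBlockCorner F e τ) (φ : G →* Sp ω) {c f : G → ℂ}
    (hfc : ∀ g ∈ regularReflections φ ψ, f g = c g)
    (hf0 : ∀ g ∉ regularReflections φ ψ, f g = 0)
    (hf : ∀ g k, f (k * g * k⁻¹) = f g) {β : H → ℂ}
    (hβ : ∀ h : H, fiberSum π ψ f h * τ 1 = β h • τ h)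
    (hβ0 : ∀ w ∉ H, fiberSum π ψ f w * τ 1 = 0) (hβreg : ∀ h, β h ≠ 0 → ζ.IsRegular h)
    (hβconj : ∀ h k, β (k * h * k⁻¹) = β h) {h : H} (hh : ζ.IsRegular h) :
    β h = inducedParameter φ π ψ c α h := by
  classical
  have := Fintype.ofFinite (ConjClasses G)
  have hreg : ∀ g, f g ≠ 0 → ψ.IsRegular g := fun g hg => by
    by_contra h
    exact hg (hf0 g fun h' => h h'.2)
  have h1 := hα.mul_transfer_eq hψ hζ hτ hf hreg hβ hβ0 hβreg hβconj hh
  have h2 : α (.mk 1) (.mk 1) ≠ 0 := by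
    obtain ⟨c, hc0, hc, -⟩ := exists_trace_identity hτ hψ
    rwa [hα.apply_one hζ hc]
  rw [inducedParameter, eq_div_iff (mul_ne_zero h2 (ncard_carrier_ne_zero _)), mul_comm, h1,
    finsum_eq_sum_of_fintype]
  refine Finset.sum_congr rfl fun D _ => ?_
  rw [finsum_eq_if]
  have h3 : D ∈ {D : ConjClasses G | D.carrier ⊆ regularReflections φ ψ ∧
      D.map π = ConjClasses.mk (h : W)} ↔
      D.rep ∈ regularReflections φ ψ ∧ D.map π = ConjClasses.mk (h : W) := by
    rw [Set.mem_ofPred_eq, carrier_subset_regularReflections_iff]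
  by_cases h4 : D.map π = ConjClasses.mk (h : W)
  · rw [if_pos h4]
    by_cases h5 : D.rep ∈ regularReflections φ ψ
    · rw [if_pos (h3.2 ⟨h5, h4⟩), hfc _ h5]
    · rw [if_neg fun h6 => h5 (h3.1 h6).1, hf0 _ h5, mul_zero, zero_mul]
  · rw [if_neg h4, if_neg fun h6 => h4 (h3.1 h6).2]

end Parameter

/-! ### The decomposition of the regular representation and the Morita equivalence -/

theorem mainTheorem1
    {U : Type} [AddCommGroup U] [Module ℂ U] [FiniteDimensional ℂ U]
    (ω : LinearMap.BilinForm ℂ U) (hω_alt : ω.IsAlt) (hω_nondeg : ω.Nondegenerate)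
    {G : Type} [Group G] [Finite G]
    (W : Subgroup (Sp ω)) (π : G →* W) (hπ : Function.Surjective π)
    (ψ : TwoCocycle G) (hψ : ψ.IsClassFunction)
    (c : G → ℂ)
    (hc : ∀ s ∈ regularReflections (W.subtype.comp π) ψ, ∀ g : G, c (g * s * g⁻¹) = c s)
    {ι : Type} [Fintype ι]
    (S : ι → ModuleSubcategory (FDRep ℂ W) (TwistedRep π ψ))
    (hS : ModuleSubcategory.IsDirectSum S)
    (hind : ∀ i, IsIndecomposableModuleCategory (FDRep ℂ W) (S i).Cat)
    (i : ι) (H : Subgroup W) (ζ : TwoCocycle H) (hζ : ζ.IsClassFunction)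
    (F : (S i).Cat ⥤ TwistedRep H.subtype ζ) [F.IsEquivalence] [F.LeftLinear (FDRep ℂ W)] :
    (∃! e : ι → TwistedGroupAlgebra ψ, IsBlockDecomposition S e) ∧
    (∃ α : ConjClasses G → ConjClasses H → ℂ, IsCharacterCoefficients F α) ∧
    ∀ (e : ι → TwistedGroupAlgebra ψ) (α : ConjClasses G → ConjClasses H → ℂ),
      IsBlockDecomposition S e → IsCharacterCoefficients F α →
      (∀ a : SRA (W.subtype.comp π) ψ c,
        Commute (SRA.ofGroupAlgebra (W.subtype.comp π) ψ c (e i)) a) ∧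
      ∃ he : IsIdempotentElem (SRA.ofGroupAlgebra (W.subtype.comp π) ψ c (e i)),
        IsMoritaEquivalent ℂ he.Corner
          (SRA (W.subtype.comp H.subtype) ζ
            (inducedParameter (W.subtype.comp π) π ψ c α)) := by
  classical
  have := Fintype.ofFinite G
  have : Finite W := Finite.of_surjective π hπ
  have := Fintype.ofFinite W
  obtain ⟨e₀, he₀⟩ := ModuleSubcategory.exists_isBlockDecomposition hS
  refine ⟨⟨e₀, he₀, fun e he => ModuleSubcategory.isBlockDecomposition_unique hS he he₀⟩, ?_, ?_⟩
  · obtain ⟨τ, hτ⟩ := ModuleSubcategory.exists_block_corner hS he₀ hπ F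
    exact exists_isCharacterCoefficients hψ hζ hτ
  intro e α he hα
  obtain ⟨τ, hτ⟩ := ModuleSubcategory.exists_block_corner hS he hπ F
  have hcomm := ModuleSubcategory.commute_block hS he i
  have hidem := ModuleSubcategory.block_mul_self hS he i
  refine ⟨SRA.commute_ofGroupAlgebra W.subtype c (ModuleSubcategory.block_mem_degPart hS he i)
    hcomm,
    by rw [IsIdempotentElem, ← map_mul, hidem], ?_⟩
  let f : G → ℂ := fun g => if g ∈ regularReflections (W.subtype.comp π) ψ then c g else 0
  have hfc : ∀ g ∈ regularReflections (W.subtype.comp π) ψ, f g = c g := fun g hg => if_pos hg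
  have hf0 : ∀ g ∉ regularReflections (W.subtype.comp π) ψ, f g = 0 := fun g hg => if_neg hg
  have hf : ∀ g k, f (k * g * k⁻¹) = f g := fun g k => by
    by_cases hg : g ∈ regularReflections (W.subtype.comp π) ψ
    · rw [hfc _ hg, hfc _ ((conj_mem_regularReflections_iff _ _ _).2 hg), hc g hg]
    · rw [hf0 _ hg, hf0 _ fun h => hg ((conj_mem_regularReflections_iff _ _ _).1 h)]
  have hreg : ∀ g, f g ≠ 0 → ψ.IsRegular g := fun g hg => by
    by_contra h
    exact hg (hf0 g fun h' => h h'.2)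
  obtain ⟨β, hβ, hβ0, hβreg, hβconj⟩ := hτ.toIsGradedCorner.exists_transfer hψ hζ hf hreg
  refine isMoritaEquivalent_corner_SRA (β := β) hτ.toIsGradedCorner hψ W.subtype hfc hf0 hf
    (fun h hh => hα.eq_inducedParameter hψ hζ hτ _ hfc hf0 hf hβ hβ0 hβreg hβconj hh.2)
    (fun h hh => ?_) hβ hβ0 hτ.mul_eq hcomm hτ.mem_span _
  -- If `β h ≠ 0`, then `h` is regular, and it is the image of an element of `S_ψ(G, U)`.
  by_contra h0
  have h1 : fiberSum π ψ f h ≠ 0 := fun h2 => by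
    have h3 := hβ h
    rw [h2, zero_mul] at h3
    exact (smul_ne_zero h0 (hτ.ne_zero' h)) h3.symm
  obtain ⟨g, -, hg⟩ := Finset.exists_ne_zero_of_sum_ne_zero h1
  have hgh : π g = h := by
    by_contra h2
    exact hg (if_neg h2)
  have hg' : g ∈ regularReflections (W.subtype.comp π) ψ := by
    by_contra h2
    rw [if_pos hgh, hf0 g h2, zero_smul] at hg
    exact hg rfl
  refine hh ⟨?_, hβreg h h0⟩
  have h2 := hg'.1
  rw [MonoidHom.comp_apply, hgh] at h2
  exact h2
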